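/- Let $\mathcal A$ be a sheaf of (not necessarily commutative) rings on a topological space $X$, let $Y\subset X$ be a locally closed subspace, and let $\mathcal B$ be the restriction of $\mathcal A$ to $Y$. Write $\mathrm{Mod}\,\mathcal A$ and $\mathrm{Mod}\,\mathcal B$ for the categories of sheaves of left modules. Restriction to $Y$ induces an equivalence from the full subcategory of $\mathrm{Mod}\,\mathcal A$ formed by the $\mathcal A$-modules supported on $Y$ (those whose stalks at all points of $X\setminus Y$ vanish) to $\mathrm{Mod}\,\mathcal B$; let $\iota:\mathrm{Mod}\,\mathcal B\to\mathrm{Mod}\,\mathcal A$ be the resulting fully faithful inclusion. Then $\iota$ is exact, the bifunctors $\mathrm{RHom}_{\mathcal A}$ and $\mathrm{RHom}_{\mathcal B}$ (the right derived functors of the Hom complex $\mathrm{Hom}^\bullet$, with values in the derived category $D\mathbb Z$ of abelian groups) are defined on the whole of the unbounded derived categories, i.e. on $D(\mathrm{Mod}\,\mathcal A)^{\mathrm{op}}\times D(\mathrm{Mod}\,\mathcal A)$ and $D(\mathrm{Mod}\,\mathcal B)^{\mathrm{op}}\times D(\mathrm{Mod}\,\mathcal B)$, and for all $V,W\in D(\mathrm{Mod}\,\mathcal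 B)$ the canonical morphism $$\mathrm{RHom}_{\mathcal B}(V,W)\longrightarrow \mathrm{RHom}_{\mathcal A}(\iota V,\iota W)$$ is an isomorphism in $D\mathbb Z$. Here the canonical morphism is the one, natural in $V$ and $W$, that is induced on derived functors by the maps of Hom complexes $\mathrm{Hom}^\bullet_{\mathcal B}(K,L)\to\mathrm{Hom}^\bullet_{\mathcal A}(\iota K,\iota L)$ given by applying $\iota$. -/

import Mathlib

open CategoryTheory Limits TopologicalSpace Opposite CochainComplex

universe w₁ w₂ w v u u₁ u₂

noncomputable section

section HomComplexes

/-- The map `Hom^•(K', L) ⟶ Hom^•(K, L')` induced by `f : K ⟶ K'` and `g : L ⟶ L'`,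
sending a cochain `z` to `f ≫ z ≫ g`. -/
def homComplexMap {G : Type u} [Category.{v} G] [Preadditive G]
    {K K' L L' : CochainComplex G ℤ} (f : K ⟶ K') (g : L ⟶ L') :
    HomComplex K' L ⟶ HomComplex K L' where
  f n := AddCommGrpCat.ofHom
    { toFun := fun z => ((HomComplex.Cochain.ofHom f).comp z (zero_add n)).comp
        (HomComplex.Cochain.ofHom g) (add_zero n)
      map_zero' := by simp
      map_add' := by intros; simp }
  comm' i j _ := by
    ext z
    exact (HomComplex.δ_comp_ofHom _ g j).trans
      (congrArg (fun t => HomComplex.Cochain.comp t (HomComplex.Cochain.ofHom g) (add_zero j))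
        (HomComplex.δ_ofHom_comp f z j))

theorem homComplexMap_id {G : Type u} [Category.{v} G] [Preadditive G]
    (K L : CochainComplex G ℤ) : homComplexMap (𝟙 K) (𝟙 L) = 𝟙 (HomComplex K L) := by
  have h : ∀ (n : ℤ) (z : HomComplex.Cochain K L n),
      ((HomComplex.Cochain.ofHom (𝟙 K)).comp z (zero_add n)).comp
        (HomComplex.Cochain.ofHom (𝟙 L)) (add_zero n) = z := by
    intro n z
    simp
  ext n z
  exact h n z

theorem homComplexMap_comp {G : Type u} [Category.{v} G] [Preadditive G]
    {K K' K'' L L' L'' : CochainComplex G ℤ} (f : K ⟶ K') (f' : K' ⟶ K'') (g : L ⟶ L')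
    (g' : L' ⟶ L'') :
    homComplexMap (f ≫ f') (g ≫ g') = homComplexMap f' g ≫ homComplexMap f g' := by
  have h : ∀ (n : ℤ) (z : HomComplex.Cochain K'' L n),
      ((HomComplex.Cochain.ofHom (f ≫ f')).comp z (zero_add n)).comp
        (HomComplex.Cochain.ofHom (g ≫ g')) (add_zero n) =
      ((HomComplex.Cochain.ofHom f).comp
        (((HomComplex.Cochain.ofHom f').comp z (zero_add n)).comp
          (HomComplex.Cochain.ofHom g) (add_zero n)) (zero_add n)).comp
        (HomComplex.Cochain.ofHom g') (add_zero n) := by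
    intro n z
    ext p q hpq
    simp [-HomComplex.Cochain.ofHom_comp]
  ext n z
  exact h n z

/-- The bifunctor `Hom^•`, contravariant in the first variable, on cochain complexes in a
preadditive category, with values in cochain complexes of abelian groups. -/
def homComplexFunctor (G : Type u) [Category.{v} G] [Preadditive G] :
    (CochainComplex G ℤ)ᵒᵖ × CochainComplex G ℤ ⥤ CochainComplex AddCommGrpCat.{v} ℤ where
  obj P := HomComplex P.1.unop P.2
  map φ := homComplexMap φ.1.unop φ.2
  map_id P := homComplexMap_id P.1.unop P.2
  map_comp φ ψ := homComplexMap_comp ψ.1.unop φ.1.unop φ.2 ψ.2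

/-- For an additive functor `F`, the natural map `Hom^•(K, L) ⟶ Hom^•(F K, F L)`. -/
def homComplexFunctorMap {G₂ : Type u₂} [Category.{v} G₂] [Preadditive G₂]
    {G₁ : Type u₁} [Category.{v} G₁] [Preadditive G₁] (F : G₂ ⥤ G₁) [F.Additive] :
    homComplexFunctor G₂ ⟶
      ((F.mapHomologicalComplex (ComplexShape.up ℤ)).op.prod
        (F.mapHomologicalComplex (ComplexShape.up ℤ))) ⋙ homComplexFunctor G₁ where
  app P :=
    { f := fun n => AddCommGrpCat.ofHom
        { toFun := fun z => HomComplex.Cochain.map z F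
          map_zero' := by simp
          map_add' := by intros; simp }
      comm' := fun i j _ => by
        ext z
        exact HomComplex.δ_map (n := i) j z F }
  naturality P P' φ := by
    have h : ∀ (n : ℤ) (z : HomComplex.Cochain P.1.unop P.2 n),
        HomComplex.Cochain.map (((HomComplex.Cochain.ofHom φ.1.unop).comp z (zero_add n)).comp
          (HomComplex.Cochain.ofHom φ.2) (add_zero n)) F =
        ((HomComplex.Cochain.ofHom
            ((F.mapHomologicalComplex (ComplexShape.up ℤ)).map φ.1.unop)).comp
          (HomComplex.Cochain.map z F) (zero_add n)).comp
          (HomComplex.Cochain.ofHom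
            ((F.mapHomologicalComplex (ComplexShape.up ℤ)).map φ.2)) (add_zero n) := by
      intro n z
      ext p q hpq
      simp
    ext n z
    exact h n z

end HomComplexes

section DerivedHom

/-- Pairs of quasi-isomorphisms, in `Ch(G)ᵒᵖ × Ch(G)`. -/
abbrev pairQuasiIso (G : Type u) [Category.{v} G] [Abelian G] :
    MorphismProperty ((CochainComplex G ℤ)ᵒᵖ × CochainComplex G ℤ) :=
  (HomologicalComplex.quasiIso G (ComplexShape.up ℤ)).op.prod
    (HomologicalComplex.quasiIso G (ComplexShape.up ℤ))

/-- The localization functor `Ch(G)ᵒᵖ × Ch(G) ⥤ D(G)ᵒᵖ × D(G)`. -/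
abbrev pairQ (G : Type u) [Category.{v} G] [Abelian G] [HasDerivedCategory.{w} G] :
    (CochainComplex G ℤ)ᵒᵖ × CochainComplex G ℤ ⥤ (DerivedCategory G)ᵒᵖ × DerivedCategory G :=
  (DerivedCategory.Q (C := G)).op.prod (DerivedCategory.Q (C := G))

/-- The bifunctor `Hom^•` of a category `G`, with values in `D(ℤ)`. -/
abbrev homToDerived (G : Type u) [Category.{v} G] [Preadditive G]
    [HasDerivedCategory.{w} AddCommGrpCat.{v}] :
    (CochainComplex G ℤ)ᵒᵖ × CochainComplex G ℤ ⥤ DerivedCategory AddCommGrpCat.{v} :=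
  homComplexFunctor G ⋙ DerivedCategory.Q

/-- `RHom` is defined on the whole of `D(G)ᵒᵖ × D(G)` (no boundedness condition). -/
abbrev HasRHom (G : Type u) [Category.{v} G] [Abelian G]
    [HasDerivedCategory.{w} AddCommGrpCat.{v}] : Prop :=
  (homToDerived G).HasRightDerivedFunctor (pairQuasiIso G)

/-- `RHom : D(G)ᵒᵖ × D(G) ⥤ D(ℤ)`, the total right derived functor of `Hom^•`. -/
abbrev RHom (G : Type u) [Category.{v} G] [Abelian G] [HasDerivedCategory.{w₁} G]
    [HasDerivedCategory.{w} AddCommGrpCat.{v}] [HasRHom G] :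
    (DerivedCategory G)ᵒᵖ × DerivedCategory G ⥤ DerivedCategory AddCommGrpCat.{v} :=
  (homToDerived G).totalRightDerived (pairQ G) (pairQuasiIso G)

/-- The canonical map `Hom^•(K, L) ⟶ RHom(K, L)` in `D(ℤ)`. -/
abbrev RHomUnit (G : Type u) [Category.{v} G] [Abelian G] [HasDerivedCategory.{w₁} G]
    [HasDerivedCategory.{w} AddCommGrpCat.{v}] [HasRHom G] :
    homToDerived G ⟶ pairQ G ⋙ RHom G :=
  (homToDerived G).totalRightDerivedUnit (pairQ G) (pairQuasiIso G)

section Comparison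

variable {G₂ : Type u₂} [Category.{v} G₂] [Abelian G₂] [HasDerivedCategory.{w₂} G₂]
  {G₁ : Type u₁} [Category.{v} G₁] [Abelian G₁] [HasDerivedCategory.{w₁} G₁]
  [HasDerivedCategory.{w} AddCommGrpCat.{v}]
  (F : G₂ ⥤ G₁) [F.Additive] [PreservesFiniteLimits F] [PreservesFiniteColimits F]

/-- The natural isomorphism in `D(G₁)ᵒᵖ × D(G₁)` between `(F K, F L)` and `(DF K, DF L)`, where
`F` is exact and `DF` denotes the functor which it induces on derived categories. -/
def pairFactors :
    ((F.mapHomologicalComplex (ComplexShape.up ℤ)).op.prod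
        (F.mapHomologicalComplex (ComplexShape.up ℤ))) ⋙ pairQ G₁ ≅
      pairQ G₂ ⋙ F.mapDerivedCategory.op.prod F.mapDerivedCategory :=
  NatIso.prod (NatIso.op F.mapDerivedCategoryFactors) F.mapDerivedCategoryFactors.symm

/-- The natural map
`Hom^•_{G₂}(K, L) ⟶ Hom^•_{G₁}(F K, F L) ⟶ RHom_{G₁}(F K, F L) ≅ RHom_{G₁}(DF K, DF L)`. -/
def homToRHom [HasRHom G₁] :
    homToDerived G₂ ⟶
      pairQ G₂ ⋙ (F.mapDerivedCategory.op.prod F.mapDerivedCategory) ⋙ RHom G₁ :=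
  Functor.whiskerRight (homComplexFunctorMap F) DerivedCategory.Q ≫
    (Functor.associator _ _ _).hom ≫
    Functor.whiskerLeft _ (RHomUnit G₁) ≫
    (Functor.associator _ _ _).inv ≫
    Functor.whiskerRight (pairFactors F).hom (RHom G₁) ≫
    (Functor.associator _ _ _).hom

/-- The canonical map `RHom_{G₂}(V, W) ⟶ RHom_{G₁}(DF V, DF W)`, natural in `V` and `W` in
`D(G₂)`: the one which extends `Hom^•_{G₂}(K, L) ⟶ RHom_{G₁}(DF K, DF L)`. -/
def RHomComparison [HasRHom G₁] [HasRHom G₂] :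
    RHom G₂ ⟶ (F.mapDerivedCategory.op.prod F.mapDerivedCategory) ⋙ RHom G₁ :=
  (RHom G₂).rightDerivedDesc (RHomUnit G₂) (pairQuasiIso G₂) _ (homToRHom F)

end Comparison

/-- Condition (R) for the inclusion `F` of `G₂` in `G₁`: `F` is exact, both `RHom_{G₁}` and
`RHom_{G₂}` are defined on the whole (unbounded) derived categories, and the canonical map
`RHom_{G₂}(V, W) ⟶ RHom_{G₁}(V, W)` is an isomorphism in `D(ℤ)` for all `V`, `W` in `D(G₂)`. -/
def SatisfiesR {G₂ : Type u₂} [Category.{v} G₂] [Abelian G₂] [HasDerivedCategory.{w₂} G₂]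
    {G₁ : Type u₁} [Category.{v} G₁] [Abelian G₁] [HasDerivedCategory.{w₁} G₁]
    [HasDerivedCategory.{w} AddCommGrpCat.{v}] (F : G₂ ⥤ G₁) [F.Additive] : Prop :=
  ∃ (_ : PreservesFiniteLimits F) (_ : PreservesFiniteColimits F)
    (_ : HasRHom G₁) (_ : HasRHom G₂),
    ∀ V W : DerivedCategory G₂, IsIso ((RHomComparison F).app (op V, W))

end DerivedHom

section Sheaves

section Pullback

variable {X Z : TopCat.{u}} (f : Z ⟶ X) (A : Sheaf (Opens.grothendieckTopology X) RingCat.{u})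

/-- The inverse image `f⁻¹ A` of a sheaf of rings. -/
def pullbackRing : Sheaf (Opens.grothendieckTopology Z) RingCat.{u} :=
  (TopCat.Sheaf.pullback RingCat.{u} f).obj A

/-- The canonical map `A ⟶ f_* f⁻¹ A`. -/
def pullbackRingUnit :
    A ⟶ ((Opens.map f).sheafPushforwardContinuous RingCat.{u}
      (Opens.grothendieckTopology X) (Opens.grothendieckTopology Z)).obj (pullbackRing f A) :=
  (TopCat.Sheaf.pullbackPushforwardAdjunction RingCat.{u} f).unit.app A

instance presheafPushforward_isRightAdjoint :
    (PresheafOfModules.pushforward.{u} (pullbackRingUnit f A).hom).IsRightAdjoint := by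
  let φ : A.obj ⟶ (Opens.map f).op ⋙ (pullbackRing f A).obj := (pullbackRingUnit f A).hom
  have h : (PresheafOfModules.pushforward.{u} φ).IsRightAdjoint := inferInstance
  exact h

/-- The inverse image functor from `A`-modules to `f⁻¹ A`-modules. -/
def pullbackModules : SheafOfModules.{u} A ⥤ SheafOfModules.{u} (pullbackRing f A) :=
  SheafOfModules.pullback (pullbackRingUnit f A)

instance pullbackModules_additive : (pullbackModules f A).Additive := by
  have : (SheafOfModules.pushforward.{u} (pullbackRingUnit f A)).Additive := ⟨fun {_ _ _ _} => rfl⟩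
  exact (SheafOfModules.pullbackPushforwardAdjunction
    (pullbackRingUnit f A)).left_adjoint_additive

end Pullback

section Restriction

variable {X : TopCat.{u}} (A : Sheaf (Opens.grothendieckTopology X) RingCat.{u}) (Y : Set X)

/-- The subset `Y` of `X`, with the subspace topology. -/
def subspace {X : TopCat.{u}} (Y : Set X) : TopCat.{u} :=
  TopCat.of Y

/-- The inclusion of a subspace. -/
def subspaceIncl {X : TopCat.{u}} (Y : Set X) : subspace Y ⟶ X :=
  TopCat.ofHom ⟨fun y : Y => (y : X), continuous_subtype_val⟩

/-- The restriction of the sheaf of rings `A` to the subspace `Y`. -/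
abbrev restrictRing : Sheaf (Opens.grothendieckTopology (subspace Y)) RingCat.{u} :=
  pullbackRing (subspaceIncl Y) A

/-- An `A`-module is supported on `Y` if its stalks at the points outside `Y` vanish. -/
def supportedOn : ObjectProperty (SheafOfModules.{u} A) := fun M =>
  ∀ x : X, x ∉ Y → IsZero (TopCat.Presheaf.stalk (C := AddCommGrpCat.{u}) M.val.presheaf x)

/-- The restriction functor, from the full subcategory of `A`-modules supported on `Y` to
modules over the restriction of `A` to `Y`. -/
def restrictSupported : (supportedOn A Y).FullSubcategory ⥤ SheafOfModules.{u} (restrictRing A Y) :=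
  (supportedOn A Y).ι ⋙ pullbackModules (subspaceIncl Y) A

instance restrictSupported_additive : (restrictSupported A Y).Additive := by
  unfold restrictSupported
  infer_instance

/-- The inclusion of `Mod B` in `Mod A`, where `B` is the restriction of `A` to `Y`, obtained by
identifying `Mod B` with the full subcategory of `A`-modules supported on `Y`, by means of the
restriction functor. -/
def inclusionOfRestriction [(restrictSupported A Y).IsEquivalence] :
    SheafOfModules.{u} (restrictRing A Y) ⥤ SheafOfModules.{u} A :=
  (restrictSupported A Y).inv ⋙ (supportedOn A Y).ι

instance inclusionOfRestriction_additive [(restrictSupported A Y).IsEquivalence] :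
    (inclusionOfRestriction A Y).Additive := by
  have : (restrictSupported A Y).asEquivalence.functor.Additive := restrictSupported_additive A Y
  have : (restrictSupported A Y).inv.Additive :=
    (restrictSupported A Y).asEquivalence.inverse_additive
  unfold inclusionOfRestriction
  infer_instance

end Restriction

end Sheaves

end

/-! Write `j` for the inclusion of `Y`, `T` for `closure Y \ Y` and `k` for the inclusion of `T`.
Local closedness of `Y` means exactly that `T` is closed.

Because the rings are restricted along with the modules, inverse images do not change stalks, so
`j⁻¹` and `k⁻¹` are exact; `k_*` is exact because `T` is closed. For `V` in `Mod B` the natural map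
`ιV ⟶ j_* V` is an isomorphism on stalks over `Y`, hence a monomorphism, and its cokernel `Q` is
supported on `T`, so `Q ≅ k_* k⁻¹ Q`. Since `k⁻¹ ι = 0`, nothing maps from a complex `ιK` to a
complex of such `Q`, even in the derived category (`derivedCategory_hom_eq_zero`).

Let `I` be K-injective over `B`. Then `j_* I` is K-injective, as `j⁻¹` is exact, and `Hom_D(ιK, ιI)
≅ Hom_D(ιK, j_* I)` is the group of homotopy classes from `ιK` to `j_* I`. By adjunction and `j⁻¹ ι
≅ id` these are the homotopy classes from `K` to `I`, that is, `Hom_D(K, I)`. So the derived functor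
of `ι` is bijective on these morphisms (`bijective_mapDerivedCategory_map`). Applied to all shifts
of `I`, this says that the comparison of `RHom`'s is an isomorphism on every cohomology group
(`isIso_RHomComparison_app`).

`RHom` exists on unbounded derived categories because complexes in a Grothendieck abelian category
have functorial K-injective resolutions (`exists_functorial_isKInjective_resolution`). These come
from the small object argument, once the acyclic monomorphisms are shown to have the same right
lifting property as a set of them (`smallAcyclicMonos_rlp`). For this, every proper acyclic
monomorphism into `Y` is enlarged inside `Y` by a pushout of a member of the set, and the process is
iterated transfinitely. -/

noncomputable section

/-! ### Acyclic monomorphisms and their lifting properties. -/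

namespace CochainComplex

section Lifting

open ZeroObject

variable {C : Type u} [Category.{v} C] [Abelian C]

open HomComplex in
/-- A monomorphism which is a quasi-isomorphism lifts against a degreewise epimorphism with
injective and K-injective kernel. -/
theorem hasLiftingProperty_of_isKInjective_kernel {A B X Y : CochainComplex C ℤ}
    (i : A ⟶ B) (p : X ⟶ Y) [Mono i] [QuasiIso i] (hp : degreewiseEpiWithInjectiveKernel p)
    [(kernel p).IsKInjective] : HasLiftingProperty i p where
  sq_hasLift {t b} sq := by
    have sq' (n : ℤ) : CommSq (t.f n) (i.f n) (p.f n) (b.f n) :=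
      (sq.map (HomologicalComplex.eval _ _ n))
    have (n : ℤ) : (sq' n).HasLift := by
      have := (hp n).hasLiftingProperty (i.f n)
      infer_instance
    -- Injectivity of the kernels gives lifts degree by degree; their failure to commute with the
    -- differentials is the cocycle `β`. As `cokernel i` is acyclic and `kernel p` is K-injective,
    -- `β` is a coboundary `δ α`, and `α` corrects the lifts.
    let β : Cocycle (cokernel i) (kernel p) 1 :=
      Lifting.cocycle₁ sq (fun n ↦ { l := (sq' n).lift, fac_left := (sq' n).fac_left, fac_right := (sq' n).fac_right })
        (cokernelIsCokernel i) (kernelIsKernel p) (hπ := by simp) (hι := by simp)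
    obtain ⟨α, hα⟩ : ∃ (α : Cochain (cokernel i) (kernel p) 0), δ 0 1 α = β.1 := by
      refine IsKInjective.eq_δ_of_cocycle β ?_ 0 (by simp)
      have : (ShortComplex.mk _ _ (cokernel.condition i)).ShortExact :=
        { exact := ShortComplex.exact_cokernel i }
      exact this.acyclic_X₃ (by dsimp; infer_instance)
    exact Lifting.hasLift sq _ (cokernelIsCokernel _) (kernelIsKernel _) α hα

/-- The monomorphisms of cochain complexes which are quasi-isomorphisms. -/
def acyclicMonos (C : Type u) [Category.{v} C] [Abelian C] :
    MorphismProperty (CochainComplex C ℤ) :=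
  fun _ _ f => Mono f ∧ QuasiIso f

theorem up_rel (n : ℤ) : (ComplexShape.up ℤ).Rel n (n + 1) := rfl

/-- The contractible complex `I = I` in degrees `n, n + 1`. -/
def disc (I : C) (n : ℤ) : CochainComplex C ℤ :=
  HomologicalComplex.double (𝟙 I) (up_rel n)

/-- The degree `n` part of `disc I n`. -/
def discXIso₀ (I : C) (n : ℤ) : (disc I n).X n ≅ I :=
  HomologicalComplex.doubleXIso₀ _ _

/-- The degree `n + 1` part of `disc I n`. -/
def discXIso₁ (I : C) (n : ℤ) : (disc I n).X (n + 1) ≅ I :=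
  HomologicalComplex.doubleXIso₁ _ _ (by simp)

theorem disc_d (I : C) (n : ℤ) :
    (disc I n).d n (n + 1) = (discXIso₀ I n).hom ≫ (discXIso₁ I n).inv :=
  (HomologicalComplex.double_d (𝟙 I) (up_rel n) (by simp)).trans
    (congrArg _ (Category.id_comp _))

theorem disc_d_eq_zero (I : C) (n i j : ℤ) (hi : i ≠ n) : (disc I n).d i j = 0 :=
  HomologicalComplex.double_d_eq_zero₀ _ _ _ _ hi

theorem isZero_disc_X (I : C) (n m : ℤ) (h₀ : m ≠ n) (h₁ : m ≠ n + 1) :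
    IsZero ((disc I n).X m) :=
  HomologicalComplex.isZero_double_X _ _ m h₀ h₁

/-- The complex `I` in degree `n`. -/
def sphere (I : C) (n : ℤ) : CochainComplex C ℤ :=
  (HomologicalComplex.single C (ComplexShape.up ℤ) n).obj I

/-- The degree `n` part of `sphere I n`. -/
def sphereXIso (I : C) (n : ℤ) : (sphere I n).X n ≅ I :=
  HomologicalComplex.singleObjXSelf (ComplexShape.up ℤ) n I

theorem isZero_sphere_X (I : C) (n m : ℤ) (hm : m ≠ n) : IsZero ((sphere I n).X m) :=
  HomologicalComplex.isZero_single_obj_X _ _ _ _ hm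

/-- The map from the contractible complex `I = I` in degrees `n, n + 1` to `I` in degree `n`. -/
def discToSphere (I : C) (n : ℤ) : disc I n ⟶ sphere I n :=
  HomologicalComplex.mkHomFromDouble _ (by simp) (sphereXIso I n).inv 0
    ((isZero_sphere_X I n (n + 1) (by lia)).eq_of_tgt _ _)
    (by intros; exact zero_comp)

theorem discToSphere_f (I : C) (n : ℤ) :
    (discToSphere I n).f n = (discXIso₀ I n).hom ≫ (sphereXIso I n).inv :=
  HomologicalComplex.mkHomFromDouble_f₀ _ _ _ _ _ _

theorem isIso_discToSphere_f (I : C) (n : ℤ) : IsIso ((discToSphere I n).f n) := by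
  rw [discToSphere_f]
  infer_instance

instance (I : C) (n : ℤ) [Injective I] (m : ℤ) : Injective ((disc I n).X m) := by
  by_cases h₀ : m = n
  · subst h₀
    exact Injective.of_iso (discXIso₀ I m).symm inferInstance
  by_cases h₁ : m = n + 1
  · subst h₁
    exact Injective.of_iso (HomologicalComplex.doubleXIso₁ _ _ (by simp)).symm inferInstance
  exact (isZero_disc_X I n m h₀ h₁).injective

instance isStrictlyGE_disc (I : C) (n : ℤ) : (disc I n).IsStrictlyGE n := by
  rw [isStrictlyGE_iff]
  intro i hi
  exact isZero_disc_X I n i (by lia) (by lia)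

/-- The lower bound on `X` passes to the kernel, and a bounded below complex of injectives is
K-injective. -/
theorem hasLiftingProperty_of_injective_kernel {A B X Y : CochainComplex C ℤ} (i : A ⟶ B)
    (p : X ⟶ Y) [Mono i] [QuasiIso i] (hp : degreewiseEpiWithInjectiveKernel p) (n : ℤ)
    [X.IsStrictlyGE n] : HasLiftingProperty i p := by
  have (m : ℤ) : Injective ((kernel p).X m) := Injective.of_iso
    (asIso (kernelComparison p (HomologicalComplex.eval _ _ m))).symm (hp m).2
  have : (kernel p).IsStrictlyGE n := by
    rw [isStrictlyGE_iff]
    intro i hi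
    rw [IsZero.iff_id_eq_zero, ← cancel_mono ((kernel.ι p).f i)]
    exact (CochainComplex.isZero_of_isStrictlyGE _ n i).eq_of_tgt _ _
  have : (kernel p).IsKInjective := isKInjective_of_injective _ n
  exact hasLiftingProperty_of_isKInjective_kernel i _ hp

theorem degreewiseEpiWithInjectiveKernel_discToSphere (I : C) [Injective I] (n : ℤ) :
    degreewiseEpiWithInjectiveKernel (discToSphere I n) := by
  intro m
  by_cases hm : m = n
  · subst hm
    have := isIso_discToSphere_f I m
    exact ⟨inferInstance, (isZero_kernel_of_mono _).injective⟩
  · have h₁ := isZero_sphere_X I n m hm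
    have : (discToSphere I n).f m = 0 := h₁.eq_of_tgt _ _
    refine ⟨⟨fun _ _ _ => h₁.eq_of_src _ _⟩, ?_⟩
    rw [this]
    exact Injective.of_iso kernelZeroIsoSource.symm inferInstance

theorem hasLiftingProperty_discToSphere {A B : CochainComplex C ℤ} (i : A ⟶ B) [Mono i]
    [QuasiIso i] (I : C) [Injective I] (n : ℤ) : HasLiftingProperty i (discToSphere I n) :=
  hasLiftingProperty_of_injective_kernel i _ (degreewiseEpiWithInjectiveKernel_discToSphere I n) n

theorem hasLiftingProperty_disc_zero {A B : CochainComplex C ℤ} (i : A ⟶ B) [Mono i]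
    [QuasiIso i] (I : C) [Injective I] (n : ℤ) :
    HasLiftingProperty i (0 : disc I n ⟶ 0) := by
  refine hasLiftingProperty_of_injective_kernel i _ ?_ n
  rw [degreewiseEpiWithInjectiveKernel_iff_of_isZero _ (isZero_zero _)]
  infer_instance

/-- Maps of complexes from `K` to `disc I n` correspond to maps `K.X (n + 1) ⟶ I`. -/
theorem exists_hom_disc (K : CochainComplex C ℤ) (I : C) (n : ℤ) (f : K.X (n + 1) ⟶ I) :
    ∃ g : K ⟶ disc I n, g.f (n + 1) ≫ (discXIso₁ I n).hom = f := by
  let φ (m : ℤ) : K.X m ⟶ (disc I n).X m :=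
    if h : m = n then
      eqToHom (by rw [h]) ≫ K.d n (n + 1) ≫ f ≫ (discXIso₀ I n).inv ≫ eqToHom (by rw [h])
    else if h : m = n + 1 then
      eqToHom (by rw [h]) ≫ f ≫ (discXIso₁ I n).inv ≫ eqToHom (by rw [h])
    else 0
  have h₀ : φ n = K.d n (n + 1) ≫ f ≫ (discXIso₀ I n).inv := by simp [φ]
  have h₁ : φ (n + 1) = f ≫ (discXIso₁ I n).inv := by simp [φ]
  refine ⟨{ f := φ, comm' := ?_ }, ?_⟩
  · rintro i j (rfl : i + 1 = j)
    by_cases hi : i = n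
    · subst hi
      rw [h₀, h₁, disc_d]
      simp
    · rw [disc_d_eq_zero _ _ _ _ hi, comp_zero]
      by_cases hi' : i + 1 = n
      · subst hi'
        rw [h₀, ← Category.assoc, HomologicalComplex.d_comp_d, zero_comp]
      · exact (isZero_disc_X I n (i + 1) hi' (fun h => hi (by simpa using h))).eq_of_tgt _ _
  · dsimp only
    rw [h₁, Category.assoc, Iso.inv_hom_id, Category.comp_id]

theorem quasiIso_f_of_shortExact {S : ShortComplex (CochainComplex C ℤ)} (hS : S.ShortExact)
    (h : HomologicalComplex.Acyclic S.X₃) : QuasiIso S.f := by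
  rw [quasiIso_iff]
  intro n
  rw [quasiIsoAt_iff_isIso_homologyMap]
  have h₀ (m : ℤ) := (HomologicalComplex.exactAt_iff_isZero_homology _ _).1 (h m)
  have : Mono (HomologicalComplex.homologyMap S.f n) :=
    (hS.homology_exact₁ (n - 1) n (by simp)).mono_g ((h₀ (n - 1)).eq_of_src _ _)
  have : Epi (HomologicalComplex.homologyMap S.f n) :=
    (hS.homology_exact₂ n).epi_f ((h₀ n).eq_of_tgt _ _)
  exact isIso_of_mono_of_epi _

open HomComplex in
/-- If `Z` is injective relatively to acyclic monomorphisms, then `Z` is K-injective. -/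
theorem isKInjective_of_acyclicMonos_rlp {Z Z' : CochainComplex C ℤ} (hZ' : IsZero Z')
    {p : Z ⟶ Z'} (hp : (acyclicMonos C).rlp p) : Z.IsKInjective where
  nonempty_homotopy_zero {N} f hN := by
    -- Since `N` is acyclic, its inclusion in the contractible cone of `𝟙 N` is an acyclic
    -- monomorphism. An extension of `f` to the cone, restricted to the other summand, is a
    -- null-homotopy of `f`.
    have : Mono (mappingCone.inr (𝟙 N)) := by
      have h (n : ℤ) : Mono ((mappingCone.inr (𝟙 N)).f n) :=
        mono_of_mono_fac (mappingCone.inr_f_snd_v (𝟙 N) n)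
      exact HomologicalComplex.mono_of_mono_f _ h
    have : QuasiIso (mappingCone.inr (𝟙 N)) := by
      rw [quasiIso_iff]
      intro n
      rw [quasiIsoAt_iff_isIso_homologyMap]
      have h₁ : IsZero (N.homology n) := (hN n).isZero_homology
      have h₂ : IsZero ((mappingCone (𝟙 N)).homology n) := by
        rw [IsZero.iff_id_eq_zero, ← HomologicalComplex.homologyMap_id,
          (mappingCone.homotopyToZeroOfId N).homologyMap_eq n, HomologicalComplex.homologyMap_zero]
      exact ⟨0, h₁.eq_of_src _ _, h₂.eq_of_src _ _⟩
    have sq : CommSq f (mappingCone.inr (𝟙 N)) p 0 := ⟨hZ'.eq_of_tgt _ _⟩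
    have := hp _ (show acyclicMonos C (mappingCone.inr (𝟙 N)) from ⟨inferInstance, inferInstance⟩)
    refine ⟨(Cochain.equivHomotopy f 0).symm
      ⟨(mappingCone.inl (𝟙 N)).comp (Cochain.ofHom sq.lift) (by lia), ?_⟩⟩
    rw [δ_comp_ofHom, mappingCone.δ_inl, ← Cochain.ofHom_comp]
    simp

variable [EnoughInjectives C]

/-- Test against `disc I n ⟶ 0` for `I` an injective object containing `K.X (n + 1)`: the embedding,
seen as a map from `K` to the disc, extends to `L`, so `i` is a monomorphism in degree `n + 1`. -/
theorem mono_of_acyclicMonos_rlp_llp {K L : CochainComplex C ℤ} {i : K ⟶ L}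
    (hi : (acyclicMonos C).rlp.llp i) : Mono i := by
  have h (n : ℤ) : Mono (i.f (n + 1)) := by
    obtain ⟨g, hg⟩ := exists_hom_disc K (Injective.under (K.X (n + 1))) n (Injective.ι _)
    have sq : CommSq g i (0 : disc (Injective.under (K.X (n + 1))) n ⟶ 0) 0 := ⟨by simp⟩
    have := hi (0 : disc (Injective.under (K.X (n + 1))) n ⟶ 0) (by
      rintro A B j ⟨_, _⟩
      exact hasLiftingProperty_disc_zero j _ n)
    have fac : i.f (n + 1) ≫ sq.lift.f (n + 1) = g.f (n + 1) := by
      rw [← HomologicalComplex.comp_f, sq.fac_left]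
    have : Mono (i.f (n + 1) ≫ sq.lift.f (n + 1) ≫
        (discXIso₁ (Injective.under (K.X (n + 1))) n).hom) := by
      rw [reassoc_of% fac, hg]
      infer_instance
    exact mono_of_mono _ (sq.lift.f (n + 1) ≫ (discXIso₁ (Injective.under (K.X (n + 1))) n).hom)
  refine @HomologicalComplex.mono_of_mono_f _ _ _ _ _ _ _ i (fun n => ?_)
  have := h (n - 1)
  rwa [show n - 1 + 1 = n by lia] at this

/-- Test against `disc I n ⟶ sphere I n` for `I` an injective object containing the opcycles of the
cokernel `E`. The lift makes the embedding of the opcycles in `I` factor through `E.fromOpcycles`,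
so that map is a monomorphism and its kernel, the homology of `E`, vanishes. -/
theorem quasiIso_of_acyclicMonos_rlp_llp {K L : CochainComplex C ℤ} {i : K ⟶ L}
    (hi : (acyclicMonos C).rlp.llp i) : QuasiIso i := by
  have := mono_of_acyclicMonos_rlp_llp hi
  let E := cokernel i
  let π : L ⟶ E := cokernel.π i
  have hS : (ShortComplex.mk _ _ (cokernel.condition i)).ShortExact :=
    { exact := ShortComplex.exact_cokernel i }
  suffices HomologicalComplex.Acyclic E by
    exact quasiIso_f_of_shortExact hS this
  intro n
  let I := Injective.under (E.opcycles n)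
  let u : E.X n ⟶ I := E.pOpcycles n ≫ Injective.ι _
  let u' : E ⟶ sphere I n := HomologicalComplex.mkHomToSingle u (fun m _ => by
    rw [HomologicalComplex.d_pOpcycles_assoc, zero_comp])
  have hu' : u'.f n = u ≫ (sphereXIso I n).inv := HomologicalComplex.mkHomToSingle_f _ _
  have sq : CommSq 0 i (discToSphere I n) (π ≫ u') := ⟨by simp [π]⟩
  have := hi (discToSphere I n) (by
    rintro A B j ⟨_, _⟩
    exact hasLiftingProperty_discToSphere j _ n)
  let l : E ⟶ disc I n := cokernel.desc i sq.lift sq.fac_left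
  have hl : l ≫ discToSphere I n = u' := by
    rw [← cancel_epi π, ← sq.fac_right, cokernel.π_desc_assoc]
  have hl' : l.f n ≫ (discXIso₀ I n).hom = u := by
    have := congrArg (fun t => HomologicalComplex.Hom.f t n) hl
    rw [HomologicalComplex.comp_f, hu', discToSphere_f, ← Category.assoc,
      cancel_mono] at this
    exact this
  have hl'' : E.fromOpcycles n (n + 1) ≫ l.f (n + 1) ≫ (discXIso₁ I n).hom =
      Injective.ι _ := by
    rw [← cancel_epi (E.pOpcycles n), HomologicalComplex.p_fromOpcycles_assoc, ← l.comm_assoc,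
      disc_d]
    simpa using hl'
  rw [HomologicalComplex.exactAt_iff_isZero_homology, IsZero.iff_id_eq_zero,
    ← cancel_mono (E.homologyι n), ← cancel_mono (Injective.ι (E.opcycles n)), ← hl'']
  simp

/-- The class of monomorphisms which are quasi-isomorphisms is determined by its right lifting
property. -/
theorem acyclicMonos_rlp_llp : (acyclicMonos C).rlp.llp = acyclicMonos C :=
  le_antisymm (fun _ _ _ hi => ⟨mono_of_acyclicMonos_rlp_llp hi,
    quasiIso_of_acyclicMonos_rlp_llp hi⟩) (MorphismProperty.le_llp_rlp _)

end Lifting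
end CochainComplex

/-! ### Complexes built by attaching discs. -/

namespace CochainComplex

section Tower

variable {C : Type u₁} [Category.{u} C] [Abelian C]

/-- The map `disc G n ⟶ K` corresponding to `f : G ⟶ K.X n`. -/
def discDesc {G : C} {n : ℤ} {K : CochainComplex C ℤ} (f : G ⟶ K.X n) : disc G n ⟶ K :=
  HomologicalComplex.mkHomFromDouble _ (by simp) f (f ≫ K.d n (n + 1)) (by simp)
    (by intros; simp)

theorem discDesc_f {G : C} {n : ℤ} {K : CochainComplex C ℤ} (f : G ⟶ K.X n) :
    (discDesc f).f n = (discXIso₀ G n).hom ≫ f :=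
  HomologicalComplex.mkHomFromDouble_f₀ _ _ _ _ _ _

variable [IsGrothendieckAbelian.{u} C] (G : C)

/-- Attach to `K` a copy of `disc G (m - 1)` for each map `G ⟶ K.X m`. -/
def attachDiscs (K : CochainComplex C ℤ) : CochainComplex C ℤ :=
  K ⨿ ∐ (fun x : Σ m : ℤ, (G ⟶ K.X m) => disc G (x.1 - 1))

/-- The inclusion of `K` in `attachDiscs G K`. -/
def toAttachDiscs (K : CochainComplex C ℤ) : K ⟶ attachDiscs G K := coprod.inl

/-- The inclusion of a disc. -/
def discToAttachDiscs (K : CochainComplex C ℤ) {m : ℤ} (a : G ⟶ K.X m) :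
    disc G (m - 1) ⟶ attachDiscs G K :=
  Sigma.ι (fun x : Σ m : ℤ, (G ⟶ K.X m) => disc G (x.1 - 1)) ⟨m, a⟩ ≫ coprod.inr

variable {G}

/-- Extend a morphism to `attachDiscs G K`. -/
def attachDiscsDesc {K Y : CochainComplex C ℤ} (φ : K ⟶ Y)
    (y : ∀ m : ℤ, (G ⟶ K.X m) → (G ⟶ Y.X (m - 1))) : attachDiscs G K ⟶ Y :=
  coprod.desc φ (Sigma.desc fun x => discDesc (y x.1 x.2))

theorem toAttachDiscs_desc {K Y : CochainComplex C ℤ} (φ : K ⟶ Y)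
    (y : ∀ m : ℤ, (G ⟶ K.X m) → (G ⟶ Y.X (m - 1))) :
    toAttachDiscs G K ≫ attachDiscsDesc φ y = φ :=
  coprod.inl_desc _ _

theorem discToAttachDiscs_desc {K Y : CochainComplex C ℤ} (φ : K ⟶ Y)
    (y : ∀ m : ℤ, (G ⟶ K.X m) → (G ⟶ Y.X (m - 1))) {m : ℤ} (a : G ⟶ K.X m) :
    discToAttachDiscs G K a ≫ attachDiscsDesc φ y = discDesc (y m a) :=
  (Category.assoc _ _ _).trans <|
    (congrArg _ (coprod.inr_desc _ _)).trans (Sigma.ι_desc _ _)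

variable (G)

/-- The coproduct of all the `disc G m`. -/
def allDiscs : CochainComplex C ℤ := ∐ (fun m : ULift.{u} ℤ => disc G m.down)

/-- Iterate `attachDiscs G`, starting with all the `disc G m`. -/
def discStage : ℕ → CochainComplex C ℤ
  | 0 => allDiscs G
  | n + 1 => attachDiscs G (discStage n)

/-- The sequence of the `discStage G n`. -/
def discTower : ℕ ⥤ CochainComplex C ℤ :=
  Functor.ofSequence (X := discStage G) (fun n => toAttachDiscs G (discStage G n))

/-- The sequence of the `discStage G n`, in a higher universe. -/
def discTowerULift : ULift.{u} ℕ ⥤ CochainComplex C ℤ :=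
  (show Monotone (ULift.down : ULift.{u} ℕ → ℕ) from fun _ _ h => h).functor ⋙ discTower G

/-- The union of the `discStage G n`. -/
def discColimit : CochainComplex C ℤ := colimit (discTowerULift G)

/-- The map from a stage to the colimit. -/
def discColimitι (n : ℕ) : discStage G n ⟶ discColimit G :=
  colimit.ι (discTowerULift G) ⟨n⟩

variable {G} {Y : CochainComplex C ℤ}
    (g : ∀ m : ℤ, G ⟶ Y.X m)
    (y : ∀ (K : CochainComplex C ℤ) (_ : K ⟶ Y) (m : ℤ), (G ⟶ K.X m) → (G ⟶ Y.X (m - 1)))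

/-- The morphism from a stage that is determined by choices. -/
def discStageDesc : ∀ n : ℕ, (discStage G n ⟶ Y)
  | 0 => Sigma.desc (fun m => discDesc (g m.down))
  | n + 1 => attachDiscsDesc (discStageDesc n) (y _ (discStageDesc n))

/-- The morphism from the colimit that is determined by choices. -/
def discColimitDesc : discColimit G ⟶ Y :=
  colimit.desc (discTowerULift G)
    (Cocone.mk Y (Functor.whiskerLeft
      (show Monotone (ULift.down : ULift.{u} ℕ → ℕ) from fun _ _ h => h).functor
      (NatTrans.ofSequence (F := discTower G) (G := (Functor.const ℕ).obj Y)
        (discStageDesc g y) (fun n => by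
          refine (congrArg (· ≫ _) (Functor.ofSequence_map_homOfLE_succ _ n)).trans ?_
          exact (toAttachDiscs_desc _ _).trans (Category.comp_id _).symm))))

theorem discColimitι_desc (n : ℕ) :
    discColimitι G n ≫ discColimitDesc g y = discStageDesc g y n :=
  colimit.ι_desc _ _

/-- The inclusion of a disc in the first stage. -/
def discToStageZero (G : C) (m : ℤ) : disc G m ⟶ discStage G 0 :=
  Sigma.ι (fun m : ULift.{u} ℤ => disc G m.down) ⟨m⟩

/-- The inclusion of a disc in a later stage. -/
def discToStageSucc (n : ℕ) {m : ℤ} (a : G ⟶ (discStage G n).X m) :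
    disc G (m - 1) ⟶ discStage G (n + 1) :=
  discToAttachDiscs G _ a

theorem discToStageZero_desc (m : ℤ) :
    discToStageZero G m ≫ discStageDesc g y 0 = discDesc (g m) :=
  Sigma.ι_desc _ _

theorem discToStageSucc_desc (n : ℕ) {m : ℤ} (a : G ⟶ (discStage G n).X m) :
    discToStageSucc n a ≫ discStageDesc g y (n + 1) = discDesc (y _ (discStageDesc g y n) m a) :=
  discToAttachDiscs_desc _ _ _

theorem exists_comp_discColimitDesc_of_eq {m : ℤ} {n : ℕ} (i : disc G m ⟶ discStage G n)
    (b : G ⟶ Y.X m) (hi : i ≫ discStageDesc g y n = discDesc b) :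
    ∃ b' : G ⟶ (discColimit G).X m, b' ≫ (discColimitDesc g y).f m = b := by
  refine ⟨(discXIso₀ G m).inv ≫ (i ≫ discColimitι G n).f m, ?_⟩
  rw [Category.assoc, ← HomologicalComplex.comp_f, Category.assoc, discColimitι_desc, hi,
    discDesc_f, Iso.inv_hom_id_assoc]

theorem exists_comp_discColimitDesc (m : ℤ) :
    ∃ b : G ⟶ (discColimit G).X m, b ≫ (discColimitDesc g y).f m = g m :=
  exists_comp_discColimitDesc_of_eq g y _ _ (discToStageZero_desc g y m)

/-- The disc attached for `a` has its generator in degree `m - 1`, one below `a`, so that the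
generator can be sent to a prospective preimage of the image of `a` under the differential. -/
theorem exists_comp_discColimitDesc_of_stage (n : ℕ) (m : ℤ) (a : G ⟶ (discStage G n).X m) :
    ∃ b : G ⟶ (discColimit G).X (m - 1), b ≫ (discColimitDesc g y).f (m - 1) =
      y _ (discStageDesc g y n) m a :=
  exists_comp_discColimitDesc_of_eq g y _ _ (discToStageSucc_desc g y n a)

/-- Filtered colimits are exact, so `A` is the colimit of its pullbacks along the stages, and these
pullbacks cover it. -/
theorem exists_cover_discColimit {m : ℤ} {A : C} (x : A ⟶ (discColimit G).X m) :
    ∃ (B : ULift.{u} ℕ → C) (q : ∀ n, B n ⟶ A) (z : ∀ n, B n ⟶ (discStage G n.down).X m),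
      Epi (Sigma.desc q) ∧ ∀ n, q n ≫ x = z n ≫ (discColimitι G n.down).f m := by
  let ev := HomologicalComplex.eval C (ComplexShape.up ℤ) m
  let c : Cocone (discTowerULift G ⋙ ev) := ev.mapCocone (colimit.cocone (discTowerULift G))
  let hc : IsColimit c := isColimitOfPreserves ev (colimit.isColimit _)
  let x' : A ⟶ c.pt := x
  have := IsGrothendieckAbelian.IsPresentable.surjectivity.epi_f hc x'
  refine ⟨fun n => (pullback c.ι ((Functor.const _).map x')).obj n,
    fun n => (pullback.snd c.ι ((Functor.const _).map x')).app n,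
    fun n => (pullback.fst c.ι ((Functor.const _).map x')).app n, ?_, ?_⟩
  · have h : Sigma.desc (fun n => (pullback.snd c.ι ((Functor.const _).map x')).app n) =
        Sigma.desc (fun n => colimit.ι (pullback c.ι ((Functor.const _).map x')) n) ≫
          IsGrothendieckAbelian.IsPresentable.surjectivity.f x' := by
      ext n
      rw [Sigma.ι_desc, Sigma.ι_desc_assoc, IsGrothendieckAbelian.IsPresentable.surjectivity.hf]
    have : Epi (Sigma.desc
        (fun n => colimit.ι (pullback c.ι ((Functor.const _).map x')) n)) := by
      refine ⟨fun u v huv => colimit.hom_ext fun n => ?_⟩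
      simpa using Sigma.ι _ n ≫= huv
    exact h ▸ epi_comp _ _
  · intro n
    exact (NatTrans.congr_app (pullback.condition (f := c.ι) (g := (Functor.const _).map x'))
      n).symm

end Tower

end CochainComplex

/-! ### Acyclic images of disc complexes. -/

namespace CochainComplex

section ImageOfDiscColimit

variable {C : Type u₁} [Category.{u} C] [Abelian C]

theorem exactAt_iff_up_to_refinements (K : CochainComplex C ℤ) (m : ℤ) :
    K.ExactAt m ↔ ∀ ⦃A : C⦄ (x : A ⟶ K.X m) (_ : x ≫ K.d m (m + 1) = 0),
      ∃ (A' : C) (q : A' ⟶ A) (_ : Epi q) (y : A' ⟶ K.X (m - 1)), q ≫ x = y ≫ K.d (m - 1) m := by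
  rw [K.exactAt_iff' (m - 1) m (m + 1) (by simp) (by simp),
    ShortComplex.exact_iff_exact_up_to_refinements]
  rfl

/-- Taking for `w` the cokernel of the boundary map of the image shows that a cycle of the image is
a boundary after a cover. The hypothesis is an equality of morphisms rather than the existence of a
preimage, so it can be tested on covers and on maps from a separator. -/
theorem acyclic_image_of_forall_comp_eq_zero {P E : CochainComplex C ℤ} (ψ : P ⟶ E)
    (h : ∀ (m : ℤ) ⦃A W : C⦄ (x : A ⟶ P.X m) (w : E.X m ⟶ W), x ≫ ψ.f m ≫ E.d m (m + 1) = 0 →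
      ψ.f (m - 1) ≫ E.d (m - 1) m ≫ w = 0 → x ≫ ψ.f m ≫ w = 0) :
    (image ψ).Acyclic := by
  intro m
  rw [exactAt_iff_up_to_refinements]
  intro A x hx
  have he : ∀ k, (factorThruImage ψ).f k ≫ (image.ι ψ).f k = ψ.f k := fun k => by
    rw [← HomologicalComplex.comp_f, image.fac]
  obtain ⟨A₁, q₁, _, x₁, h₁⟩ := surjective_up_to_refinements_of_epi ((factorThruImage ψ).f m) x
  have hx₁ : x₁ ≫ ψ.f m = q₁ ≫ x ≫ (image.ι ψ).f m := by
    rw [← he, reassoc_of% h₁]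
  have h₂ := h m x₁ (cokernel.π (ψ.f (m - 1) ≫ E.d (m - 1) m)) (by
    rw [reassoc_of% hx₁, (image.ι ψ).comm, reassoc_of% hx, zero_comp, comp_zero])
    ((Category.assoc _ _ _).symm.trans (cokernel.condition _))
  rw [← Category.assoc] at h₂
  obtain ⟨A₂, q₂, _, b, h₃⟩ :=
    (ShortComplex.exact_cokernel (ψ.f (m - 1) ≫ E.d (m - 1) m)).exact_up_to_refinements _ h₂
  refine ⟨A₂, q₂ ≫ q₁, epi_comp _ _, b ≫ (factorThruImage ψ).f (m - 1), ?_⟩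
  rw [← cancel_mono ((image.ι ψ).f m), Category.assoc, Category.assoc, ← hx₁]
  refine Eq.trans h₃ ?_
  dsimp
  rw [← he, Category.assoc, Category.assoc, Category.assoc, (image.ι ψ).comm]

variable [IsGrothendieckAbelian.{u} C] {G : C}

/-- Each stage of the tower supplies elements bounding, in `E`, the elements of the previous stage
that can be bounded at all by elements coming from `Y`. In the union every cycle of the image is
then a boundary. -/
theorem exists_acyclic_image (hG : IsSeparator G) {Y E : CochainComplex C ℤ} (π : Y ⟶ E) [Epi π]
    (hE : E.Acyclic) (g : ∀ m : ℤ, G ⟶ Y.X m) :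
    ∃ φ : discColimit G ⟶ Y, (∀ m, ∃ b : G ⟶ (discColimit G).X m, b ≫ φ.f m = g m) ∧
      (image (φ ≫ π)).Acyclic := by
  classical
  let y (K : CochainComplex C ℤ) (φ : K ⟶ Y) (m : ℤ) (a : G ⟶ K.X m) : G ⟶ Y.X (m - 1) :=
    -- A disc is attached for every `a`, and is sent to zero when nothing bounds `a`. The source
    -- thus depends only on `G`, and not on `Y`, `E` or the choices.
    if h : ∃ y : G ⟶ Y.X (m - 1), y ≫ π.f (m - 1) ≫ E.d (m - 1) m = a ≫ φ.f m ≫ π.f m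
    then h.choose else 0
  have hy (K : CochainComplex C ℤ) (φ : K ⟶ Y) (m : ℤ) (a : G ⟶ K.X m)
      (h : ∃ y : G ⟶ Y.X (m - 1), y ≫ π.f (m - 1) ≫ E.d (m - 1) m = a ≫ φ.f m ≫ π.f m) :
      y K φ m a ≫ π.f (m - 1) ≫ E.d (m - 1) m = a ≫ φ.f m ≫ π.f m := by
    dsimp only [y]
    rw [dif_pos h]
    exact h.choose_spec
  refine ⟨discColimitDesc g y, exists_comp_discColimitDesc g y, ?_⟩
  apply acyclic_image_of_forall_comp_eq_zero
  intro m A W x w hx hw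
  obtain ⟨B, q, z, _, hz⟩ := exists_cover_discColimit x
  rw [← cancel_epi (Sigma.desc q), comp_zero]
  refine Sigma.hom_ext _ _ fun n => ?_
  rw [Sigma.ι_desc_assoc, comp_zero, reassoc_of% (hz n)]
  have hι : (discColimitι G n.down).f m ≫ (discColimitDesc g y).f m =
      (discStageDesc g y n.down).f m := by
    rw [← HomologicalComplex.comp_f, discColimitι_desc]
  simp only [HomologicalComplex.comp_f, Category.assoc]
  rw [reassoc_of% hι]
  have hc : (z n ≫ (discStageDesc g y n.down).f m ≫ π.f m) ≫ E.d m (m + 1) = 0 := by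
    rw [← hι]
    simp only [HomologicalComplex.comp_f, Category.assoc] at hx ⊢
    rw [← reassoc_of% (hz n), hx, comp_zero]
  -- `E` is acyclic and `π` is an epimorphism, so after covers the cycle is bounded by an element
  -- `y'` of `Y`. `G` need not be projective, which is why the maps `h` from `G` are taken into the
  -- cover `A₂`, where `h ≫ y'` shows that a choice exists.
  obtain ⟨A₁, q₁, _, e, he⟩ := (exactAt_iff_up_to_refinements E m).1 (hE m) _ hc
  obtain ⟨A₂, q₂, _, y', hy'⟩ := surjective_up_to_refinements_of_epi (π.f (m - 1)) e
  rw [← cancel_epi q₁, ← cancel_epi q₂, comp_zero, comp_zero]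
  refine hG.def _ _ fun h => ?_
  have H := hy _ (discStageDesc g y n.down) m (h ≫ q₂ ≫ q₁ ≫ z n) ⟨h ≫ y', by
    simp only [Category.assoc] at he ⊢
    rw [he, ← reassoc_of% hy']⟩
  obtain ⟨b, hb⟩ := exists_comp_discColimitDesc_of_stage g y n.down m (h ≫ q₂ ≫ q₁ ≫ z n)
  simp only [Category.assoc] at H
  rw [comp_zero, ← reassoc_of% H, ← reassoc_of% hb]
  rw [HomologicalComplex.comp_f, Category.assoc] at hw
  rw [hw, comp_zero]

end ImageOfDiscColimit

end CochainComplex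

/-! ### A set of acyclic monomorphisms that enlarges every proper one. -/

namespace CochainComplex

section KernelSubobject

/-- Used in contrapositive form: gluing `B` to `X` gives something new as soon as `j` does not
factor through `p`. -/
theorem exists_comp_eq_of_isPushout_of_isIso {D : Type u₁} [Category.{v} D] {A B X X' Y : D} {t : A ⟶ X} {a : A ⟶ B}
    {i : X ⟶ X'} {i' : B ⟶ X'} (h : IsPushout t a i i') [IsIso i] {p : X ⟶ Y} {j : B ⟶ Y}
    (hpj : t ≫ p = a ≫ j) : ∃ l : B ⟶ X, l ≫ p = j := by
  refine ⟨i' ≫ inv i, ?_⟩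
  rw [Category.assoc, (IsIso.inv_comp_eq i).2 (h.inl_desc _ _ hpj).symm, h.inr_desc]


variable {D : Type u₁} [Category.{v} D] [Abelian D]

theorem kernelSubobject_exact {P Y : D} (φ : P ⟶ Y) :
    (ShortComplex.mk (kernelSubobject φ).arrow φ (kernelSubobject_arrow_comp φ)).Exact := by
  rw [ShortComplex.exact_iff_exact_up_to_refinements]
  intro T x hx
  exact ⟨T, 𝟙 _, inferInstance, factorThruKernelSubobject φ x hx, by simp⟩

/-- The part of `B` that dies in `Y / X` is the intersection of `B` with `X`. -/
theorem exists_isPullback_kernelSubobject {X Y B : D} (p : X ⟶ Y) [Mono p] (j : B ⟶ Y) :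
    ∃ t : (kernelSubobject (j ≫ cokernel.π p) : D) ⟶ X,
      IsPullback t (kernelSubobject (j ≫ cokernel.π p)).arrow p j := by
  have hS := ShortComplex.exact_cokernel p
  have : Mono (ShortComplex.mk p (cokernel.π p) (by simp)).f := by dsimp; infer_instance
  have hA : (kernelSubobject (j ≫ cokernel.π p)).arrow ≫ j ≫ cokernel.π p = 0 :=
    kernelSubobject_arrow_comp _
  have ht : hS.lift ((kernelSubobject (j ≫ cokernel.π p)).arrow ≫ j) (by simp) ≫ p =
    (kernelSubobject (j ≫ cokernel.π p)).arrow ≫ j := hS.lift_f _ _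
  refine ⟨hS.lift ((kernelSubobject (j ≫ cokernel.π p)).arrow ≫ j) (by simp), ⟨⟨ht⟩,
    ⟨PullbackCone.IsLimit.mk _ (fun s => factorThruKernelSubobject _ s.snd ?_) ?_ ?_ ?_⟩⟩⟩
  · rw [← reassoc_of% s.condition, cokernel.condition, comp_zero]
  · intro s
    rw [← cancel_mono p, Category.assoc, ht, ← Category.assoc,
      factorThruKernelSubobject_comp_arrow, s.condition]
  · intro s
    rw [factorThruKernelSubobject_comp_arrow]
  · intro s l _ h
    rw [← cancel_mono (kernelSubobject (j ≫ cokernel.π p)).arrow, h,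
      factorThruKernelSubobject_comp_arrow]

end KernelSubobject

/-- The quotient of `B` by the kernel of `r` is the image of `r`, which is also the image of `e ≫ r`
because `e` is an epimorphism. -/
theorem quasiIso_kernelSubobject_arrow {D : Type u₁} [Category.{v} D] [Abelian D]
    {P B E : CochainComplex D ℤ} (e : P ⟶ B) [Epi e] (r : B ⟶ E) (h : (image (e ≫ r)).Acyclic) :
    QuasiIso (kernelSubobject r).arrow := by
  have hr : (kernelSubobject r).arrow ≫ factorThruImage r = 0 := by
    rw [← cancel_mono (image.ι r), Category.assoc, image.fac, kernelSubobject_arrow_comp,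
      zero_comp]
  have hS : (ShortComplex.mk (kernelSubobject r).arrow (factorThruImage r) hr).ShortExact :=
    { exact := by
        rw [ShortComplex.exact_iff_exact_up_to_refinements]
        intro T x hx
        dsimp at x hx
        exact ⟨T, 𝟙 _, inferInstance, factorThruKernelSubobject r x
          (by rw [← image.fac r, reassoc_of% hx, zero_comp]), by simp⟩
      mono_f := by dsimp; infer_instance
      epi_g := by dsimp; infer_instance }
  have := isIso_of_mono_of_epi (image.preComp e r)
  exact quasiIso_f_of_shortExact hS (fun n => (h n).of_iso (asIso (image.preComp e r)))

section SmallAcyclicMonos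

variable {C : Type u₁} [Category.{u} C] [Abelian C] [IsGrothendieckAbelian.{u} C]

/-- A small family of acyclic monomorphisms. -/
def smallAcyclicMonos (G : C) : MorphismProperty (CochainComplex C ℤ) :=
  MorphismProperty.ofHoms
    (fun (x : Σ R : Subobject (discColimit G),
      {A : Subobject (cokernel R.arrow) // QuasiIso A.arrow}) => x.2.1.arrow)

instance (G : C) : MorphismProperty.IsSmall.{u} (smallAcyclicMonos G) := by
  unfold smallAcyclicMonos
  infer_instance

theorem smallAcyclicMonos_le (G : C) : smallAcyclicMonos G ≤ acyclicMonos C := by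
  rintro _ _ _ ⟨x⟩
  exact ⟨inferInstance, x.2.2⟩

variable {G : C}

/-- A separator detects isomorphisms, so some `f : G ⟶ Y.X m` does not factor through `p`. The
initial disc of degree `m` is sent to `f`, the other initial discs to zero. -/
theorem exists_acyclic_image_of_not_isIso (hG : IsSeparator G) {X Y : CochainComplex C ℤ}
    (p : X ⟶ Y) [Mono p] [QuasiIso p] (hp : ¬ IsIso p) :
    ∃ φ : discColimit G ⟶ Y, (image (φ ≫ cokernel.π p)).Acyclic ∧
      ¬ ∃ l : discColimit G ⟶ X, l ≫ p = φ := by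
  classical
  have hE : (cokernel p).Acyclic :=
    ShortComplex.ShortExact.acyclic_X₃ (S := ShortComplex.mk p (cokernel.π p) (by simp))
      { exact := ShortComplex.exact_cokernel p } (by assumption)
  obtain ⟨m, hm⟩ : ∃ m, ¬ IsIso (p.f m) := by
    by_contra! h
    exact hp (HomologicalComplex.Hom.isIso_of_components p)
  rw [hG.isDetector.isIso_iff_of_mono] at hm
  simp only [ObjectProperty.singleton_iff, Function.Surjective, Functor.flip_obj_map, forall_eq',
    not_forall, not_exists] at hm
  obtain ⟨f, hf⟩ := hm
  replace hf : ∀ x : G ⟶ X.X m, x ≫ p.f m ≠ f := hf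
  obtain ⟨φ, hφ, hQ⟩ := exists_acyclic_image hG (cokernel.π p) hE
    (fun k => if h : m = k then f ≫ eqToHom (by rw [h]) else 0)
  obtain ⟨b, hb⟩ := hφ m
  simp only [dif_pos, eqToHom_refl, Category.comp_id] at hb
  refine ⟨φ, hQ, ?_⟩
  rintro ⟨l, hl⟩
  exact hf (b ≫ l.f m) (by rw [Category.assoc, ← HomologicalComplex.comp_f, hl, hb])

theorem smallAcyclicMonos_of_quasiIso (G : C) (R : Subobject (discColimit G))
    (A : Subobject (cokernel R.arrow)) (hA : QuasiIso A.arrow) : smallAcyclicMonos G A.arrow :=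
  ⟨(⟨R, A, hA⟩ : Σ R : Subobject (discColimit G),
      {A : Subobject (cokernel R.arrow) // QuasiIso A.arrow})⟩

/-- With `B` the image of `φ` in `Y`, the new object is `X + B`, the pushout of `X` and `B` over `X
∩ B`. It embeds in `Y` because the square over `Y` is a pullback. The inclusion of `X ∩ B` in `B` is
in the set because `B` is a quotient of `discColimit G` and `B / (X ∩ B)` is acyclic. -/
theorem exists_smallAcyclicMonos_pushouts (hG : IsSeparator G) {X Y : CochainComplex C ℤ}
    (p : X ⟶ Y) [Mono p] [QuasiIso p] (hp : ¬ IsIso p) :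
    ∃ (X' : CochainComplex C ℤ) (i : X ⟶ X') (p' : X' ⟶ Y)
      (_ : (smallAcyclicMonos G).pushouts i) (_ : ¬ IsIso i) (_ : Mono p'), i ≫ p' = p := by
  obtain ⟨φ, hQ, hφ⟩ := exists_acyclic_image_of_not_isIso hG p hp
  obtain ⟨j, _, hj⟩ : ∃ j : cokernel (kernelSubobject φ).arrow ⟶ Y, ∃ _ : Mono j,
      cokernel.π _ ≫ j = φ :=
    ⟨cokernel.desc _ φ (kernelSubobject_arrow_comp φ),
      (kernelSubobject_exact φ).mono_cokernelDesc, cokernel.π_desc _ _ _⟩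
  rw [← hj, Category.assoc] at hQ
  have hqi := smallAcyclicMonos_of_quasiIso G _ _
    (quasiIso_kernelSubobject_arrow (cokernel.π _) _ hQ)
  obtain ⟨t, sq⟩ := exists_isPullback_kernelSubobject p j
  have hpo := IsPushout.of_hasPushout t (kernelSubobject (j ≫ cokernel.π p)).arrow
  refine ⟨_, _, hpo.desc p j sq.w, ⟨_, _, _, _, _, hqi, hpo⟩,
    fun h => ?_, hpo.mono_of_isPullback_of_mono sq _ (hpo.inl_desc _ _ _) (hpo.inr_desc _ _ _),
    hpo.inl_desc _ _ _⟩
  obtain ⟨l, hl⟩ := exists_comp_eq_of_isPushout_of_isIso hpo sq.w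
  exact hφ ⟨cokernel.π _ ≫ l, by rw [Category.assoc, hl, hj]⟩

end SmallAcyclicMonos

end CochainComplex

/-! ### Exhausting an object by a transfinite sequence of pushouts. -/

namespace CategoryTheory.MorphismProperty

section Iteration

variable {D : Type u₁} [Category.{v} D]

theorem exists_pushouts_ofLE (J : MorphismProperty D) {X : D} (A : Subobject X) {X' : D}
    {i : (A : D) ⟶ X'} (hi : J.pushouts i) (hi' : ¬ IsIso i) {p : X' ⟶ X} [Mono p]
    (h : i ≫ p = A.arrow) : ∃ (A' : Subobject X) (h : A < A'), J.pushouts (A.ofLE A' h.le) := by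
  have hle : A ≤ Subobject.mk p := Subobject.le_mk_of_comm i h
  have hlt : A < Subobject.mk p := by
    refine lt_of_le_of_ne hle fun h' => hi' ?_
    have : IsIso (A.ofLE _ hle) := ⟨(Subobject.mk p).ofLE A h'.ge, by simp, by simp⟩
    have : i = A.ofLE _ hle ≫ (Subobject.underlyingIso p).hom := by
      rw [← cancel_mono p, h, Category.assoc, Subobject.underlyingIso_hom_comp_eq_mk,
        Subobject.ofLE_arrow]
    rw [this]
    infer_instance
  refine ⟨_, hlt, (MorphismProperty.arrow_mk_iso_iff _ ?_).2 hi⟩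
  refine Arrow.isoMk' _ _ (Iso.refl _) (Subobject.underlyingIso p) ?_
  rw [← cancel_mono p, Iso.refl_hom, Category.id_comp, h, Category.assoc,
    Subobject.underlyingIso_hom_comp_eq_mk, Subobject.ofLE_arrow]

variable (J : MorphismProperty D) {X : D}

open scoped Classical in
/-- A larger subobject `A'` such that `A ⟶ A'` is a pushout of a morphism in `J`,
if there is one, and `A` otherwise. -/
def enlarge (A : Subobject X) : Subobject X :=
  if h : ∃ (A' : Subobject X) (h : A < A'), J.pushouts (A.ofLE A' h.le) then h.choose else A

theorem le_enlarge (A : Subobject X) : A ≤ enlarge J A := by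
  unfold enlarge
  split_ifs with h
  · exact h.choose_spec.choose.le
  · exact le_rfl

theorem lt_enlarge {A : Subobject X}
    (h : ∃ (A' : Subobject X) (h : A < A'), J.pushouts (A.ofLE A' h.le)) : A < enlarge J A := by
  unfold enlarge
  rw [dif_pos h]
  exact h.choose_spec.choose

/-- `hJ` takes care of the case in which `enlarge` is stationary and the transition map is an
identity. -/
theorem pushouts_ofLE_of_eq_enlarge (hJ : isomorphisms D ≤ J.pushouts) (A B : Subobject X)
    (hB : B = enlarge J A) (hAB : A ≤ B) : J.pushouts (A.ofLE B hAB) := by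
  by_cases h : ∃ (A' : Subobject X) (h : A < A'), J.pushouts (A.ofLE A' h.le)
  · have : B = h.choose := by
      rw [hB, enlarge, dif_pos h]
    subst this
    exact h.choose_spec.choose_spec
  · have : B = A := by
      rw [hB, enlarge, dif_neg h]
    subst this
    exact hJ _ (by rw [Subobject.ofLE_refl]; exact isomorphisms.infer_property _)

variable [Abelian D] [IsGrothendieckAbelian.{w} D]

variable (A₀ : Subobject X) (T : Type w) [LinearOrder T] [OrderBot T] [SuccOrder T]
  [WellFoundedLT T]

theorem monotone_transfiniteIterate_enlarge :
    Monotone (fun j : T => transfiniteIterate (enlarge J) j A₀) :=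
  monotone_transfiniteIterate _ _ (le_enlarge J)

/-- The transfinite iteration of `enlarge`. -/
def enlargeMonoOver : T ⥤ MonoOver X where
  obj j := MonoOver.mk (transfiniteIterate (enlarge J) j A₀).arrow
  map f := MonoOver.homMk (Subobject.ofLE _ _
      (monotone_transfiniteIterate_enlarge J A₀ T (leOfHom f))) (Subobject.ofLE_arrow _)

/-- The transfinite iteration of `enlarge`. -/
def enlargeFunctor : T ⥤ D where
  obj j := Subobject.underlying.obj (transfiniteIterate (enlarge J) j A₀)
  map f := Subobject.ofLE _ _ (monotone_transfiniteIterate_enlarge J A₀ T (leOfHom f))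
  map_id _ := Subobject.ofLE_refl _
  map_comp _ _ := (Subobject.ofLE_comp_ofLE _ _ _ _ _).symm

/-- At a limit index the iteration is a supremum of subobjects; in a Grothendieck abelian category
the supremum of a directed family of subobjects is its colimit. -/
instance : (enlargeFunctor J A₀ T).IsWellOrderContinuous where
  nonempty_isColimit m hm := ⟨by
    have := hm.nonempty_Iio.to_subtype
    let c := (Set.principalSegIio m).cocone (enlargeMonoOver J A₀ T ⋙ MonoOver.forget _)
    have : Mono c.pt.hom := inferInstanceAs (Mono (Subobject.arrow _))
    refine IsGrothendieckAbelian.isColimitMapCoconeOfSubobjectMkEqISup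
      ((Set.principalSegIio m).monotone.functor ⋙ enlargeMonoOver J A₀ T) c ?_
    have : Subobject.mk c.pt.hom = transfiniteIterate (enlarge J) m A₀ := Subobject.mk_arrow _
    rw [this, transfiniteIterate_limit (enlarge J) A₀ m hm]
    exact iSup_congr fun j => (Subobject.mk_arrow _).symm⟩

variable {T} in
/-- The maps from the bottom element are transfinite compositions. -/
def enlargeTransfiniteComposition (hJ : isomorphisms D ≤ J.pushouts) (j : T) :
    J.pushouts.TransfiniteCompositionOfShape (Set.Iic j)
    ((enlargeFunctor J A₀ T).map (homOfLE bot_le : ⊥ ⟶ j)) where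
  F := (Set.initialSegIic j).monotone.functor ⋙ enlargeFunctor J A₀ T
  isoBot := Iso.refl _
  fac := Category.id_comp _
  incl :=
    { app k := (enlargeFunctor J A₀ T).map (homOfLE k.2)
      naturality k k' h := by
        refine Eq.trans ?_ (Category.comp_id _).symm
        exact ((enlargeFunctor J A₀ T).map_comp (homOfLE (leOfHom h)) (homOfLE k'.2)).symm }
  isColimit := colimitOfDiagramTerminal isTerminalTop _
  map_mem k hk := by
    refine pushouts_ofLE_of_eq_enlarge J hJ _ _ ?_ _
    refine Eq.trans ?_ (transfiniteIterate_succ (enlarge J) A₀ k.1 (Set.not_isMax_coe _ hk))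
    exact congrArg (fun t : Set.Iic j => transfiniteIterate (enlarge J) t.1 A₀)
      (Set.Iic.succ_eq_of_not_isMax hk)

theorem llp_rlp_ofLE_transfiniteIterate (hJ : isomorphisms D ≤ J.pushouts) {T : Type w}
    [LinearOrder T] [OrderBot T] [SuccOrder T] [WellFoundedLT T] (j : T)
    (h : A₀ ≤ transfiniteIterate (enlarge J) j A₀) : J.rlp.llp (A₀.ofLE _ h) := by
  -- The value of the iteration at `⊥` equals `A₀` only propositionally; passing to a variable `B`
  -- avoids transport.
  have (B : Subobject X) (h' : B ≤ transfiniteIterate (enlarge J) j A₀)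
      (hB : B = transfiniteIterate (enlarge J) (⊥ : T) A₀) : J.rlp.llp (B.ofLE _ h') := by
    subst hB
    intro _ _ p hp
    exact transfiniteCompositionsOfShape_le_llp_rlp _ _ _
      (enlargeTransfiniteComposition J A₀ hJ j).mem _ (by simpa)
  exact this _ _ (transfiniteIterate_bot _ _).symm

theorem le_transfiniteIterate_enlarge {T : Type w}
    [LinearOrder T] [OrderBot T] [SuccOrder T] [WellFoundedLT T] (j : T) :
    A₀ ≤ transfiniteIterate (enlarge J) j A₀ :=
  (transfiniteIterate_bot (enlarge J) A₀).symm.le.trans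
    (monotone_transfiniteIterate_enlarge J A₀ T bot_le)

/-- There are more indices than subobjects of `X`, so the monotone iteration takes the same value
twice and is stationary in between. By `hJP` it can be stationary only at `⊤`; `hP` ensures that
`hJP` applies to the inclusion of every stage. -/
theorem exists_transfiniteIterate_eq_top (P : MorphismProperty D)
    (hJ : isomorphisms D ≤ J.pushouts)
    (hJP : ∀ ⦃X Y : D⦄ (p : X ⟶ Y) [Mono p], P p → ¬ IsIso p →
      ∃ (X' : D) (i : X ⟶ X') (p' : X' ⟶ Y) (_ : J.pushouts i) (_ : ¬ IsIso i) (_ : Mono p'),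
        i ≫ p' = p)
    (hP : ∀ ⦃X X' Y : D⦄ (i : X ⟶ X') (p' : X' ⟶ Y), J.rlp.llp i → Mono p' → P (i ≫ p') → P p')
    (hA₀ : P A₀.arrow) :
    ∃ (o : Ordinal.{w}) (_ : OrderBot o.ToType) (j : o.ToType),
      transfiniteIterate (enlarge J) j A₀ = ⊤ := by
  let κ := Order.succ (Cardinal.mk (Shrink.{w} (Subobject X)))
  have : Nonempty κ.ord.ToType := by simp [κ]
  have := WellFoundedLT.toOrderBot κ.ord.ToType
  refine ⟨κ.ord, inferInstance, ?_⟩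
  have hP' (j : κ.ord.ToType) : P (transfiniteIterate (enlarge J) j A₀).arrow := by
    refine hP _ _ (llp_rlp_ofLE_transfiniteIterate J A₀ hJ j
      (le_transfiniteIterate_enlarge J A₀ j)) inferInstance ?_
    rwa [Subobject.ofLE_arrow]
  obtain ⟨j₁, j₂, hj, eq⟩ : ∃ (j₁ j₂ : κ.ord.ToType) (hj : j₁ < j₂),
      transfiniteIterate (enlarge J) j₁ A₀ = transfiniteIterate (enlarge J) j₂ A₀ := by
    have hκ : HasCardinalLT (Subobject X) (Cardinal.mk κ.ord.ToType) :=
      lt_of_lt_of_le (Order.lt_succ _) (by simp [κ])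
    have H : ¬ Function.Injective
        (fun j : κ.ord.ToType => transfiniteIterate (enlarge J) j A₀) := fun h => by
      simpa [hasCardinalLT_iff_cardinal_mk_lt] using hκ.of_injective _ h
    grind [Function.Injective]
  refine ⟨j₁, ?_⟩
  by_contra hne
  have hlt := lt_enlarge J (A := transfiniteIterate (enlarge J) j₁ A₀) (by
    obtain ⟨X', i, p', hi, hi', _, fac⟩ := hJP _ (hP' j₁)
      (by rwa [Subobject.isIso_arrow_iff_eq_top])
    exact exists_pushouts_ofLE J _ hi hi' fac)
  have hj₁ : ¬ IsMax j₁ := not_isMax_iff.2 ⟨_, hj⟩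
  rw [← transfiniteIterate_succ (enlarge J) _ _ hj₁] at hlt
  have := monotone_transfiniteIterate_enlarge J A₀ _ (Order.succ_le_of_lt hj)
  dsimp only at this
  rw [← eq] at this
  exact absurd hlt this.not_gt

theorem llp_rlp_of_exists_pushouts (P : MorphismProperty D)
    (hJ : isomorphisms D ≤ J.pushouts)
    (hJP : ∀ ⦃X Y : D⦄ (p : X ⟶ Y) [Mono p], P p → ¬ IsIso p →
      ∃ (X' : D) (i : X ⟶ X') (p' : X' ⟶ Y) (_ : J.pushouts i) (_ : ¬ IsIso i) (_ : Mono p'),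
        i ≫ p' = p)
    (hP : ∀ ⦃X X' Y : D⦄ (i : X ⟶ X') (p' : X' ⟶ Y), J.rlp.llp i → Mono p' → P (i ≫ p') → P p')
    {A X : D} (f : A ⟶ X) [Mono f] (hf : P f) : J.rlp.llp f := by
  have hf' : P (Subobject.mk f).arrow := by
    refine hP (Subobject.underlyingIso f).inv _ (fun _ _ _ _ => inferInstance) inferInstance ?_
    rwa [Subobject.underlyingIso_arrow]
  obtain ⟨o, _, j, hj⟩ := exists_transfiniteIterate_eq_top J (Subobject.mk f) P hJ hJP hP hf'
  have := (Subobject.isIso_arrow_iff_eq_top _).2 hj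
  refine (MorphismProperty.arrow_mk_iso_iff _ (Arrow.isoMk' _ _ (Subobject.underlyingIso f)
    (asIso (transfiniteIterate (enlarge J) j (Subobject.mk f)).arrow) ?_)).1
    (llp_rlp_ofLE_transfiniteIterate J (Subobject.mk f) hJ j
      (le_transfiniteIterate_enlarge J _ j))
  rw [asIso_hom, Subobject.ofLE_arrow, Subobject.underlyingIso_hom_comp_eq_mk]

end Iteration

end CategoryTheory.MorphismProperty

/-! ### Functorial K-injective resolutions by the small object argument. -/

namespace CochainComplex

section Resolutions

variable {C : Type u₁} [Category.{u} C] [Abelian C] [IsGrothendieckAbelian.{u} C]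

/-- Each acyclic monomorphism is exhausted by pushouts of small ones. The inclusion of each stage
remains a quasi-isomorphism by two out of three, since the part already built is in
`(smallAcyclicMonos G).rlp.llp`, which is contained in `acyclicMonos C`. -/
theorem smallAcyclicMonos_rlp {G : C} (hG : IsSeparator G) :
    (smallAcyclicMonos G).rlp = (acyclicMonos C).rlp := by
  refine le_antisymm (fun _ _ p hp A B i hi => ?_)
    (MorphismProperty.antitone_rlp (smallAcyclicMonos_le G))
  have := hi.1
  have hle : (smallAcyclicMonos G).rlp.llp ≤ acyclicMonos C :=
    (MorphismProperty.antitone_llp (MorphismProperty.antitone_rlp (smallAcyclicMonos_le G))).trans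
      acyclicMonos_rlp_llp.le
  refine MorphismProperty.llp_rlp_of_exists_pushouts (smallAcyclicMonos G)
    (HomologicalComplex.quasiIso C (ComplexShape.up ℤ)) ?_ ?_ ?_ i hi.2 p hp
  · exact MorphismProperty.isomorphisms_le_pushouts _
      -- One isomorphism in the set is enough: its target has the zero map to every `X`.
      (fun X ↦ ⟨_, _, _, smallAcyclicMonos_of_quasiIso G ⊤ ⊤ inferInstance, 0, inferInstance⟩)
  · intro X Y p _ hp hp'
    have : QuasiIso p := hp
    exact exists_smallAcyclicMonos_pushouts hG p hp'
  · intro X X' Y i p' hi _ h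
    have : QuasiIso i := (hle _ hi).2
    have : QuasiIso (i ≫ p') := h
    exact quasiIso_of_comp_left i p'

open MorphismProperty in
-- The regular cardinal `κ` exceeds the number of subobjects of each source in the set. The cell
-- attachments are monomorphisms, and maps from an object with fewer than `κ` subobjects commute
-- with unions of `κ`-indexed chains.
instance (G : C) : HasSmallObjectArgument.{u} (smallAcyclicMonos G) := by
  obtain ⟨κ, hκ', hκ⟩ := HasCardinalLT.exists_regular_cardinal_forall.{u}
    (fun (x : Shrink.{u} (Σ R : Subobject (discColimit G), Subobject (cokernel R.arrow))) =>
      Subobject (((equivShrink _).symm x).2 : CochainComplex C ℤ))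
  have : Fact κ.IsRegular := ⟨hκ'⟩
  have : Nonempty κ.ord.ToType := by simpa using hκ'.ne_zero
  have := WellFoundedLT.toOrderBot κ.ord.ToType
  exact ⟨κ, inferInstance, inferInstance,
    { preservesColimit {A B X Y} i hi f hf := by
        let hf' : (monomorphisms (CochainComplex C ℤ)).TransfiniteCompositionOfShape
            κ.ord.ToType f :=
          { toTransfiniteCompositionOfShape := hf.toTransfiniteCompositionOfShape
            map_mem j hj := by
              have := (hf.attachCells j hj).pushouts_coproducts
              simp only [ofHoms_homFamily] at this
              refine (?_ : _ ≤ monomorphisms (CochainComplex C ℤ)) _ this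
              simp only [pushouts_le_iff, coproducts_le_iff]
              exact fun _ _ _ h => (smallAcyclicMonos_le G _ h).1 }
        have (j j' : κ.ord.ToType) (φ : j ⟶ j') : Mono (hf'.F.map φ) := hf'.mem_map φ
        apply IsGrothendieckAbelian.preservesColimit_coyoneda_obj_of_mono (Y := hf'.F) (κ := κ)
        obtain ⟨R, S, hS⟩ := hi
        have := hκ (equivShrink _ ⟨R, S⟩)
        rwa [Equiv.symm_apply_apply] at this }⟩

variable (C) in
/-- Functorial factorizations as an acyclic monomorphism followed by a morphism with the right
lifting property with respect to these. -/
theorem hasFunctorialFactorization_acyclicMonos :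
    MorphismProperty.HasFunctorialFactorization (acyclicMonos C) (acyclicMonos C).rlp := by
  have hG := isSeparator_separator C
  have h := smallAcyclicMonos_rlp hG
  have h' : (smallAcyclicMonos (separator C)).rlp.llp = acyclicMonos C := by
    rw [h, acyclicMonos_rlp_llp]
  have : MorphismProperty.HasFunctorialFactorization (smallAcyclicMonos (separator C)).rlp.llp
    (smallAcyclicMonos (separator C)).rlp := inferInstance
  rwa [h', h] at this

open ZeroObject in
variable (C) in
/-- The functor sending `X` to `X ⟶ 0`. -/
def arrowToZero : CochainComplex C ℤ ⥤ Arrow (CochainComplex C ℤ) where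
  obj X := Arrow.mk (0 : X ⟶ 0)
  map f := Arrow.homMk f 0 (by simp)

variable (C) in
-- Factor `X ⟶ 0`: the first map is the resolution, and the lifting property of the second makes the
-- middle object K-injective.
theorem exists_functorial_isKInjective_resolution :
    ∃ (ρ : CochainComplex C ℤ ⥤ CochainComplex C ℤ) (i : 𝟭 _ ⟶ ρ),
      (∀ X, (ρ.obj X).IsKInjective) ∧ ∀ X, QuasiIso (i.app X) := by
  have := hasFunctorialFactorization_acyclicMonos C
  let data := MorphismProperty.functorialFactorizationData (acyclicMonos C) (acyclicMonos C).rlp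
  refine ⟨arrowToZero C ⋙ data.Z, Functor.whiskerLeft (arrowToZero C) data.i, fun X => ?_,
    fun X => ?_⟩
  · exact isKInjective_of_acyclicMonos_rlp (isZero_zero _) (data.hp ((arrowToZero C).obj X))
  · exact (data.hi ((arrowToZero C).obj X)).2

end Resolutions

end CochainComplex

/-! ### Cohomology of Hom complexes and morphisms in the derived category. -/

namespace CochainComplex.HomComplex

section Maps

variable {C₂ : Type u₂} [Category.{v} C₂] [Preadditive C₂]
  {C₁ : Type u₁} [Category.{v} C₁] [Preadditive C₁]
  {K L : CochainComplex C₂ ℤ} {K' L' : CochainComplex C₁ ℤ}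
  (φ : HomComplex K L ⟶ HomComplex K' L')

/-- The map on cochains given by a morphism of Hom complexes. -/
def cochainMap (n : ℤ) : Cochain K L n →+ Cochain K' L' n := (φ.f n).hom

theorem δ_cochainMap (n m : ℤ) (z : Cochain K L n) :
    δ n m (cochainMap φ n z) = cochainMap φ m (δ n m z) := by
  by_cases h : n + 1 = m
  · exact ConcreteCategory.congr_hom (φ.comm n m) z
  · rw [δ_shape _ _ h, δ_shape _ _ h, map_zero]

/-- The map on cocycles given by a morphism of Hom complexes. -/
def cocycleMap (n : ℤ) : Cocycle K L n →+ Cocycle K' L' n where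
  toFun z := Cocycle.mk (cochainMap φ n z.1) (n + 1) rfl (by
    rw [δ_cochainMap, Cocycle.δ_eq_zero, map_zero])
  map_zero' := by
    ext : 1
    exact map_zero (cochainMap φ n)
  map_add' x y := by
    ext : 1
    exact map_add (cochainMap φ n) _ _

theorem cocycleMap_coe (n : ℤ) (z : Cocycle K L n) :
    (cocycleMap φ n z : Cochain K' L' n) = cochainMap φ n z := rfl

/-- The map on morphisms to the shifts given by a morphism of Hom complexes. -/
def homShiftMap (n : ℤ) (f : K ⟶ L⟦n⟧) : K' ⟶ L'⟦n⟧ :=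
  Cocycle.equivHomShift.symm (cocycleMap φ n (Cocycle.equivHomShift f))

theorem homShiftMap_equivHomShift_symm (n : ℤ) (z : Cocycle K L n) :
    homShiftMap φ n (Cocycle.equivHomShift.symm z) =
      Cocycle.equivHomShift.symm (cocycleMap φ n z) := by
  rw [homShiftMap, AddEquiv.apply_symm_apply]

theorem homShiftMap_comp {C₀ : Type u} [Category.{v} C₀] [Preadditive C₀]
    {K'' L'' : CochainComplex C₀ ℤ} (ψ : HomComplex K' L' ⟶ HomComplex K'' L'') (n : ℤ)
    (f : K ⟶ L⟦n⟧) : homShiftMap (φ ≫ ψ) n f = homShiftMap ψ n (homShiftMap φ n f) := by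
  rw [homShiftMap, homShiftMap, homShiftMap, AddEquiv.apply_symm_apply]
  rfl

/-- The map on cohomology classes given by a morphism of Hom complexes. -/
def cohomologyClassMap (n : ℤ) : CohomologyClass K L n →+ CohomologyClass K' L' n :=
  CohomologyClass.descAddMonoidHom
    ((CohomologyClass.mkAddMonoidHom K' L' n).comp (cocycleMap φ n)) (by
      intro x hx
      obtain ⟨m, hm, y, hy⟩ := hx
      rw [AddMonoidHom.mem_ker]
      refine (CohomologyClass.mk_eq_zero_iff _).2 ⟨m, hm, cochainMap φ m y, ?_⟩
      rw [δ_cochainMap, cocycleMap_coe, hy])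

theorem cohomologyClassMap_mk (n : ℤ) (z : Cocycle K L n) :
    cohomologyClassMap φ n (.mk z) = .mk (cocycleMap φ n z) := rfl

theorem quasiIso_of_bijective_cohomologyClassMap
    (h : ∀ n, Function.Bijective (cohomologyClassMap φ n)) : QuasiIso φ := by
  rw [quasiIso_iff]
  intro n
  rw [quasiIsoAt_iff' φ (n - 1) n (n + 1) (by simp) (by simp)]
  let S := (HomologicalComplex.shortComplexFunctor' _ _ (n - 1) n (n + 1)).map φ
  let h₁ := leftHomologyData' K L (n - 1) n (n + 1) (by simp) rfl
  let h₂ := leftHomologyData' K' L' (n - 1) n (n + 1) (by simp) rfl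
  let φK : h₁.K ⟶ h₂.K := AddCommGrpCat.ofHom (cocycleMap φ n)
  have commi : φK ≫ h₂.i = h₁.i ≫ S.τ₂ := rfl
  let data : ShortComplex.LeftHomologyMapData S h₁ h₂ :=
    { φK := φK
      φH := AddCommGrpCat.ofHom (cohomologyClassMap φ n)
      commi := commi
      commf' := by
        rw [← cancel_mono h₂.i, Category.assoc, Category.assoc, commi, h₂.f'_i]
        refine (h₁.f'_i_assoc _).trans ?_
        exact S.comm₁₂.symm
      commπ := rfl }
  rw [data.quasiIso_iff, ConcreteCategory.isIso_iff_bijective]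
  exact h n

end Maps

section DerivedCategory

variable {C₂ : Type u₂} [Category.{v} C₂] [Abelian C₂] [HasDerivedCategory.{w₂} C₂]
  {C₁ : Type u₁} [Category.{v} C₁] [Abelian C₁] [HasDerivedCategory.{w₁} C₁]
  {K L : CochainComplex C₂ ℤ} {K' L' : CochainComplex C₁ ℤ}

theorem Q_map_surjective_of_isKInjective (K L : CochainComplex C₂ ℤ) [L.IsKInjective] :
    Function.Surjective (fun f : K ⟶ L => DerivedCategory.Q.map f) := by
  intro x
  obtain ⟨y, hy⟩ := (IsKInjective.Qh_map_bijective _ L).surjective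
    ((DerivedCategory.quotientCompQhIso C₂).hom.app K ≫ x ≫
      (DerivedCategory.quotientCompQhIso C₂).inv.app L)
  obtain ⟨f, rfl⟩ := (HomotopyCategory.quotient _ _).map_surjective y
  refine ⟨f, ?_⟩
  have := (DerivedCategory.quotientCompQhIso C₂).inv.naturality f
  rw [← cancel_mono ((DerivedCategory.quotientCompQhIso C₂).inv.app L)]
  refine this.trans ?_
  refine (congrArg _ hy).trans ?_
  simp

theorem quotient_map_eq_of_Q_map_eq {K L : CochainComplex C₂ ℤ} [L.IsKInjective]
    {f g : K ⟶ L} (h : DerivedCategory.Q.map f = DerivedCategory.Q.map g) :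
    (HomotopyCategory.quotient _ _).map f = (HomotopyCategory.quotient _ _).map g := by
  apply (IsKInjective.Qh_map_bijective _ L).injective
  have h₁ := (DerivedCategory.quotientCompQhIso C₂).hom.naturality f
  have h₂ := (DerivedCategory.quotientCompQhIso C₂).hom.naturality g
  rw [← h, ← h₁] at h₂
  exact ((cancel_mono _).1 h₂).symm

theorem mk_eq_mk_iff_Q_map_eq [L.IsKInjective] (n : ℤ) (x y : Cocycle K L n) :
    CohomologyClass.mk x = CohomologyClass.mk y ↔
      DerivedCategory.Q.map (Cocycle.equivHomShift.symm x) =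
        DerivedCategory.Q.map (Cocycle.equivHomShift.symm y) := by
  rw [← (CohomologyClass.toHom_bijective K L n).injective.eq_iff, CohomologyClass.toHom_mk,
    CohomologyClass.toHom_mk]
  constructor
  · intro h
    have h₁ := (DerivedCategory.quotientCompQhIso C₂).hom.naturality (Cocycle.equivHomShift.symm x)
    have h₂ := (DerivedCategory.quotientCompQhIso C₂).hom.naturality (Cocycle.equivHomShift.symm y)
    rw [← cancel_epi ((DerivedCategory.quotientCompQhIso C₂).hom.app K), ← h₁, ← h₂]
    exact congrArg (fun t => DerivedCategory.Qh.map t ≫ _) h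
  · exact quotient_map_eq_of_Q_map_eq

/-- For K-injective `L`, the degree `n` cohomology of the Hom complex is the group of morphisms from
`K` to `L⟦n⟧` in the derived category, so `φ` can be tested there. -/
theorem quasiIso_of_bijective_derivedCategory [L.IsKInjective] [L'.IsKInjective]
    (φ : HomComplex K L ⟶ HomComplex K' L')
    (Ψ : ∀ n : ℤ, (DerivedCategory.Q.obj K ⟶ DerivedCategory.Q.obj (L⟦n⟧)) →
      (DerivedCategory.Q.obj K' ⟶ DerivedCategory.Q.obj (L'⟦n⟧)))
    (hΨ : ∀ n, Function.Bijective (Ψ n))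
    (h : ∀ (n : ℤ) (f : K ⟶ L⟦n⟧),
      DerivedCategory.Q.map (homShiftMap φ n f) = Ψ n (DerivedCategory.Q.map f)) :
    QuasiIso φ := by
  refine quasiIso_of_bijective_cohomologyClassMap φ fun n => ⟨?_, ?_⟩
  · intro x y hxy
    obtain ⟨x, rfl⟩ := x.mk_surjective
    obtain ⟨y, rfl⟩ := y.mk_surjective
    rw [cohomologyClassMap_mk, cohomologyClassMap_mk, mk_eq_mk_iff_Q_map_eq,
      ← homShiftMap_equivHomShift_symm, ← homShiftMap_equivHomShift_symm, h, h] at hxy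
    exact (mk_eq_mk_iff_Q_map_eq _ _ _).2 ((hΨ n).injective hxy)
  · intro y
    obtain ⟨y, rfl⟩ := y.mk_surjective
    obtain ⟨t, ht⟩ := (hΨ n).surjective (DerivedCategory.Q.map (Cocycle.equivHomShift.symm y))
    obtain ⟨f, rfl⟩ := Q_map_surjective_of_isKInjective _ _ t
    refine ⟨.mk (Cocycle.equivHomShift f), ?_⟩
    rw [cohomologyClassMap_mk, mk_eq_mk_iff_Q_map_eq, ← homShiftMap_equivHomShift_symm, h, ← ht,
      AddEquiv.symm_apply_apply]

end DerivedCategory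

end CochainComplex.HomComplex

namespace CochainComplex.HomComplex

section HomShiftMap

variable {C₂ : Type u₂} [Category.{v} C₂] [Preadditive C₂]
  {C₁ : Type u₁} [Category.{v} C₁] [Preadditive C₁]

theorem equivHomShift_homShiftMap {K L : CochainComplex C₂ ℤ} {K' L' : CochainComplex C₁ ℤ}
    (φ : HomComplex K L ⟶ HomComplex K' L') (n : ℤ) (u : K ⟶ L⟦n⟧) :
    Cocycle.equivHomShift (homShiftMap φ n u) = cocycleMap φ n (Cocycle.equivHomShift u) :=
  AddEquiv.apply_symm_apply _ _

theorem homShiftMap_homComplexMap {K K' L L' : CochainComplex C₂ ℤ} (f : K' ⟶ K) (g : L ⟶ L')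
    (n : ℤ) (u : K ⟶ L⟦n⟧) : homShiftMap (homComplexMap f g) n u = f ≫ u ≫ g⟦n⟧' := by
  apply Cocycle.equivHomShift.injective
  rw [equivHomShift_homShiftMap, ← Category.assoc, Cocycle.equivHomShift_comp_shift,
    Cocycle.equivHomShift_comp]
  ext : 1
  rfl

variable (F : C₂ ⥤ C₁) [F.Additive]

/-- The map between Hom complexes given by a functor. -/
def homComplexMapFunctor (K L : CochainComplex C₂ ℤ) :
    HomComplex K L ⟶ HomComplex ((F.mapHomologicalComplex (ComplexShape.up ℤ)).obj K)
      ((F.mapHomologicalComplex (ComplexShape.up ℤ)).obj L) :=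
  (homComplexFunctorMap F).app (op K, L)

theorem homShiftMap_homComplexMapFunctor {K L : CochainComplex C₂ ℤ} (n : ℤ) (u : K ⟶ L⟦n⟧) :
    homShiftMap (homComplexMapFunctor F K L) n u =
      (F.mapHomologicalComplex (ComplexShape.up ℤ)).map u ≫
        ((F.mapHomologicalComplex (ComplexShape.up ℤ)).commShiftIso n).hom.app L := by
  apply Cocycle.equivHomShift.injective
  rw [equivHomShift_homShiftMap]
  ext p q hpq
  rw [cocycleMap_coe]
  have : (cochainMap (homComplexMapFunctor F K L) n (Cocycle.equivHomShift u).1).v p q hpq =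
    F.map ((Cocycle.equivHomShift u).1.v p q hpq) := rfl
  rw [this]
  subst hpq
  rw [Cocycle.equivHomShift_apply, Cocycle.equivHomShift_apply, Cocycle.rightUnshift_coe,
    Cocycle.rightUnshift_coe, Cochain.rightUnshift_v _ _ _ _ _ _ _ (add_zero p),
    Cochain.rightUnshift_v _ _ _ _ _ _ _ (add_zero p), Functor.map_comp]
  simp
  exact (Category.comp_id _).symm

end HomShiftMap

section Abelian

variable {C : Type u₁} [Category.{v} C] [Abelian C]

/-- On cohomology the map is composition on both sides with isomorphisms of the derived category. -/
theorem quasiIso_homComplexMap {K K' I I' : CochainComplex C ℤ} (f : K' ⟶ K) (g : I ⟶ I')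
    [QuasiIso f] [QuasiIso g] [I.IsKInjective] [I'.IsKInjective] :
    QuasiIso (homComplexMap f g) := by
  let := HasDerivedCategory.standard C
  refine quasiIso_of_bijective_derivedCategory _
    (fun n x => DerivedCategory.Q.map f ≫ x ≫ DerivedCategory.Q.map (g⟦n⟧')) (fun n => ?_) ?_
  · have : QuasiIso (g⟦n⟧') := by
      rw [CochainComplex.quasiIso_shift_iff]
      infer_instance
    refine ⟨fun x y h => ?_, fun x => ⟨inv (DerivedCategory.Q.map f) ≫ x ≫
      inv (DerivedCategory.Q.map (g⟦n⟧')), by simp⟩⟩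
    exact (cancel_mono _).1 ((cancel_epi _).1 h)
  · intro n u
    rw [homShiftMap_homComplexMap, Functor.map_comp, Functor.map_comp]

end Abelian

end CochainComplex.HomComplex

/-! ### Existence of `RHom` on unbounded derived categories. -/

section HasRHom

variable (C : Type u₁) [Category.{v} C] [Abelian C]

/-- The property of being K-injective. -/
def isKInjectiveProperty : ObjectProperty (CochainComplex C ℤ) := fun K => K.IsKInjective

/-- The category of pairs of complexes the second of which is K-injective. -/
abbrev PairKInjective := (CochainComplex C ℤ)ᵒᵖ × (isKInjectiveProperty C).FullSubcategory

/-- The inclusion of `PairKInjective C` in the category of pairs of complexes. -/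
abbrev pairKInjectiveι : PairKInjective C ⥤ (CochainComplex C ℤ)ᵒᵖ × CochainComplex C ℤ :=
  (𝟭 _).prod (isKInjectiveProperty C).ι

/-- The localizer morphism from pairs with a K-injective second component to all pairs. -/
def pairKInjectiveLocalizerMorphism :
    LocalizerMorphism ((pairQuasiIso C).inverseImage (pairKInjectiveι C)) (pairQuasiIso C) where
  functor := pairKInjectiveι C
  map := le_rfl

instance : (pairKInjectiveLocalizerMorphism C).functor.Full :=
  ⟨fun f => ⟨(f.1, ObjectProperty.homMk f.2), rfl⟩⟩

instance : (pairKInjectiveLocalizerMorphism C).functor.Faithful :=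
  ⟨fun {X Y f g} h => by
    have h' : (pairKInjectiveι C).map f = (pairKInjectiveι C).map g := h
    exact Prod.ext (show f.1 = g.1 from (congrArg Prod.fst h' :))
      ((isKInjectiveProperty C).ι.map_injective (congrArg Prod.snd h' :))⟩

instance {D₁ : Type u₁} [Category.{v} D₁] {D₂ : Type u₂} [Category.{w} D₂]
    (W₁ : MorphismProperty D₁) (W₂ : MorphismProperty D₂) [W₁.IsMultiplicative]
    [W₂.IsMultiplicative] : (W₁.prod W₂).IsMultiplicative where
  id_mem _ := ⟨W₁.id_mem _, W₂.id_mem _⟩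
  comp_mem _ _ hf hg := ⟨W₁.comp_mem _ _ hf.1 hg.1, W₂.comp_mem _ _ hf.2 hg.2⟩

instance {D₁ : Type u₁} [Category.{v} D₁] {D₂ : Type u₂} [Category.{w} D₂]
    (W₁ : MorphismProperty D₁) (W₂ : MorphismProperty D₂) [W₁.HasTwoOutOfThreeProperty]
    [W₂.HasTwoOutOfThreeProperty] : (W₁.prod W₂).HasTwoOutOfThreeProperty where
  comp_mem _ _ hf hg := ⟨W₁.comp_mem _ _ hf.1 hg.1, W₂.comp_mem _ _ hf.2 hg.2⟩
  of_postcomp f g hg hfg :=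
    ⟨W₁.of_postcomp f.1 g.1 hg.1 hfg.1, W₂.of_postcomp f.2 g.2 hg.2 hfg.2⟩
  of_precomp f g hf hfg :=
    ⟨W₁.of_precomp f.1 g.1 hf.1 hfg.1, W₂.of_precomp f.2 g.2 hf.2 hfg.2⟩

end HasRHom

section HasRHom

variable (C : Type u₁) [Category.{u} C] [Abelian C] [IsGrothendieckAbelian.{u} C]

/-- Only the second variable has to be resolved; the first is kept unchanged. -/
theorem isRightDerivabilityStructure_pairKInjective :
    (pairKInjectiveLocalizerMorphism C).IsRightDerivabilityStructure := by
  obtain ⟨ρ, i, hρ, hi⟩ := exists_functorial_isKInjective_resolution C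
  let ρ' : (CochainComplex C ℤ)ᵒᵖ × CochainComplex C ℤ ⥤ PairKInjective C :=
    (𝟭 _).prod ((isKInjectiveProperty C).lift ρ hρ)
  let i' : 𝟭 _ ⟶ ρ' ⋙ (pairKInjectiveLocalizerMorphism C).functor :=
    { app X := (𝟙 X.1, i.app X.2)
      naturality X Y f := Prod.ext ((Category.comp_id _).trans (Category.id_comp _).symm)
        (i.naturality f.2) }
  have hi' : ∀ X, pairQuasiIso C (i'.app X) := fun X =>
    ⟨MorphismProperty.id_mem _ _, hi X.2⟩
  exact (pairKInjectiveLocalizerMorphism C).isRightDerivabilityStructure_of_functorial_resolutions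
    i' hi' rfl

end HasRHom

section HasRHom

variable (C : Type u₁) [Category.{v} C] [Abelian C]

theorem pairKInjective_derives [HasDerivedCategory.{w} AddCommGrpCat.{v}] :
    (pairKInjectiveLocalizerMorphism C).Derives (homToDerived C) := by
  intro X Y f hf
  have : X.2.obj.IsKInjective := X.2.property
  have : Y.2.obj.IsKInjective := Y.2.property
  have : QuasiIso f.1.unop := hf.1
  have : QuasiIso f.2.hom := hf.2
  have := HomComplex.quasiIso_homComplexMap f.1.unop f.2.hom
  exact inferInstanceAs (IsIso (DerivedCategory.Q.map (homComplexMap f.1.unop f.2.hom)))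

end HasRHom

section HasRHom

variable (C : Type u₁) [Category.{u} C] [Abelian C] [IsGrothendieckAbelian.{u} C]

theorem hasRHom [HasDerivedCategory.{w} AddCommGrpCat.{u}] : HasRHom C := by
  have := isRightDerivabilityStructure_pairKInjective C
  have := (pairKInjective_derives C).hasPointwiseRightDerivedFunctor
  infer_instance

variable {C} in
theorem isIso_RHomUnit_app [HasDerivedCategory.{w₁} C] [HasDerivedCategory.{w} AddCommGrpCat.{u}]
    [HasRHom C] (K I : CochainComplex C ℤ) [hI : I.IsKInjective] :
    IsIso ((RHomUnit C).app (op K, I)) := by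
  have := isRightDerivabilityStructure_pairKInjective C
  exact (pairKInjective_derives C).isIso_of_isRightDerivedFunctor (RHomUnit C)
    ((op K, ⟨I, hI⟩) : PairKInjective C)

end HasRHom

/-! ### Reducing the comparison of `RHom`'s to morphisms in derived categories. -/

section Comparison

variable {C₂ : Type u₂} [Category.{v} C₂] [Abelian C₂] [HasDerivedCategory.{w₂} C₂]
  {C₁ : Type u₁} [Category.{v} C₁] [Abelian C₁] [HasDerivedCategory.{w₁} C₁]
  (F : C₂ ⥤ C₁) [F.Additive] [PreservesFiniteLimits F] [PreservesFiniteColimits F]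

theorem isIso_comp_comp_of_eq {D : Type u} [Category.{v} D] {X Y Z Y' Z' T : D} {a : X ⟶ Y}
    {a' : Y ⟶ Y'} {b : Y ⟶ Z} {b' : Y' ⟶ Z'} {c : Z ⟶ Z'} {d : Z ⟶ T} (h₁ : IsIso (a ≫ a'))
    (h : a' ≫ b' = b ≫ c) (_ : IsIso b') (_ : IsIso c) (_ : IsIso d) : IsIso (a ≫ b ≫ d) := by
  have h₂ : IsIso ((a ≫ b) ≫ c) := by
    rw [Category.assoc, ← h, ← Category.assoc]
    infer_instance
  have := (isIso_comp_right_iff _ _).1 h₂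
  rw [← Category.assoc]
  infer_instance

open HomComplex in
-- The image of `I` under `F` need not be K-injective, hence the resolution `j`. On cohomology the
-- composite is `F.mapDerivedCategory` on morphisms from `K` to `I⟦n⟧`, up to isomorphisms; `hF`
-- applies because `I⟦n⟧` is again K-injective.
theorem quasiIso_homComplexMapFunctor_comp (K I : CochainComplex C₂ ℤ) [I.IsKInjective]
    {J : CochainComplex C₁ ℤ} [J.IsKInjective]
    (j : (F.mapHomologicalComplex (ComplexShape.up ℤ)).obj I ⟶ J) [QuasiIso j]
    (hF : ∀ I : CochainComplex C₂ ℤ, I.IsKInjective → Function.Bijective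
      (fun x : DerivedCategory.Q.obj K ⟶ DerivedCategory.Q.obj I => F.mapDerivedCategory.map x)) :
    QuasiIso (homComplexMapFunctor F K I ≫ homComplexMap (𝟙 _) j) := by
  have hj (n : ℤ) : QuasiIso (j⟦n⟧') := by
    rw [CochainComplex.quasiIso_shift_iff]
    infer_instance
  refine quasiIso_of_bijective_derivedCategory _
    (fun n x => F.mapDerivedCategoryFactors.inv.app K ≫ F.mapDerivedCategory.map x ≫
      F.mapDerivedCategoryFactors.hom.app (I⟦n⟧) ≫ DerivedCategory.Q.map
      (((F.mapHomologicalComplex (ComplexShape.up ℤ)).commShiftIso n).hom.app I ≫ j⟦n⟧'))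
    (fun n => ?_) ?_
  · have : QuasiIso
        (((F.mapHomologicalComplex (ComplexShape.up ℤ)).commShiftIso n).hom.app I ≫ j⟦n⟧') :=
      inferInstance
    refine ⟨fun x y h => (hF (I⟦n⟧) inferInstance).injective ?_, fun x => ?_⟩
    · dsimp only at h ⊢
      rw [← Category.assoc, ← Category.assoc, ← Category.assoc, ← Category.assoc] at h
      rw [cancel_mono] at h
      rw [cancel_mono] at h
      rwa [cancel_epi] at h
    · obtain ⟨y, hy⟩ := (hF (I⟦n⟧) inferInstance).surjective
        (F.mapDerivedCategoryFactors.hom.app K ≫ x ≫ inv (DerivedCategory.Q.map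
      (((F.mapHomologicalComplex (ComplexShape.up ℤ)).commShiftIso n).hom.app I ≫ j⟦n⟧')) ≫
        F.mapDerivedCategoryFactors.inv.app (I⟦n⟧))
      refine ⟨y, ?_⟩
      dsimp only at hy ⊢
      rw [hy]
      simp
  · intro n u
    rw [homShiftMap_comp, homShiftMap_homComplexMapFunctor, homShiftMap_homComplexMap,
      Category.id_comp, Category.assoc, Functor.map_comp]
    have := F.mapDerivedCategoryFactors.hom.naturality u
    dsimp only [Functor.comp_map] at this
    rw [reassoc_of% this, Iso.inv_hom_id_app_assoc]

end Comparison

section Comparison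

variable {C₂ : Type u₂} [Category.{u} C₂] [Abelian C₂]
  [HasDerivedCategory.{w₂} C₂]
  {C₁ : Type u₁} [Category.{u} C₁] [Abelian C₁] [IsGrothendieckAbelian.{u} C₁]
  [HasDerivedCategory.{w₁} C₁] [HasDerivedCategory.{w} AddCommGrpCat.{u}]
  (F : C₂ ⥤ C₁) [F.Additive] [PreservesFiniteLimits F] [PreservesFiniteColimits F]
  [HasRHom C₁]

theorem isIso_homToRHom_app (K I : CochainComplex C₂ ℤ) [I.IsKInjective]
    (hF : ∀ I : CochainComplex C₂ ℤ, I.IsKInjective → Function.Bijective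
      (fun x : DerivedCategory.Q.obj K ⟶ DerivedCategory.Q.obj I => F.mapDerivedCategory.map x)) :
    IsIso ((homToRHom F).app (op K, I)) := by
  obtain ⟨ρ, i, hρ, hi⟩ := exists_functorial_isKInjective_resolution C₁
  let FK := (F.mapHomologicalComplex (ComplexShape.up ℤ)).obj K
  let FI := (F.mapHomologicalComplex (ComplexShape.up ℤ)).obj I
  let J := ρ.obj FI
  let j : FI ⟶ J := i.app FI
  have : J.IsKInjective := hρ _
  have : QuasiIso j := hi _
  have h₁ := quasiIso_homComplexMapFunctor_comp F K I j hF
  have h₂ := isIso_RHomUnit_app FK J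
  let p : ((op FK, FI) : (CochainComplex C₁ ℤ)ᵒᵖ × CochainComplex C₁ ℤ) ⟶ (op FK, J) := (𝟙 _, j)
  have h₃ : IsIso ((pairQ C₁).map p) := by
    rw [isIso_prod_iff]
    exact ⟨inferInstanceAs (IsIso (DerivedCategory.Q.op.map (𝟙 _))),
      inferInstanceAs (IsIso (DerivedCategory.Q.map j))⟩
  have h₄ : DerivedCategory.Q.map (homComplexMap (𝟙 FK) j) ≫ (RHomUnit C₁).app (op FK, J) =
      (RHomUnit C₁).app (op FK, FI) ≫ (RHom C₁).map ((pairQ C₁).map p) :=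
    (RHomUnit C₁).naturality p
  have h₆ : IsIso (DerivedCategory.Q.map (HomComplex.homComplexMapFunctor F K I) ≫
      DerivedCategory.Q.map (homComplexMap (𝟙 FK) j)) := by
    rw [← Functor.map_comp]
    infer_instance
  have h₇ : (homToRHom F).app (op K, I) = DerivedCategory.Q.map
      (HomComplex.homComplexMapFunctor F K I) ≫ (RHomUnit C₁).app (op FK, FI) ≫
      (RHom C₁).map ((pairFactors F).hom.app (op K, I)) := by
    simp [homToRHom]
    rfl
  rw [h₇]
  have h₈ : IsIso ((RHom C₁).map ((pairFactors F).hom.app (op K, I))) := inferInstance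
  have h₉ : IsIso ((RHom C₁).map ((pairQ C₁).map p)) := inferInstance
  exact isIso_comp_comp_of_eq h₆ h₄ h₂ h₉ h₈

/-- By naturality `W` may be represented by a K-injective complex. There the unit of `RHom C₂` is an
isomorphism, and the comparison is determined by `homToRHom F`. -/
theorem isIso_RHomComparison_app [IsGrothendieckAbelian.{u} C₂] [HasRHom C₂]
    (hF : ∀ K I : CochainComplex C₂ ℤ, I.IsKInjective → Function.Bijective
      (fun x : DerivedCategory.Q.obj K ⟶ DerivedCategory.Q.obj I => F.mapDerivedCategory.map x))
    (V W : DerivedCategory C₂) : IsIso ((RHomComparison F).app (op V, W)) := by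
  obtain ⟨ρ, i, hρ, hi⟩ := exists_functorial_isKInjective_resolution C₂
  let K := DerivedCategory.Q.objPreimage V
  let L := DerivedCategory.Q.objPreimage W
  have : QuasiIso (i.app L) := hi _
  have : (ρ.obj L).IsKInjective := hρ _
  let e : (pairQ C₂).obj (op K, ρ.obj L) ≅ (op V, W) :=
    Iso.prod (DerivedCategory.Q.objObjPreimageIso V).op.symm
      ((asIso (DerivedCategory.Q.map (i.app L))).symm ≪≫ DerivedCategory.Q.objObjPreimageIso W)
  rw [← NatTrans.isIso_app_iff_of_iso _ e]
  have h₁ := isIso_homToRHom_app F K (ρ.obj L) (hF K)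
  have h₂ := isIso_RHomUnit_app K (ρ.obj L)
  have h₃ : (RHomUnit C₂).app (op K, ρ.obj L) ≫
      (RHomComparison F).app ((pairQ C₂).obj (op K, ρ.obj L)) =
        (homToRHom F).app (op K, ρ.obj L) :=
    (RHom C₂).rightDerived_fac_app (RHomUnit C₂) (pairQuasiIso C₂) _ (homToRHom F) _
  rw [← h₃] at h₁
  exact (isIso_comp_left_iff _ _).1 h₁

end Comparison

/-! ### Exact adjoint functors, K-injectivity and orthogonality. -/

namespace CochainComplex

universe u₃ v₁ v₂ v₃

/-- The functor on cochain complexes induced by an additive functor. -/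
abbrev mapCh {C₁ : Type u₁} [Category.{v₁} C₁] [Preadditive C₁] {C₂ : Type u₂}
    [Category.{v₂} C₂] [Preadditive C₂] (F : C₁ ⥤ C₂) [F.Additive] :
    CochainComplex C₁ ℤ ⥤ CochainComplex C₂ ℤ :=
  F.mapHomologicalComplex (ComplexShape.up ℤ)

section Adjunction

variable {C₁ : Type u₁} [Category.{v₁} C₁] [Preadditive C₁] {C₂ : Type u₂}
    [Category.{v₂} C₂] [Preadditive C₂] {L : C₁ ⥤ C₂} {R : C₂ ⥤ C₁} [L.Additive] [R.Additive]
    (adj : L ⊣ R)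

/-- The adjunction on cochain complexes induced by an adjunction of additive functors. -/
def mapChAdjunction : mapCh L ⊣ mapCh R :=
  Adjunction.mkOfUnitCounit
    { unit :=
        { app K :=
            { f i := adj.unit.app (K.X i)
              comm' i j _ := (adj.unit.naturality (K.d i j)).symm }
          naturality K K' f := by
            ext i
            exact adj.unit.naturality (f.f i) }
      counit :=
        { app K :=
            { f i := adj.counit.app (K.X i)
              comm' i j _ := (adj.counit.naturality (K.d i j)).symm }
          naturality K K' f := by
            ext i
            exact adj.counit.naturality (f.f i) }
      left_triangle := by
        ext K i
        exact (congrArg (_ ≫ ·) (Category.id_comp _)).trans (adj.left_triangle_components (K.X i))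
      right_triangle := by
        ext K i
        exact (congrArg (_ ≫ ·) (Category.id_comp _)).trans (adj.right_triangle_components (K.X i)) }

end Adjunction

section Exact

variable {C₁ : Type u₁} [Category.{v₁} C₁] [Abelian C₁] {C₂ : Type u₂}
    [Category.{v₂} C₂] [Abelian C₂]

theorem acyclic_mapCh (F : C₁ ⥤ C₂) [F.Additive] [PreservesFiniteLimits F]
    [PreservesFiniteColimits F] {K : CochainComplex C₁ ℤ} (hK : K.Acyclic) :
    ((mapCh F).obj K).Acyclic :=
  fun i => (show (K.sc i).Exact from hK i).map F

/-- The left adjoint preserves acyclic complexes, and null-homotopies transpose along the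
adjunction. -/
theorem isKInjective_mapCh {L : C₁ ⥤ C₂} {R : C₂ ⥤ C₁} [L.Additive] [R.Additive] (adj : L ⊣ R)
    [PreservesFiniteLimits L] [PreservesFiniteColimits L] (I : CochainComplex C₂ ℤ)
    [I.IsKInjective] : ((mapCh R).obj I).IsKInjective where
  nonempty_homotopy_zero {K} f hK := by
    let adj' := mapChAdjunction adj
    let h := IsKInjective.homotopyZero ((adj'.homEquiv _ _).symm f) (acyclic_mapCh L hK)
    have hf : adj'.unit.app K ≫ (mapCh R).map ((adj'.homEquiv _ _).symm f) = f :=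
      (adj'.homEquiv_unit K I _).symm.trans (Equiv.apply_symm_apply _ _)
    exact ⟨(Homotopy.ofEq hf.symm).trans (((R.mapHomotopy h).compLeft (adj'.unit.app K)).trans
      (Homotopy.ofEq (by simp)))⟩

end Exact

section Orthogonality

variable {C₁ : Type u₁} [Category.{u} C₁] [Abelian C₁] [HasDerivedCategory.{w₁} C₁]
  {C₃ : Type u₃} [Category.{u} C₃] [Abelian C₃] [IsGrothendieckAbelian.{u} C₃]
  {L : C₁ ⥤ C₃} {R : C₃ ⥤ C₁} [L.Additive] [R.Additive] (adj : L ⊣ R)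
  [PreservesFiniteLimits L] [PreservesFiniteColimits L]
  [PreservesFiniteLimits R] [PreservesFiniteColimits R]

include adj in
-- Since `M ≅ R L M` and `R` is exact, `R` of a K-injective resolution of `L M` is a K-injective
-- resolution of `M`. A morphism in the derived category thus comes from a map of complexes, whose
-- transpose starts from `L K = 0`.
theorem derivedCategory_hom_eq_zero (K M : CochainComplex C₁ ℤ) (hK : ∀ i, IsZero (L.obj (K.X i)))
    (hM : ∀ i, IsIso (adj.unit.app (M.X i)))
    (x : DerivedCategory.Q.obj K ⟶ DerivedCategory.Q.obj M) : x = 0 := by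
  obtain ⟨ρ, i, hρ, hi⟩ := exists_functorial_isKInjective_resolution C₃
  let N := (mapCh L).obj M
  have : (ρ.obj N).IsKInjective := hρ _
  have : QuasiIso (i.app N) := hi _
  have := isKInjective_mapCh adj (ρ.obj N)
  have : ∀ i, IsIso (((mapChAdjunction adj).unit.app M).f i) := hM
  have : IsIso ((mapChAdjunction adj).unit.app M) :=
    HomologicalComplex.Hom.isIso_of_components _
  have : QuasiIso ((mapCh R).map (i.app N)) := inferInstance
  let q : M ⟶ (mapCh R).obj (ρ.obj N) :=
    (mapChAdjunction adj).unit.app M ≫ (mapCh R).map (i.app N)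
  have : QuasiIso q := inferInstance
  rw [← cancel_mono (DerivedCategory.Q.map q), zero_comp]
  obtain ⟨f, hf⟩ := HomComplex.Q_map_surjective_of_isKInjective _ _ (x ≫ DerivedCategory.Q.map q)
  have hf' : f = 0 := by
    ext n
    apply (adj.homEquiv _ _).symm.injective
    exact (hK n).eq_of_src _ _
  rw [← hf]
  dsimp only
  rw [hf', Functor.map_zero]

end Orthogonality

end CochainComplex

/-! ### Full faithfulness of the inclusion on derived categories. -/

namespace CochainComplex

universe u₃

section Vanishing

variable {C : Type u₁} [Category.{v} C] [Abelian C] [HasDerivedCategory.{w₁} C]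

/-- This is the long exact sequence of the triangle of `S`. Surjectivity uses `h₀`; injectivity uses
`h₁`, since the preceding term consists of morphisms from `X⟦1⟧` to `S.X₃`. -/
theorem bijective_comp_Q_map_f {S : ShortComplex (CochainComplex C ℤ)} (hS : S.ShortExact)
    {X : DerivedCategory C} (h₀ : ∀ x : X ⟶ DerivedCategory.Q.obj S.X₃, x = 0)
    (h₁ : ∀ x : X⟦(1 : ℤ)⟧ ⟶ DerivedCategory.Q.obj S.X₃, x = 0) :
    Function.Bijective
      (fun x : X ⟶ DerivedCategory.Q.obj S.X₁ => x ≫ DerivedCategory.Q.map S.f) := by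
  have hT := DerivedCategory.triangleOfSES_distinguished hS
  constructor
  · refine (injective_iff_map_eq_zero
      (Preadditive.rightComp X (DerivedCategory.Q.map S.f))).2 ?_
    intro x hx
    replace hx : x ≫ DerivedCategory.Q.map S.f = 0 := hx
    obtain ⟨g, hg⟩ := Pretriangulated.Triangle.coyoneda_exact₁ _ hT (x⟦(1 : ℤ)⟧') (by
      change x⟦(1 : ℤ)⟧' ≫ (DerivedCategory.Q.map S.f)⟦(1 : ℤ)⟧' = 0
      rw [← Functor.map_comp, hx, Functor.map_zero])
    apply (CategoryTheory.shiftFunctor (DerivedCategory C) (1 : ℤ)).map_injective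
    rw [Functor.map_zero]
    refine hg.trans ?_
    rw [h₁ g]
    exact zero_comp
  · intro y
    obtain ⟨g, hg⟩ := Pretriangulated.Triangle.coyoneda_exact₂ _ hT y (h₀ _)
    exact ⟨g, hg.symm⟩

end Vanishing

section FullyFaithful

variable {C₂ : Type u₂} [Category.{u} C₂] [Abelian C₂]
  {C₁ : Type u₁} [Category.{u} C₁] [Abelian C₁]
  {jL : C₁ ⥤ C₂} {jR : C₂ ⥤ C₁} [jL.Additive] [jR.Additive] (adjJ : jL ⊣ jR)
  (F : C₂ ⥤ C₁) [F.Additive] (e : F ⋙ jL ≅ 𝟭 C₂)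

/-- The isomorphism on cochain complexes induced by `e`. -/
def mapChCompIso : mapCh F ⋙ mapCh jL ≅ 𝟭 (CochainComplex C₂ ℤ) where
  hom :=
    { app K :=
        { f i := e.hom.app (K.X i)
          comm' i j _ := (e.hom.naturality (K.d i j)).symm }
      naturality K K' f := by
        ext i
        exact e.hom.naturality (f.f i) }
  inv :=
    { app K :=
        { f i := e.inv.app (K.X i)
          comm' i j _ := (e.inv.naturality (K.d i j)).symm }
      naturality K K' f := by
        ext i
        exact e.inv.naturality (f.f i) }
  hom_inv_id := by
    ext K i
    exact e.hom_inv_id_app (K.X i)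
  inv_hom_id := by
    ext K i
    exact e.inv_hom_id_app (K.X i)

/-- The canonical map from `F I` to `jR I`. -/
def mapChMate (I : CochainComplex C₂ ℤ) : (mapCh F).obj I ⟶ (mapCh jR).obj I :=
  (mapChAdjunction adjJ).homEquiv _ _ ((mapChCompIso F e).hom.app I)

theorem mapChMate_f (I : CochainComplex C₂ ℤ) (i : ℤ) :
    (mapChMate adjJ F e I).f i = adjJ.unit.app (F.obj (I.X i)) ≫ jR.map (e.hom.app (I.X i)) := by
  refine (congrArg (fun t => HomologicalComplex.Hom.f t i)
    ((mapChAdjunction adjJ).homEquiv_unit _ _ _)).trans ?_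
  rfl

theorem map_comp_mapChMate {K I : CochainComplex C₂ ℤ} (f : K ⟶ I) :
    (mapCh F).map f ≫ mapChMate adjJ F e I =
      (mapChAdjunction adjJ).homEquiv _ _ ((mapChCompIso F e).hom.app K ≫ f) := by
  have h₁ := (mapChCompIso F e).hom.naturality f
  have h₂ := (mapChAdjunction adjJ).homEquiv_naturality_left ((mapCh F).map f)
    ((mapChCompIso F e).hom.app I)
  exact h₂.symm.trans (congrArg ((mapChAdjunction adjJ).homEquiv _ _) h₁)

variable [HasDerivedCategory.{w₂} C₂] [HasDerivedCategory.{w₁} C₁]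

theorem Q_map_mapCh (G : C₁ ⥤ C₂) [G.Additive] [PreservesFiniteLimits G]
    [PreservesFiniteColimits G] {K L : CochainComplex C₁ ℤ} {f g : K ⟶ L}
    (h : DerivedCategory.Q.map f = DerivedCategory.Q.map g) :
    DerivedCategory.Q.map ((mapCh G).map f) = DerivedCategory.Q.map ((mapCh G).map g) := by
  have h₁ := G.mapDerivedCategoryFactors_hom_naturality f
  have h₂ := G.mapDerivedCategoryFactors_hom_naturality g
  rw [← cancel_epi (G.mapDerivedCategoryFactors.hom.app K), ← h₁, ← h₂, h]

variable [PreservesFiniteLimits jL] [PreservesFiniteColimits jL]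

/-- Applying the exact functor `jL` and then the counit recovers `f` up to the isomorphism `jL F K ≅
K`. -/
theorem Q_map_eq_of_Q_map_comp_mapChMate_eq {K I : CochainComplex C₂ ℤ} {f g : K ⟶ I}
    (h : DerivedCategory.Q.map ((mapCh F).map f ≫ mapChMate adjJ F e I) =
      DerivedCategory.Q.map ((mapCh F).map g ≫ mapChMate adjJ F e I)) :
    DerivedCategory.Q.map f = DerivedCategory.Q.map g := by
  have h' := Q_map_mapCh jL h
  have key (f : K ⟶ I) : (mapCh jL).map ((mapCh F).map f ≫ mapChMate adjJ F e I) ≫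
      (mapChAdjunction adjJ).counit.app I = (mapChCompIso F e).hom.app K ≫ f := by
    rw [map_comp_mapChMate]
    exact ((mapChAdjunction adjJ).homEquiv_counit _ _ _).symm.trans (Equiv.symm_apply_apply _ _)
  have h'' : DerivedCategory.Q.map ((mapChCompIso F e).hom.app K ≫ f) =
      DerivedCategory.Q.map ((mapChCompIso F e).hom.app K ≫ g) := by
    rw [← key f, ← key g]
    exact (Functor.map_comp _ _ _).trans
      ((congrArg (· ≫ _) h').trans (Functor.map_comp _ _ _).symm)
  rw [Functor.map_comp, Functor.map_comp] at h''
  exact (cancel_epi _).1 h''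

variable [PreservesFiniteLimits F] [PreservesFiniteColimits F]
  {C₃ : Type u₃} [Category.{u} C₃] [Abelian C₃] [IsGrothendieckAbelian.{u} C₃]
  {kL : C₁ ⥤ C₃} {kR : C₃ ⥤ C₁} [kL.Additive] [kR.Additive] (adjK : kL ⊣ kR)
  [PreservesFiniteLimits kL] [PreservesFiniteColimits kL]
  [PreservesFiniteLimits kR] [PreservesFiniteColimits kR]

include adjJ e adjK in
-- In the application `jL`, `jR` are restriction to `Y` and direct image, `F` is the inclusion, and
-- `kL`, `kR` are restriction to `closure Y \ Y` and direct image. The hypotheses say that `F`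
-- embeds in `jR` with a cokernel orthogonal to the image of `F`.
theorem bijective_mapDerivedCategory_map
    (hF : ∀ V, IsZero (kL.obj (F.obj V)))
    (hε : ∀ V, Mono (adjJ.unit.app (F.obj V) ≫ jR.map (e.hom.app V)))
    (hK : ∀ V, IsIso (adjK.unit.app
      (cokernel (adjJ.unit.app (F.obj V) ≫ jR.map (e.hom.app V)))))
    (K I : CochainComplex C₂ ℤ) [I.IsKInjective] : Function.Bijective
      (fun x : DerivedCategory.Q.obj K ⟶ DerivedCategory.Q.obj I =>
        F.mapDerivedCategory.map x) := by
  let ε := mapChMate adjJ F e I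
  have hε' (i : ℤ) : Mono (ε.f i) := by
    rw [show ε.f i = _ from mapChMate_f adjJ F e I i]
    exact hε _
  have : Mono ε := HomologicalComplex.mono_of_mono_f _ hε'
  let S := ShortComplex.mk ε (cokernel.π ε) (cokernel.condition ε)
  have hS : S.ShortExact := { exact := ShortComplex.exact_cokernel ε }
  have hC (i : ℤ) : IsIso (adjK.unit.app ((cokernel ε).X i)) := by
    let ev := HomologicalComplex.eval C₁ (ComplexShape.up ℤ) i
    let iso : (cokernel ε).X i ≅
        cokernel (adjJ.unit.app (F.obj (I.X i)) ≫ jR.map (e.hom.app (I.X i))) :=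
      PreservesCokernel.iso ev ε ≪≫ cokernelIsoOfEq (mapChMate_f adjJ F e I i)
    exact (NatTrans.isIso_app_iff_of_iso adjK.unit iso).2 (hK _)
  have hv (K : CochainComplex C₂ ℤ)
      (x : DerivedCategory.Q.obj ((mapCh F).obj K) ⟶ DerivedCategory.Q.obj (cokernel ε)) :
      x = 0 := derivedCategory_hom_eq_zero adjK _ _ (fun i => hF _) hC x
  -- Orthogonality to the cokernel lets `F I` be replaced by `jR I` as a target. The shifted
  -- vanishing follows from `hv` for `K⟦1⟧`.
  have hA := bijective_comp_Q_map_f hS (X := DerivedCategory.Q.obj ((mapCh F).obj K)) (hv K) (by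
    intro x
    let iso := (DerivedCategory.Q.commShiftIso (1 : ℤ)).app ((mapCh F).obj K)
    let iso' := DerivedCategory.Q.mapIso (((mapCh F).commShiftIso (1 : ℤ)).app K)
    have := hv (K⟦(1 : ℤ)⟧) (iso'.hom ≫ iso.hom ≫ x)
    rwa [Preadditive.IsIso.comp_left_eq_zero, Preadditive.IsIso.comp_left_eq_zero] at this)
  have := isKInjective_mapCh adjJ I
  -- With the K-injective target `jR I`, all morphisms come from maps of complexes, and the
  -- adjunction turns maps `F K ⟶ jR I` into maps `K ⟶ I`.
  have hB : Function.Bijective (fun x : DerivedCategory.Q.obj K ⟶ DerivedCategory.Q.obj I =>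
      (F.mapDerivedCategoryFactors.inv.app K ≫ F.mapDerivedCategory.map x ≫
        F.mapDerivedCategoryFactors.hom.app I) ≫ DerivedCategory.Q.map ε) := by
    have key (f : K ⟶ I) : (F.mapDerivedCategoryFactors.inv.app K ≫
        F.mapDerivedCategory.map (DerivedCategory.Q.map f) ≫
        F.mapDerivedCategoryFactors.hom.app I) ≫ DerivedCategory.Q.map ε =
        DerivedCategory.Q.map ((mapCh F).map f ≫ ε) := by
      have := F.mapDerivedCategoryFactors.hom.naturality f
      dsimp only [Functor.comp_map] at this
      rw [this, Iso.inv_hom_id_app_assoc, Functor.map_comp]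
    constructor
    · intro x y h
      obtain ⟨f, rfl⟩ := HomComplex.Q_map_surjective_of_isKInjective _ _ x
      obtain ⟨g, rfl⟩ := HomComplex.Q_map_surjective_of_isKInjective _ _ y
      dsimp only at h
      rw [key, key] at h
      exact Q_map_eq_of_Q_map_comp_mapChMate_eq adjJ F e h
    · intro y
      obtain ⟨g, rfl⟩ := HomComplex.Q_map_surjective_of_isKInjective _ _ y
      refine ⟨DerivedCategory.Q.map ((mapChCompIso F e).inv.app K ≫
        ((mapChAdjunction adjJ).homEquiv _ _).symm g), ?_⟩
      dsimp only
      rw [key, map_comp_mapChMate, Iso.hom_inv_id_app_assoc]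
      exact congrArg _ (Equiv.apply_symm_apply _ _)
  have hC' : Function.Bijective (fun x : DerivedCategory.Q.obj K ⟶ DerivedCategory.Q.obj I =>
      F.mapDerivedCategoryFactors.inv.app K ≫ F.mapDerivedCategory.map x ≫
        F.mapDerivedCategoryFactors.hom.app I) :=
    (Function.Bijective.of_comp_iff' hA _).1 hB
  refine ⟨fun x y h => hC'.injective (congrArg (_ ≫ · ≫ _) h), fun y => ?_⟩
  obtain ⟨x, hx⟩ := hC'.surjective (F.mapDerivedCategoryFactors.inv.app K ≫ y ≫
        F.mapDerivedCategoryFactors.hom.app I)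
  exact ⟨x, (cancel_mono _).1 ((cancel_epi _).1 hx)⟩

end FullyFaithful

end CochainComplex

/-! ### Sheaves of modules as a Grothendieck abelian category, and their stalks. -/

namespace SheafOfModules

section

variable {C : Type u} [SmallCategory C] {J : GrothendieckTopology C} (R : Sheaf J RingCat.{u})
  [HasSheafify J AddCommGrpCat.{u}] [J.WEqualsLocallyBijective AddCommGrpCat.{u}]

/-- A diagram of sheaves is the sheafification of its underlying diagram of presheaves, and
sheafification of modules agrees with that of the underlying abelian groups. -/
instance toSheaf_preservesColimitsOfShape (K : Type u₁) [Category.{w} K]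
    [HasColimitsOfShape K (PresheafOfModules.{u} R.obj)]
    [PreservesColimitsOfShape K (PresheafOfModules.toPresheaf.{u} R.obj)] :
    PreservesColimitsOfShape K (toSheaf.{u} R) where
  preservesColimit {F} := by
    let e : F ≅ (F ⋙ forget R) ⋙ PresheafOfModules.sheafification (𝟙 R.obj) :=
      Functor.isoWhiskerLeft F
        (asIso (PresheafOfModules.sheafificationAdjunction (𝟙 R.obj)).counit).symm
    have : PreservesColimit ((F ⋙ forget R) ⋙ PresheafOfModules.sheafification (𝟙 R.obj))
        (toSheaf.{u} R) := by
      refine preservesColimit_of_preserves_colimit_cocone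
        (isColimitOfPreserves (PresheafOfModules.sheafification (𝟙 R.obj))
          (colimit.isColimit (F ⋙ forget R))) ?_
      exact isColimitOfPreserves
        (PresheafOfModules.toPresheaf R.obj ⋙ presheafToSheaf J AddCommGrpCat.{u})
        (colimit.isColimit (F ⋙ forget R))
    exact preservesColimit_of_iso_diagram _ e.symm

/-- Exactness of filtered colimits is inherited from sheaves of abelian groups. The separator is the
coproduct of the sheafified free modules on representable presheaves. -/
instance isGrothendieckAbelian : IsGrothendieckAbelian.{u} (SheafOfModules.{u} R) where
  ab5OfSize := ⟨fun K _ _ => HasExactColimitsOfShape.domain_of_functor K (toSheaf.{u} R)⟩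
  hasSeparator := by
    let adj := PresheafOfModules.sheafificationAdjunction (𝟙 R.obj)
    refine ⟨∐ fun U : C => (PresheafOfModules.sheafification (𝟙 R.obj)).obj
      ((PresheafOfModules.free R.obj).obj (yoneda.obj U)), ?_⟩
    refine ObjectProperty.IsSeparating.isSeparator_coproduct ?_
    intro M N f g h
    apply (forget R).map_injective
    refine PresheafOfModules.freeYoneda.isSeparating R.obj _ _ ?_
    rintro _ ⟨U⟩ a
    apply (adj.homEquiv _ _).symm.injective
    refine (adj.homEquiv_naturality_right_symm a f).trans ?_
    refine Eq.trans ?_ (adj.homEquiv_naturality_right_symm a g).symm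
    exact h _ ⟨U⟩ _

instance toSheaf_preservesFiniteColimits : PreservesFiniteColimits (toSheaf.{u} R) :=
  ⟨fun _ _ _ => inferInstance⟩
end

end SheafOfModules

namespace SheafOfModules

variable {X : TopCat.{u}} (A : Sheaf (Opens.grothendieckTopology X) RingCat.{u})

/-- The stalk functor, from sheaves of modules to abelian groups. -/
def stalkFunctor (x : X) : SheafOfModules.{u} A ⥤ AddCommGrpCat.{u} :=
  toSheaf.{u} A ⋙ (TopCat.Sheaf.forget AddCommGrpCat.{u} X ⋙
    TopCat.Presheaf.stalkFunctor AddCommGrpCat.{u} x)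

instance stalkFunctor_preservesFiniteLimits (x : X) :
    PreservesFiniteLimits (stalkFunctor A x) := by
  have : PreservesFiniteLimits (TopCat.Sheaf.forget AddCommGrpCat.{u} X ⋙
    TopCat.Presheaf.stalkFunctor AddCommGrpCat.{u} x) :=
    TopCat.Sheaf.instPreservesFiniteLimitsCompPresheafForgetStalkFunctor x
  exact @comp_preservesFiniteLimits _ _ _ _ _ _ (toSheaf.{u} A) _ _ this

instance stalkFunctor_preservesFiniteColimits (x : X) :
    PreservesFiniteColimits (stalkFunctor A x) := by
  have : PreservesFiniteColimits (TopCat.Sheaf.forget AddCommGrpCat.{u} X ⋙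
    TopCat.Presheaf.stalkFunctor AddCommGrpCat.{u} x) :=
    PreservesColimitsOfSize0.preservesFiniteColimits _
  exact @comp_preservesFiniteColimits _ _ _ _ _ _ (toSheaf.{u} A) _ _ this

instance stalkFunctor_additive (x : X) : (stalkFunctor A x).Additive :=
  Functor.additive_of_preserves_binary_products _

variable {A}

lemma isIso_iff_stalkFunctor_map_isIso {M N : SheafOfModules.{u} A} (f : M ⟶ N) :
    IsIso f ↔ ∀ x, IsIso ((stalkFunctor A x).map f) := by
  refine ⟨fun _ _ => inferInstance, fun h => ?_⟩
  have : IsIso ((toSheaf A).map f) :=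
    (TopCat.Presheaf.isIso_iff_stalkFunctor_map_iso (C := AddCommGrpCat.{u}) (X := X)
      (F := (toSheaf A).obj M) (G := (toSheaf A).obj N) ((toSheaf A).map f)).2 h
  exact isIso_of_reflects_iso f (toSheaf A)

open ZeroObject in
lemma isZero_iff_stalkFunctor_obj_isZero (M : SheafOfModules.{u} A) :
    IsZero M ↔ ∀ x, IsZero ((stalkFunctor A x).obj M) := by
  refine ⟨fun h x => (stalkFunctor A x).map_isZero h, fun h => ?_⟩
  have : IsIso (0 : M ⟶ 0) := (isIso_iff_stalkFunctor_map_isIso _).2 fun x =>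
    isIso_of_source_target_iso_zero _ (h x).isoZero
      ((stalkFunctor A x).map_isZero (isZero_zero _)).isoZero
  exact (isZero_zero _).of_iso (asIso (0 : M ⟶ 0))

lemma mono_of_stalkFunctor_map_mono {M N : SheafOfModules.{u} A} (f : M ⟶ N)
    (hf : ∀ x, Mono ((stalkFunctor A x).map f)) : Mono f := by
  refine Preadditive.mono_of_isZero_kernel _ ?_
  rw [isZero_iff_stalkFunctor_obj_isZero]
  intro x
  have := hf x
  exact (isZero_kernel_of_mono ((stalkFunctor A x).map f)).of_iso
    (PreservesKernel.iso (stalkFunctor A x) f)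

end SheafOfModules

/-! ### Stalks of the inverse image of a sheaf of rings. -/

section GodementRing

variable {X Z : TopCat.{u}}

/-- The presheaf of rings `U ↦ ∏_{z ∈ U} E z`. -/
def godementRingPresheaf (E : Z → RingCat.{u}) : TopCat.Presheaf RingCat.{u} Z where
  obj U := RingCat.of (∀ z : (unop U : Opens Z), E z)
  map {U V} i := RingCat.ofHom (RingHom.pi fun z : (unop V : Opens Z) =>
    Pi.evalRingHom (fun z : (unop U : Opens Z) => E z) ⟨z.1, i.unop.le z.2⟩)

/-- The sheaf of rings `U ↦ ∏_{z ∈ U} E z`. -/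
def godementRing (E : Z → RingCat.{u}) : Sheaf (Opens.grothendieckTopology Z) RingCat.{u} :=
  ⟨godementRingPresheaf E, (TopCat.Presheaf.isSheaf_iff_isSheaf_comp
    (forget RingCat.{u}) (godementRingPresheaf E)).2 (by
      have h := TopCat.Presheaf.toTypes_isSheaf Z fun z => E z
      exact h)⟩

/-- The value at `z` of a section of the sheaf `U ↦ ∏_{z ∈ U} E z`. -/
def godementRingEval (E : Z → RingCat.{u}) (U : Opens Z) (z : Z) (hz : z ∈ U) :
    (godementRing E).obj.obj (op U) ⟶ E z :=
  RingCat.ofHom (Pi.evalRingHom (fun z : U => E z) ⟨z, hz⟩)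

lemma godementRing_ext (E : Z → RingCat.{u}) (U : Opens Z)
    (s t : (godementRing E).obj.obj (op U))
    (h : ∀ z hz, godementRingEval E U z hz s = godementRingEval E U z hz t) : s = t :=
  funext fun z => h z.1 z.2

/-- A family of ring morphisms `A_{f z} ⟶ E z` induces a morphism from `A` to the direct image of
`U ↦ ∏_{z ∈ U} E z`. -/
def toGodementRing (f : Z ⟶ X) (A : Sheaf (Opens.grothendieckTopology X) RingCat.{u})
    (E : Z → RingCat.{u}) (h : ∀ z, TopCat.Presheaf.stalk A.obj (f z) ⟶ E z) :
    A ⟶ ((Opens.map f).sheafPushforwardContinuous RingCat.{u}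
      (Opens.grothendieckTopology X) (Opens.grothendieckTopology Z)).obj (godementRing E) where
  hom :=
    { app := fun U =>
        (RingCat.ofHom (RingHom.pi fun z : (Opens.map f).obj (unop U) =>
          (TopCat.Presheaf.germ A.obj (unop U) (f z) z.2 ≫ h z).hom) :
          A.obj.obj U ⟶ RingCat.of (∀ z : (Opens.map f).obj (unop U), E z))
      naturality := by
        intro U V i
        ext a
        refine godementRing_ext E ((Opens.map f).obj (unop V)) _ _ fun z hz => ?_
        exact congrArg (h z) (TopCat.Presheaf.germ_res_apply A.obj i.unop (f z) hz a) }

lemma exists_pullbackRing_hom (f : Z ⟶ X) (A : Sheaf (Opens.grothendieckTopology X) RingCat.{u})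
    (N : Sheaf (Opens.grothendieckTopology Z) RingCat.{u})
    (k : A ⟶ ((Opens.map f).sheafPushforwardContinuous RingCat.{u}
      (Opens.grothendieckTopology X) (Opens.grothendieckTopology Z)).obj N) :
    ∃ r : pullbackRing f A ⟶ N, ∀ (U : Opens X) (a : A.obj.obj (op U)),
      r.hom.app (op ((Opens.map f).obj U)) ((pullbackRingUnit f A).hom.app (op U) a) =
        k.hom.app (op U) a := by
  let adj := TopCat.Sheaf.pullbackPushforwardAdjunction RingCat.{u} f
  refine ⟨(adj.homEquiv A N).symm k, fun U a => ?_⟩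
  have h := (adj.homEquiv_unit A N ((adj.homEquiv A N).symm k)).symm.trans
    ((adj.homEquiv A N).apply_symm_apply k)
  have h' := congrArg (fun φ : A ⟶ ((Opens.map f).sheafPushforwardContinuous RingCat.{u}
      (Opens.grothendieckTopology X) (Opens.grothendieckTopology Z)).obj N =>
      φ.hom.app (op U) a) h
  exact h'

lemma pullbackRing_hom_ext (f : Z ⟶ X) (A : Sheaf (Opens.grothendieckTopology X) RingCat.{u})
    (N : Sheaf (Opens.grothendieckTopology Z) RingCat.{u}) (g h : pullbackRing f A ⟶ N)
    (hgh : ∀ (U : Opens X) (a : A.obj.obj (op U)),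
      g.hom.app (op ((Opens.map f).obj U)) ((pullbackRingUnit f A).hom.app (op U) a) =
        h.hom.app (op ((Opens.map f).obj U)) ((pullbackRingUnit f A).hom.app (op U) a)) :
    g = h := by
  let adj := TopCat.Sheaf.pullbackPushforwardAdjunction RingCat.{u} f
  apply (adj.homEquiv A N).injective
  refine (adj.homEquiv_unit A N g).trans (Eq.trans ?_ (adj.homEquiv_unit A N h).symm)
  apply Sheaf.hom_ext
  apply NatTrans.ext
  funext U
  apply RingCat.hom_ext
  exact RingHom.ext fun a => hgh (unop U) a

/-- The morphism from the stalk of `A` at `f z` to the stalk of `f⁻¹ A` at `z`. -/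
def stalkPullbackRing (f : Z ⟶ X) (A : Sheaf (Opens.grothendieckTopology X) RingCat.{u}) (z : Z) :
    TopCat.Presheaf.stalk A.obj (f z) ⟶ TopCat.Presheaf.stalk (pullbackRing f A).obj z :=
  (TopCat.Presheaf.stalkFunctor RingCat.{u} (f z)).map (pullbackRingUnit f A).hom ≫
    TopCat.Presheaf.stalkPushforward RingCat.{u} f (pullbackRing f A).obj z

lemma stalkPullbackRing_germ (f : Z ⟶ X) (A : Sheaf (Opens.grothendieckTopology X) RingCat.{u})
    (z : Z) (U : Opens X) (hz : f z ∈ U) (a : A.obj.obj (op U)) :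
    stalkPullbackRing f A z (TopCat.Presheaf.germ A.obj U (f z) hz a) =
      TopCat.Presheaf.germ (pullbackRing f A).obj ((Opens.map f).obj U) z hz
        ((pullbackRingUnit f A).hom.app (op U) a) := by
  refine (congrArg (TopCat.Presheaf.stalkPushforward RingCat.{u} f (pullbackRing f A).obj z)
    (TopCat.Presheaf.stalkFunctor_map_germ_apply (C := RingCat.{u}) U (f z) hz
      (pullbackRingUnit f A).hom a)).trans ?_
  exact TopCat.Presheaf.stalkPushforward_germ_apply RingCat.{u} f (pullbackRing f A).obj U z hz _

/-- The inverse image is used only through its universal property. The germs of `A` define a map `r`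
from `f⁻¹ A` to the product sheaf of the stalks `A_{f z}`; evaluated at `z`, it undoes the stalk
map, whence injectivity. Following `r` by the stalk maps gives the germ map of `f⁻¹ A`, as both
agree on sections from `A`, whence surjectivity. -/
lemma bijective_stalkPullbackRing (f : Z ⟶ X)
    (A : Sheaf (Opens.grothendieckTopology X) RingCat.{u}) (z : Z) :
    Function.Bijective (stalkPullbackRing f A z) := by
  let E := fun z : Z => TopCat.Presheaf.stalk A.obj (f z)
  obtain ⟨r, hr⟩ := exists_pullbackRing_hom f A (godementRing E)
    (toGodementRing f A E fun z => 𝟙 _)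
  constructor
  · intro a a' h
    obtain ⟨U, hU, a, rfl⟩ := TopCat.Presheaf.exists_germ_eq A.obj a
    obtain ⟨U', hU', a', rfl⟩ := TopCat.Presheaf.exists_germ_eq A.obj a'
    have h' := (stalkPullbackRing_germ f A z U hU a).symm.trans
      (h.trans (stalkPullbackRing_germ f A z U' hU' a'))
    obtain ⟨W, hW, i, i', e⟩ := TopCat.Presheaf.germ_eq (pullbackRing f A).obj z _ _ _ _ h'
    have e' := congrArg (fun b => godementRingEval E W z hW (r.hom.app (op W) b)) e
    have key : ∀ (U : Opens X) (hU : f z ∈ U) (a : A.obj.obj (op U))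
        (i : W ⟶ (Opens.map f).obj U),
        godementRingEval E W z hW (r.hom.app (op W)
          ((pullbackRing f A).obj.map i.op ((pullbackRingUnit f A).hom.app (op U) a))) =
        TopCat.Presheaf.germ A.obj U (f z) hU a := by
      intro U hU a i
      refine (congrArg (godementRingEval E W z hW) (NatTrans.naturality_apply r.hom i.op _)).trans ?_
      exact congrArg (godementRingEval E ((Opens.map f).obj U) z hU) (hr U a)
    exact (key U hU a i).symm.trans (e'.trans (key U' hU' a' i'))
  · intro b
    let E' := fun z : Z => TopCat.Presheaf.stalk (pullbackRing f A).obj z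
    let φ : godementRing E ⟶ godementRing E' :=
      { hom :=
        { app := fun U => (RingCat.ofHom (RingHom.pi fun z : (unop U : Opens Z) =>
              (godementRingEval E (unop U) z z.2 ≫ stalkPullbackRing f A z).hom) :
              (godementRing E).obj.obj U ⟶ RingCat.of (∀ z : (unop U : Opens Z), E' z))
          naturality := fun _ _ _ => rfl } }
    let g : pullbackRing f A ⟶ godementRing E' :=
      { hom :=
        { app := fun U => (RingCat.ofHom (RingHom.pi fun z : (unop U : Opens Z) =>
              (TopCat.Presheaf.germ (pullbackRing f A).obj (unop U) z z.2).hom) :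
              (pullbackRing f A).obj.obj U ⟶ RingCat.of (∀ z : (unop U : Opens Z), E' z))
          naturality := by
            intro U V i
            ext a
            refine godementRing_ext E' (unop V) _ _ fun z hz => ?_
            exact TopCat.Presheaf.germ_res_apply (pullbackRing f A).obj i.unop z hz a } }
    have hg : r ≫ φ = g := by
      refine pullbackRing_hom_ext f A _ _ _ fun U a => ?_
      refine godementRing_ext E' _ _ _ fun z hz => ?_
      refine Eq.trans ?_ (stalkPullbackRing_germ f A z U hz a)
      exact congrArg (fun t => stalkPullbackRing f A z (godementRingEval E _ z hz t)) (hr U a)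
    obtain ⟨V, hV, b, rfl⟩ := TopCat.Presheaf.exists_germ_eq (pullbackRing f A).obj b
    refine ⟨godementRingEval E V z hV (r.hom.app (op V) b), ?_⟩
    exact congrArg (fun t : pullbackRing f A ⟶ godementRing E' =>
      godementRingEval E' V z hV (t.hom.app (op V) b)) hg

end GodementRing

/-! ### Stalks of the inverse image of a module. -/

section GodementModule

variable {X Z : TopCat.{u}}

/-- The presheaf of abelian groups `U ↦ ∏_{z ∈ U} E z`. -/
def godementPresheaf (E : Z → AddCommGrpCat.{u}) : TopCat.Presheaf AddCommGrpCat.{u} Z where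
  obj U := AddCommGrpCat.of (∀ z : (unop U : Opens Z), E z)
  map {U V} i := AddCommGrpCat.ofHom (AddMonoidHom.pi fun z : (unop V : Opens Z) =>
    Pi.evalAddMonoidHom (fun z : (unop U : Opens Z) => E z) ⟨z.1, i.unop.le z.2⟩)

lemma isSheaf_godementPresheaf (E : Z → AddCommGrpCat.{u}) :
    TopCat.Presheaf.IsSheaf (godementPresheaf E) :=
  (TopCat.Presheaf.isSheaf_iff_isSheaf_comp (forget AddCommGrpCat.{u}) (godementPresheaf E)).2 (by
    have h := TopCat.Presheaf.toTypes_isSheaf Z fun z => E z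
    exact h)

variable (B : Sheaf (Opens.grothendieckTopology Z) RingCat.{u}) (E : Z → AddCommGrpCat.{u})
  (ρ : ∀ z : Z, TopCat.Presheaf.stalk (C := RingCat.{u}) B.obj z →+* AddMonoid.End (E z))

/-- The action of sections of `B` on sections of `U ↦ ∏_{z ∈ U} E z` which is given by an action of
the stalks of `B`. -/
abbrev godementModule (U : (Opens Z)ᵒᵖ) : Module (B.obj.obj U) ((godementPresheaf E).obj U) where
  smul b s := fun z : (unop U : Opens Z) =>
    ρ z (TopCat.Presheaf.germ B.obj (unop U) z z.2 b) ((s : ∀ z : (unop U : Opens Z), E z) z)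
  one_smul s := funext fun z : (unop U : Opens Z) => by
    change ρ z (TopCat.Presheaf.germ B.obj (unop U) z z.2 1) _ = _
    rw [map_one, map_one]
    rfl
  mul_smul b b' s := funext fun z : (unop U : Opens Z) => by
    change ρ z (TopCat.Presheaf.germ B.obj (unop U) z z.2 (b * b')) _ = _
    rw [map_mul, map_mul]
    rfl
  smul_zero b := funext fun z : (unop U : Opens Z) => map_zero (ρ z _)
  smul_add b s t := funext fun z : (unop U : Opens Z) => map_add (ρ z _) _ _
  add_smul b b' s := funext fun z : (unop U : Opens Z) => by
    change ρ z (TopCat.Presheaf.germ B.obj (unop U) z z.2 (b + b')) _ = _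
    rw [map_add, map_add]
    rfl
  zero_smul s := funext fun z : (unop U : Opens Z) => by
    change ρ z (TopCat.Presheaf.germ B.obj (unop U) z z.2 0) _ = _
    rw [map_zero, map_zero]
    rfl

/-- The sheaf of modules `U ↦ ∏_{z ∈ U} E z`, where each `E z` is a module over the stalk
at `z` of the sheaf of rings. -/
def godementSheaf : SheafOfModules.{u} B :=
  letI := fun U => godementModule B E ρ U
  { val := PresheafOfModules.ofPresheaf (godementPresheaf E) (by
      intro U V i b s
      funext z
      have h := TopCat.Presheaf.germ_res_apply B.obj i.unop z.1 z.2 b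
      exact congrArg (fun t => ρ z.1 t ((s : ∀ z : (unop U : Opens Z), E z) ⟨z.1, i.unop.le z.2⟩))
        h.symm)
    isSheaf := isSheaf_godementPresheaf E }

/-- The value at `z` of a section of the sheaf `U ↦ ∏_{z ∈ U} E z`. -/
def godementEval (U : Opens Z) (z : Z) (hz : z ∈ U) :
    (godementSheaf B E ρ).val.obj (op U) →+ E z :=
  Pi.evalAddMonoidHom (fun z : U => E z) ⟨z, hz⟩

variable {B E ρ}

lemma godementSheaf_ext (U : Opens Z) (s t : (godementSheaf B E ρ).val.obj (op U))
    (h : ∀ z hz, godementEval B E ρ U z hz s = godementEval B E ρ U z hz t) : s = t :=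
  funext fun z => h z.1 z.2

end GodementModule

section

variable {X Z : TopCat.{u}} (f : Z ⟶ X) (A : Sheaf (Opens.grothendieckTopology X) RingCat.{u})

/-- The direct image functor from `f⁻¹ A`-modules to `A`-modules. -/
def pushforwardModules : SheafOfModules.{u} (pullbackRing f A) ⥤ SheafOfModules.{u} A :=
  SheafOfModules.pushforward (pullbackRingUnit f A)

/-- The adjunction between inverse and direct images of sheaves of modules. -/
def pullbackPushforwardModules : pullbackModules f A ⊣ pushforwardModules f A :=
  SheafOfModules.pullbackPushforwardAdjunction (pullbackRingUnit f A)

instance pushforwardModules_additive : (pushforwardModules f A).Additive := ⟨fun {_ _ _ _} => rfl⟩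

variable {f A}

/-- A morphism of sheaves of modules from a compatible family of additive maps. -/
def sheafOfModulesHomMk {M N : SheafOfModules.{u} A} (φ : M.val.presheaf ⟶ N.val.presheaf)
    (hφ : ∀ (U : Opens X) (a : A.obj.obj (op U)) (m : M.val.obj (op U)),
      φ.app (op U) (a • m) = a • (φ.app (op U) m : N.val.obj (op U))) : M ⟶ N :=
  ⟨PresheafOfModules.homMk φ fun U => hφ (unop U)⟩

variable {B : Sheaf (Opens.grothendieckTopology Z) RingCat.{u}} {E : Z → AddCommGrpCat.{u}}
  {ρ : ∀ z : Z, TopCat.Presheaf.stalk (C := RingCat.{u}) B.obj z →+* AddMonoid.End (E z)}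

/-- A family of linear maps `N_z ⟶ E z` induces a morphism from `N` to `U ↦ ∏_{z ∈ U} E z`. -/
def toGodement (N : SheafOfModules.{u} B) (k : ∀ z, (SheafOfModules.stalkFunctor B z).obj N ⟶ E z)
    (hk : ∀ z U (hz : z ∈ U) (b : B.obj.obj (op U)) (n : N.val.obj (op U)),
      k z (TopCat.Presheaf.germ (C := AddCommGrpCat.{u}) N.val.presheaf U z hz (b • n)) =
        ρ z (TopCat.Presheaf.germ B.obj U z hz b)
          (k z (TopCat.Presheaf.germ (C := AddCommGrpCat.{u}) N.val.presheaf U z hz n))) :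
    N ⟶ godementSheaf B E ρ :=
  sheafOfModulesHomMk
    { app := fun U => (AddCommGrpCat.ofHom (AddMonoidHom.pi fun z : (unop U : Opens Z) =>
        (TopCat.Presheaf.germ (C := AddCommGrpCat.{u}) N.val.presheaf (unop U) z z.2 ≫ k z).hom) :
          N.val.presheaf.obj U ⟶ AddCommGrpCat.of (∀ z : (unop U : Opens Z), E z))
      naturality := by
        intro U V i
        ext n
        refine godementSheaf_ext (B := B) (ρ := ρ) (unop V) _ _ fun z hz => ?_
        exact congrArg (k z) (TopCat.Presheaf.germ_res_apply (C := AddCommGrpCat.{u})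
          N.val.presheaf i.unop z hz n) }
    (by
      intro U b n
      refine godementSheaf_ext (B := B) (ρ := ρ) U _ _ fun z hz => ?_
      exact hk z U hz b n)

/-- A family of semilinear maps `M_{f z} ⟶ E z` induces a morphism from `M` to the direct image of
`U ↦ ∏_{z ∈ U} E z`. -/
def toPushforwardGodement {E : Z → AddCommGrpCat.{u}}
    {ρ : ∀ z : Z, TopCat.Presheaf.stalk (C := RingCat.{u}) (pullbackRing f A).obj z →+*
      AddMonoid.End (E z)} (M : SheafOfModules.{u} A)
    (k : ∀ z, (SheafOfModules.stalkFunctor A (f z)).obj M ⟶ E z)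
    (hk : ∀ z U (hz : f z ∈ U) (a : A.obj.obj (op U)) (m : M.val.obj (op U)),
      k z (TopCat.Presheaf.germ (C := AddCommGrpCat.{u}) M.val.presheaf U (f z) hz (a • m)) =
        ρ z (stalkPullbackRing f A z (TopCat.Presheaf.germ A.obj U (f z) hz a))
          (k z (TopCat.Presheaf.germ (C := AddCommGrpCat.{u}) M.val.presheaf U (f z) hz m))) :
    M ⟶ (pushforwardModules f A).obj (godementSheaf (pullbackRing f A) E ρ) :=
  sheafOfModulesHomMk
    { app := fun U => (AddCommGrpCat.ofHom (AddMonoidHom.pi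
        fun z : (Opens.map f).obj (unop U) =>
        (TopCat.Presheaf.germ (C := AddCommGrpCat.{u}) M.val.presheaf (unop U) (f z) z.2 ≫
          k z).hom) :
          M.val.presheaf.obj U ⟶ AddCommGrpCat.of (∀ z : (Opens.map f).obj (unop U), E z))
      naturality := by
        intro U V i
        ext m
        refine godementSheaf_ext (B := pullbackRing f A) (ρ := ρ) ((Opens.map f).obj (unop V)) _ _
          fun z hz => ?_
        exact congrArg (k z) (TopCat.Presheaf.germ_res_apply (C := AddCommGrpCat.{u})
          M.val.presheaf i.unop (f z) hz m) }
    (by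
      intro U a m
      refine godementSheaf_ext (B := pullbackRing f A) (ρ := ρ) ((Opens.map f).obj U) _ _
        fun z hz => ?_
      refine (hk z U hz a m).trans ?_
      exact congrArg (fun t => ρ z t (k z (TopCat.Presheaf.germ (C := AddCommGrpCat.{u})
        M.val.presheaf U (f z) hz m))) (stalkPullbackRing_germ f A z U hz a))

/-- The morphism between sheaves `U ↦ ∏_{z ∈ U} E z` induced by linear maps on the factors. -/
def godementMap {E' : Z → AddCommGrpCat.{u}}
    {ρ' : ∀ z : Z, TopCat.Presheaf.stalk (C := RingCat.{u}) B.obj z →+* AddMonoid.End (E' z)}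
    (k : ∀ z, E z ⟶ E' z) (hk : ∀ z b e, k z (ρ z b e) = ρ' z b (k z e)) :
    godementSheaf B E ρ ⟶ godementSheaf B E' ρ' :=
  sheafOfModulesHomMk
    { app := fun U => (AddCommGrpCat.ofHom (AddMonoidHom.pi fun z : (unop U : Opens Z) =>
        (k z).hom.comp (godementEval B E ρ (unop U) z z.2)) :
          AddCommGrpCat.of (∀ z : (unop U : Opens Z), E z) ⟶
            AddCommGrpCat.of (∀ z : (unop U : Opens Z), E' z))
      naturality := fun _ _ _ => rfl }
    (by
      intro U b s
      refine godementSheaf_ext (B := B) (ρ := ρ') U _ _ fun z hz => ?_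
      exact hk z _ _)

end

section

variable {X Z : TopCat.{u}} (f : Z ⟶ X) (A : Sheaf (Opens.grothendieckTopology X) RingCat.{u})

/-- The canonical morphism `(f_* P)_{f z} ⟶ P_z`. -/
def stalkPushforwardModules (z : Z) :
    pushforwardModules f A ⋙ SheafOfModules.stalkFunctor A (f z) ⟶
      SheafOfModules.stalkFunctor (pullbackRing f A) z where
  app P := TopCat.Presheaf.stalkPushforward AddCommGrpCat.{u} f P.val.presheaf z
  naturality P P' g := by
    ext p
    obtain ⟨U, hU, p, rfl⟩ := TopCat.Presheaf.exists_germ_eq (C := AddCommGrpCat.{u})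
      ((pushforwardModules f A).obj P).val.presheaf p
    refine (congrArg (TopCat.Presheaf.stalkPushforward AddCommGrpCat.{u} f P'.val.presheaf z)
      (TopCat.Presheaf.stalkFunctor_map_germ_apply (C := AddCommGrpCat.{u}) U (f z) hU
        ((SheafOfModules.toSheaf A).map ((pushforwardModules f A).map g)).hom p)).trans ?_
    refine (TopCat.Presheaf.stalkPushforward_germ_apply AddCommGrpCat.{u} f P'.val.presheaf U z
      hU _).trans ?_
    refine Eq.trans ?_ (congrArg ((SheafOfModules.stalkFunctor (pullbackRing f A) z).map g)
      (TopCat.Presheaf.stalkPushforward_germ_apply AddCommGrpCat.{u} f P.val.presheaf U z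
        hU p).symm)
    exact (TopCat.Presheaf.stalkFunctor_map_germ_apply (C := AddCommGrpCat.{u})
      ((Opens.map f).obj U) z hU
        ((SheafOfModules.toSheaf (pullbackRing f A)).map g).hom p).symm

lemma stalkPushforwardModules_germ (P : SheafOfModules.{u} (pullbackRing f A)) (z : Z)
    (U : Opens X) (hz : f z ∈ U) (p : P.val.obj (op ((Opens.map f).obj U))) :
    (stalkPushforwardModules f A z).app P (TopCat.Presheaf.germ (C := AddCommGrpCat.{u})
      ((pushforwardModules f A).obj P).val.presheaf U (f z) hz p) =
      TopCat.Presheaf.germ (C := AddCommGrpCat.{u}) P.val.presheaf ((Opens.map f).obj U) z hz p :=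
  TopCat.Presheaf.stalkPushforward_germ_apply AddCommGrpCat.{u} f P.val.presheaf U z hz p

/-- The canonical morphism `M_{f z} ⟶ (f^* M)_z`. -/
def stalkPullbackModules (z : Z) :
    SheafOfModules.stalkFunctor A (f z) ⟶
      pullbackModules f A ⋙ SheafOfModules.stalkFunctor (pullbackRing f A) z :=
  Functor.whiskerRight (pullbackPushforwardModules f A).unit (SheafOfModules.stalkFunctor A (f z)) ≫
    Functor.whiskerLeft (pullbackModules f A) (stalkPushforwardModules f A z)

lemma stalkPullbackModules_germ (M : SheafOfModules.{u} A) (z : Z)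
    (U : Opens X) (hz : f z ∈ U) (m : M.val.obj (op U)) :
    (stalkPullbackModules f A z).app M
        (TopCat.Presheaf.germ (C := AddCommGrpCat.{u}) M.val.presheaf U (f z) hz m) =
      TopCat.Presheaf.germ (C := AddCommGrpCat.{u}) ((pullbackModules f A).obj M).val.presheaf
        ((Opens.map f).obj U) z hz
        (((pullbackPushforwardModules f A).unit.app M).val.app (op U) m) := by
  refine (congrArg ((stalkPushforwardModules f A z).app ((pullbackModules f A).obj M))
    (TopCat.Presheaf.stalkFunctor_map_germ_apply (C := AddCommGrpCat.{u}) U (f z) hz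
      ((SheafOfModules.toSheaf A).map ((pullbackPushforwardModules f A).unit.app M)).hom m)).trans ?_
  exact stalkPushforwardModules_germ f A ((pullbackModules f A).obj M) z U hz _

end

section

variable {X : TopCat.{u}} {A : Sheaf (Opens.grothendieckTopology X) RingCat.{u}}

/-- The action of the stalk of `A` at `x` on the stalk of an `A`-module at `x`. -/
def stalkAction (M : SheafOfModules.{u} A) (x : X) :
    TopCat.Presheaf.stalk (C := RingCat.{u}) A.obj x →+*
      AddMonoid.End ((SheafOfModules.stalkFunctor A x).obj M) :=
  Module.toAddMonoidEnd (TopCat.Presheaf.stalk (C := RingCat.{u}) A.obj x)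
    (TopCat.Presheaf.stalk (C := AddCommGrpCat.{u}) M.val.presheaf x)

lemma stalkAction_germ (M : SheafOfModules.{u} A) (x : X) (U : Opens X) (hx : x ∈ U)
    (a : A.obj.obj (op U)) (m : M.val.obj (op U)) :
    stalkAction M x (TopCat.Presheaf.germ A.obj U x hx a)
        (TopCat.Presheaf.germ (C := AddCommGrpCat.{u}) M.val.presheaf U x hx m) =
      TopCat.Presheaf.germ (C := AddCommGrpCat.{u}) M.val.presheaf U x hx (a • m) :=
  (PresheafOfModules.germ_ringCat_smul M.val x U hx a m).symm

end

section

variable {X Z : TopCat.{u}} (f : Z ⟶ X) (A : Sheaf (Opens.grothendieckTopology X) RingCat.{u})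

lemma exists_pullbackModules_hom (M : SheafOfModules.{u} A)
    (N : SheafOfModules.{u} (pullbackRing f A)) (k : M ⟶ (pushforwardModules f A).obj N) :
    ∃ r : (pullbackModules f A).obj M ⟶ N, ∀ (U : Opens X) (m : M.val.obj (op U)),
      r.val.app (op ((Opens.map f).obj U))
        (((pullbackPushforwardModules f A).unit.app M).val.app (op U) m) =
        k.val.app (op U) m := by
  let adj := pullbackPushforwardModules f A
  refine ⟨(adj.homEquiv M N).symm k, fun U m => ?_⟩
  have h := (adj.homEquiv_unit M N ((adj.homEquiv M N).symm k)).symm.trans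
    ((adj.homEquiv M N).apply_symm_apply k)
  exact congrArg (fun φ : M ⟶ (pushforwardModules f A).obj N => φ.val.app (op U) m) h

lemma pullbackModules_hom_ext (M : SheafOfModules.{u} A)
    (N : SheafOfModules.{u} (pullbackRing f A)) (g h : (pullbackModules f A).obj M ⟶ N)
    (hgh : ∀ (U : Opens X) (m : M.val.obj (op U)),
      g.val.app (op ((Opens.map f).obj U))
        (((pullbackPushforwardModules f A).unit.app M).val.app (op U) m) =
      h.val.app (op ((Opens.map f).obj U))
        (((pullbackPushforwardModules f A).unit.app M).val.app (op U) m)) : g = h := by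
  let adj := pullbackPushforwardModules f A
  apply (adj.homEquiv M N).injective
  refine (adj.homEquiv_unit M N g).trans (Eq.trans ?_ (adj.homEquiv_unit M N h).symm)
  apply SheafOfModules.hom_ext
  apply PresheafOfModules.hom_ext
  intro U
  apply ModuleCat.hom_ext
  exact LinearMap.ext fun m => hgh (unop U) m

/-- The stalk of `A` at `f z`, identified with the stalk of `f⁻¹ A` at `z`. -/
def stalkPullbackRingEquiv (z : Z) :
    TopCat.Presheaf.stalk (C := RingCat.{u}) A.obj (f z) ≃+*
      TopCat.Presheaf.stalk (C := RingCat.{u}) (pullbackRing f A).obj z :=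
  RingEquiv.ofBijective (stalkPullbackRing f A z).hom (bijective_stalkPullbackRing f A z)

lemma stalkPullbackModules_smul (M : SheafOfModules.{u} A) (z : Z)
    (a : TopCat.Presheaf.stalk (C := RingCat.{u}) A.obj (f z))
    (m : (SheafOfModules.stalkFunctor A (f z)).obj M) :
    (stalkPullbackModules f A z).app M (stalkAction M (f z) a m) =
      stalkAction ((pullbackModules f A).obj M) z (stalkPullbackRing f A z a)
        ((stalkPullbackModules f A z).app M m) := by
  obtain ⟨U, hU, a, rfl⟩ := TopCat.Presheaf.exists_germ_eq A.obj a
  obtain ⟨V, hVU, hV, m, rfl⟩ := TopCat.Presheaf.exists_le_germ_eq (C := AddCommGrpCat.{u})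
    M.val.presheaf m hU
  rw [← TopCat.Presheaf.germ_res_apply A.obj (homOfLE hVU) (f z) hV a]
  generalize A.obj.map (homOfLE hVU).op a = b
  refine (congrArg ((stalkPullbackModules f A z).app M) (stalkAction_germ M (f z) V hV b m)).trans ?_
  refine (stalkPullbackModules_germ f A M z V hV (b • m)).trans ?_
  refine Eq.trans (congrArg (TopCat.Presheaf.germ (C := AddCommGrpCat.{u})
    ((pullbackModules f A).obj M).val.presheaf ((Opens.map f).obj V) z hV)
    ((((pullbackPushforwardModules f A).unit.app M).val.app (op V)).hom.map_smul b m)) ?_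
  refine Eq.trans (stalkAction_germ ((pullbackModules f A).obj M) z ((Opens.map f).obj V) hV
    ((pullbackRingUnit f A).hom.app (op V) b)
    (((pullbackPushforwardModules f A).unit.app M).val.app (op V) m)).symm ?_
  exact congr (congrArg (fun b p => stalkAction ((pullbackModules f A).obj M) z b p)
    (stalkPullbackRing_germ f A z V hV b).symm) (stalkPullbackModules_germ f A M z V hV m).symm

/-- The argument is that of `bijective_stalkPullbackRing`. The stalk of `f⁻¹ A` at `z` acts on `M_{f
z}` through the inverse of the ring isomorphism just obtained. -/
lemma bijective_stalkPullbackModules_app (M : SheafOfModules.{u} A) (z : Z) :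
    Function.Bijective ((stalkPullbackModules f A z).app M) := by
  let P := (pullbackModules f A).obj M
  let E := fun z : Z => (SheafOfModules.stalkFunctor A (f z)).obj M
  let ρ := fun z : Z => (stalkAction M (f z)).comp
    (stalkPullbackRingEquiv f A z).symm.toRingHom
  have hρ : ∀ z a, ρ z (stalkPullbackRing f A z a) = stalkAction M (f z) a := fun z a =>
    congrArg (stalkAction M (f z)) ((stalkPullbackRingEquiv f A z).symm_apply_apply a)
  obtain ⟨r, hr⟩ := exists_pullbackModules_hom f A M (godementSheaf (pullbackRing f A) E ρ)
    (toPushforwardGodement M (fun z => 𝟙 _) (by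
      intro z U hz a m
      refine (stalkAction_germ M (f z) U hz a m).symm.trans ?_
      exact congrArg (fun t : AddMonoid.End (E z) =>
        t (TopCat.Presheaf.germ (C := AddCommGrpCat.{u}) M.val.presheaf U (f z) hz m)) (hρ z _).symm))
  have hr' : ∀ (U : Opens X) (z : Z) (hz : f z ∈ U) (m : M.val.obj (op U)),
      godementEval (pullbackRing f A) E ρ ((Opens.map f).obj U) z hz
        (r.val.app (op ((Opens.map f).obj U))
          (((pullbackPushforwardModules f A).unit.app M).val.app (op U) m)) =
      TopCat.Presheaf.germ (C := AddCommGrpCat.{u}) M.val.presheaf U (f z) hz m := fun U z hz m =>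
    congrArg (godementEval (pullbackRing f A) E ρ ((Opens.map f).obj U) z hz) (hr U m)
  constructor
  · intro m m' h
    obtain ⟨U, hU, m, rfl⟩ := TopCat.Presheaf.exists_germ_eq (C := AddCommGrpCat.{u})
      M.val.presheaf m
    obtain ⟨U', hU', m', rfl⟩ := TopCat.Presheaf.exists_germ_eq (C := AddCommGrpCat.{u})
      M.val.presheaf m'
    have h' := (stalkPullbackModules_germ f A M z U hU m).symm.trans
      (h.trans (stalkPullbackModules_germ f A M z U' hU' m'))
    obtain ⟨W, hW, i, i', e⟩ := TopCat.Presheaf.germ_eq (C := AddCommGrpCat.{u})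
      P.val.presheaf z _ _ _ _ h'
    have e' := congrArg (fun p => godementEval (pullbackRing f A) E ρ W z hW (r.val.app (op W) p)) e
    have key : ∀ (U : Opens X) (hU : f z ∈ U) (m : M.val.obj (op U))
        (i : W ⟶ (Opens.map f).obj U),
        godementEval (pullbackRing f A) E ρ W z hW (r.val.app (op W) (P.val.presheaf.map i.op
          (((pullbackPushforwardModules f A).unit.app M).val.app (op U) m))) =
        TopCat.Presheaf.germ (C := AddCommGrpCat.{u}) M.val.presheaf U (f z) hU m := by
      intro U hU m i
      refine Eq.trans ?_ (hr' U z hU m)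
      exact congrArg (godementEval (pullbackRing f A) E ρ W z hW)
        (PresheafOfModules.naturality_apply r.val i.op _)
    exact (key U hU m i).symm.trans (e'.trans (key U' hU' m' i'))
  · intro p
    let E' := fun z : Z => (SheafOfModules.stalkFunctor (pullbackRing f A) z).obj P
    let φ : godementSheaf (pullbackRing f A) E ρ ⟶
        godementSheaf (pullbackRing f A) E' (stalkAction P) :=
      godementMap (fun z => (stalkPullbackModules f A z).app M) (by
        intro z b m
        obtain ⟨a, rfl⟩ := (bijective_stalkPullbackRing f A z).surjective b
        refine Eq.trans ?_ (stalkPullbackModules_smul f A M z a m)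
        exact congrArg (fun t : AddMonoid.End (E z) => (stalkPullbackModules f A z).app M (t m))
          (hρ z a))
    let g : P ⟶ godementSheaf (pullbackRing f A) E' (stalkAction P) :=
      toGodement P (fun z => 𝟙 _) (fun z U hz b n => (stalkAction_germ P z U hz b n).symm)
    have hg : r ≫ φ = g := by
      refine pullbackModules_hom_ext f A _ _ _ _ fun U m => ?_
      refine godementSheaf_ext (B := pullbackRing f A) (ρ := stalkAction P) _ _ _ fun z hz => ?_
      refine Eq.trans ?_ (stalkPullbackModules_germ f A M z U hz m)
      exact congrArg ((stalkPullbackModules f A z).app M) (hr' U z hz m)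
    obtain ⟨V, hV, p, rfl⟩ := TopCat.Presheaf.exists_germ_eq (C := AddCommGrpCat.{u})
      P.val.presheaf p
    refine ⟨godementEval (pullbackRing f A) E ρ V z hV (r.val.app (op V) p), ?_⟩
    exact congrArg (fun t : P ⟶ godementSheaf (pullbackRing f A) E' (stalkAction P) =>
      godementEval (pullbackRing f A) E' (stalkAction P) V z hV (t.val.app (op V) p)) hg

instance isIso_stalkPullbackModules (z : Z) : IsIso (stalkPullbackModules f A z) := by
  rw [NatTrans.isIso_iff_isIso_app]
  intro M
  exact (ConcreteCategory.isIso_iff_bijective _).2 (bijective_stalkPullbackModules_app f A M z)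

end

/-! ### Exactness of inverse and direct images. -/

namespace SheafOfModules

variable {X : TopCat.{u}} {A : Sheaf (Opens.grothendieckTopology X) RingCat.{u}}

lemma epi_of_stalkFunctor_map_epi {M N : SheafOfModules.{u} A} (f : M ⟶ N)
    (hf : ∀ x, Epi ((stalkFunctor A x).map f)) : Epi f := by
  refine Preadditive.epi_of_isZero_cokernel _ ?_
  rw [isZero_iff_stalkFunctor_obj_isZero]
  intro x
  have := hf x
  exact (isZero_cokernel_of_epi ((stalkFunctor A x).map f)).of_iso
    (PreservesCokernel.iso (stalkFunctor A x) f)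

instance stalkFunctor_preservesMonomorphisms (x : X) :
    (stalkFunctor A x).PreservesMonomorphisms :=
  preservesMonomorphisms_of_preservesLimitsOfShape _

instance stalkFunctor_preservesEpimorphisms (x : X) :
    (stalkFunctor A x).PreservesEpimorphisms :=
  preservesEpimorphisms_of_preservesColimitsOfShape _

end SheafOfModules

section

variable {X Z : TopCat.{u}} (f : Z ⟶ X) (A : Sheaf (Opens.grothendieckTopology X) RingCat.{u})

instance pullbackModules_preservesFiniteColimits :
    PreservesFiniteColimits (pullbackModules f A) := by
  have := (pullbackPushforwardModules f A).leftAdjoint_preservesColimits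
  exact PreservesColimitsOfSize0.preservesFiniteColimits _

instance pushforwardModules_preservesFiniteLimits :
    PreservesFiniteLimits (pushforwardModules f A) := by
  have := (pullbackPushforwardModules f A).rightAdjoint_preservesLimits
  exact PreservesLimitsOfSize0.preservesFiniteLimits _

/-- The isomorphism `M_{f z} ≅ (f^* M)_z`. -/
def stalkPullbackModulesIso (z : Z) :
    SheafOfModules.stalkFunctor A (f z) ≅
      pullbackModules f A ⋙ SheafOfModules.stalkFunctor (pullbackRing f A) z :=
  asIso (stalkPullbackModules f A z)

/-- The scalars are pulled back too, so no tensor product intervenes and stalks are unchanged. -/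
instance pullbackModules_preservesMonomorphisms :
    (pullbackModules f A).PreservesMonomorphisms where
  preserves g _ := by
    refine SheafOfModules.mono_of_stalkFunctor_map_mono _ fun z => ?_
    exact ((MorphismProperty.monomorphisms _).arrow_mk_iso_iff
      (((Functor.mapArrowFunctor _ _).mapIso (stalkPullbackModulesIso f A z)).app
        (Arrow.mk g))).1 (inferInstanceAs (Mono ((SheafOfModules.stalkFunctor A (f z)).map g)))

instance pullbackModules_preservesFiniteLimits :
    PreservesFiniteLimits (pullbackModules f A) := by
  have := (pullbackModules f A).preservesHomology_of_preservesMonos_and_cokernels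
  exact (pullbackModules f A).preservesFiniteLimits_of_preservesHomology

/-- A neighbourhood of `x` missing the closure of the range has empty preimage, so the direct image
has only zero sections there. -/
lemma isZero_stalkFunctor_pushforwardModules (P : SheafOfModules.{u} (pullbackRing f A)) (x : X)
    (hx : x ∉ closure (Set.range f)) :
    IsZero ((SheafOfModules.stalkFunctor A x).obj ((pushforwardModules f A).obj P)) := by
  have : Subsingleton ((SheafOfModules.stalkFunctor A x).obj
      ((pushforwardModules f A).obj P)) := by
    let V : Opens X := ⟨(closure (Set.range f))ᶜ, isClosed_closure.isOpen_compl⟩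
    refine subsingleton_of_forall_eq 0 fun p => ?_
    obtain ⟨U, hU, hx', p, rfl⟩ := TopCat.Presheaf.exists_le_germ_eq (C := AddCommGrpCat.{u})
      ((pushforwardModules f A).obj P).val.presheaf p (V := V) hx
    have hp : p = 0 := by
      refine TopCat.Presheaf.section_ext (C := AddCommGrpCat.{u})
        ((SheafOfModules.toSheaf (pullbackRing f A)).obj P) ((Opens.map f).obj U) _ _
        fun z hz => ?_
      exact (hU hz (subset_closure ⟨z, rfl⟩)).elim
    rw [hp]
    exact map_zero _
  exact AddCommGrpCat.isZero_of_subsingleton _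

variable {f}

lemma isIso_stalkPushforwardModules (hf : Topology.IsInducing f) (z : Z) :
    IsIso (stalkPushforwardModules f A z) := by
  rw [NatTrans.isIso_iff_isIso_app]
  intro P
  exact TopCat.Presheaf.stalkPushforward.stalkPushforward_iso_of_isInducing AddCommGrpCat.{u} hf
    P.val.presheaf z

lemma isIso_stalkFunctor_map_unit (hf : Topology.IsInducing f) (M : SheafOfModules.{u} A) (z : Z) :
    IsIso ((SheafOfModules.stalkFunctor A (f z)).map
      ((pullbackPushforwardModules f A).unit.app M)) := by
  have := isIso_stalkPushforwardModules A hf z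
  have h : IsIso ((SheafOfModules.stalkFunctor A (f z)).map
      ((pullbackPushforwardModules f A).unit.app M) ≫
      (stalkPushforwardModules f A z).app ((pullbackModules f A).obj M)) :=
    inferInstanceAs (IsIso ((stalkPullbackModules f A z).app M))
  exact IsIso.of_isIso_comp_right _
    ((stalkPushforwardModules f A z).app ((pullbackModules f A).obj M))

/-- By the triangle identity the direct image of the counit is inverse, on the stalk at `f z`, to
the unit, which is an isomorphism there. -/
lemma isIso_counit_app (hf : Topology.IsInducing f) (P : SheafOfModules.{u} (pullbackRing f A)) :
    IsIso ((pullbackPushforwardModules f A).counit.app P) := by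
  rw [SheafOfModules.isIso_iff_stalkFunctor_map_isIso]
  intro z
  have := isIso_stalkPushforwardModules A hf z
  have h₁ := isIso_stalkFunctor_map_unit A hf ((pushforwardModules f A).obj P) z
  have h₂ : IsIso ((SheafOfModules.stalkFunctor A (f z)).map ((pushforwardModules f A).map
      ((pullbackPushforwardModules f A).counit.app P))) := by
    have h := congrArg (SheafOfModules.stalkFunctor A (f z)).map
      ((pullbackPushforwardModules f A).right_triangle_components P)
    rw [Functor.map_comp] at h
    have h' : IsIso ((SheafOfModules.stalkFunctor A (f z)).map
      ((pullbackPushforwardModules f A).unit.app ((pushforwardModules f A).obj P)) ≫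
        (SheafOfModules.stalkFunctor A (f z)).map ((pushforwardModules f A).map
          ((pullbackPushforwardModules f A).counit.app P))) := by
      rw [h]
      infer_instance
    exact IsIso.of_isIso_comp_left ((SheafOfModules.stalkFunctor A (f z)).map
      ((pullbackPushforwardModules f A).unit.app ((pushforwardModules f A).obj P))) _
  exact (NatIso.isIso_map_iff (asIso (stalkPushforwardModules f A z)) _).1 h₂

lemma isIso_counit (hf : Topology.IsInducing f) : IsIso (pullbackPushforwardModules f A).counit := by
  rw [NatTrans.isIso_iff_isIso_app]
  exact isIso_counit_app A hf

/-- Epimorphisms are tested on stalks: on the closed range these are the stalks upstairs, and off it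
they vanish. -/
lemma pushforwardModules_preservesFiniteColimits (hf : Topology.IsClosedEmbedding f) :
    PreservesFiniteColimits (pushforwardModules f A) := by
  have : (pushforwardModules f A).PreservesEpimorphisms :=
    { preserves := by
        intro P Q g _
        refine SheafOfModules.epi_of_stalkFunctor_map_epi _ fun x => ?_
        by_cases hx : x ∈ Set.range f
        · obtain ⟨z, rfl⟩ := hx
          have := isIso_stalkPushforwardModules A hf.isInducing z
          exact ((MorphismProperty.epimorphisms _).arrow_mk_iso_iff
            (((Functor.mapArrowFunctor _ _).mapIso (asIso (stalkPushforwardModules f A z))).app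
              (Arrow.mk g))).2
                (inferInstanceAs (Epi ((SheafOfModules.stalkFunctor (pullbackRing f A) z).map g)))
        · refine (isZero_stalkFunctor_pushforwardModules f A Q x ?_).epi _
          rwa [hf.isClosed_range.closure_eq] }
  have := (pushforwardModules f A).preservesHomology_of_preservesEpis_and_kernels
  exact (pushforwardModules f A).preservesFiniteColimits_of_preservesHomology

end

/-! ### Modules supported on a locally closed subspace. -/

section

variable {X : TopCat.{u}} {A : Sheaf (Opens.grothendieckTopology X) RingCat.{u}} {Y : Set X}

lemma isInducing_subspaceIncl : Topology.IsInducing (subspaceIncl Y) :=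
  Topology.IsInducing.subtypeVal

lemma range_subspaceIncl : Set.range (subspaceIncl Y) = Y := Subtype.range_coe

lemma isClosedEmbedding_subspaceIncl (hY : IsClosed Y) :
    Topology.IsClosedEmbedding (subspaceIncl Y) :=
  hY.isClosedEmbedding_subtypeVal

lemma supportedOn_pushforward (hY : IsClosed Y) (P : SheafOfModules.{u} (restrictRing A Y)) :
    supportedOn A Y ((pushforwardModules (subspaceIncl Y) A).obj P) := fun x hx =>
  isZero_stalkFunctor_pushforwardModules (subspaceIncl Y) A P x
    (by rwa [range_subspaceIncl, hY.closure_eq])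

variable (A Y) in
/-- The adjunction between the restriction to a subspace and the direct image. -/
abbrev restrictionAdjunction :
    pullbackModules (subspaceIncl Y) A ⊣ pushforwardModules (subspaceIncl Y) A :=
  pullbackPushforwardModules (subspaceIncl Y) A

lemma isIso_stalkFunctor_map_unit_of_mem (M : SheafOfModules.{u} A) (x : X) (hx : x ∈ Y) :
    IsIso ((SheafOfModules.stalkFunctor A x).map ((restrictionAdjunction A Y).unit.app M)) :=
  isIso_stalkFunctor_map_unit A isInducing_subspaceIncl M (⟨x, hx⟩ : Y)

lemma isIso_unit_app_of_supportedOn (hY : IsClosed Y) (M : SheafOfModules.{u} A)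
    (hM : supportedOn A Y M) : IsIso ((restrictionAdjunction A Y).unit.app M) := by
  rw [SheafOfModules.isIso_iff_stalkFunctor_map_isIso]
  intro x
  by_cases hx : x ∈ Y
  · exact isIso_stalkFunctor_map_unit_of_mem M x hx
  · exact isIso_of_source_target_iso_zero _ (hM x hx).isoZero
      (supportedOn_pushforward hY _ x hx).isoZero

lemma isZero_restriction {T : Set X} (M : SheafOfModules.{u} A) (hM : supportedOn A Y M)
    (hT : Disjoint Y T) : IsZero ((pullbackModules (subspaceIncl T) A).obj M) := by
  rw [SheafOfModules.isZero_iff_stalkFunctor_obj_isZero]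
  intro z
  exact (hM (z : T).1 (hT.notMem_of_mem_right (z : T).2)).of_iso
    ((stalkPullbackModulesIso (subspaceIncl T) A z).app M).symm

/-- A morphism from a module supported on `Y` to a direct image from `Y` which is an isomorphism
on the stalks at the points of `Y` is a monomorphism. -/
lemma mono_of_supportedOn {M N : SheafOfModules.{u} A} (g : M ⟶ N) (hM : supportedOn A Y M)
    (hg : ∀ x ∈ Y, IsIso ((SheafOfModules.stalkFunctor A x).map g)) : Mono g := by
  refine SheafOfModules.mono_of_stalkFunctor_map_mono _ fun x => ?_
  by_cases hx : x ∈ Y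
  · have := hg x hx
    infer_instance
  · exact (hM x hx).mono _

lemma supportedOn_cokernel {M : SheafOfModules.{u} A} {P : SheafOfModules.{u} (restrictRing A Y)}
    (g : M ⟶ (pushforwardModules (subspaceIncl Y) A).obj P)
    (hg : ∀ x ∈ Y, IsIso ((SheafOfModules.stalkFunctor A x).map g)) :
    supportedOn A (closure Y \ Y) (cokernel g) := by
  intro x hx
  by_cases hx' : x ∈ Y
  · have := hg x hx'
    exact (isZero_cokernel_of_epi ((SheafOfModules.stalkFunctor A x).map g)).of_iso
      (PreservesCokernel.iso (SheafOfModules.stalkFunctor A x) g)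
  · have h : IsZero ((SheafOfModules.stalkFunctor A x).obj
        ((pushforwardModules (subspaceIncl Y) A).obj P)) :=
      isZero_stalkFunctor_pushforwardModules (subspaceIncl Y) A P x
        (by rw [range_subspaceIncl]; exact fun h => hx ⟨h, hx'⟩)
    have he := (SheafOfModules.stalkFunctor A x).map_epi (cokernel.π g)
    exact @IsZero.of_epi _ _ _ _ _ _ he h

/-- This is the form in which local closedness enters the rest of the argument. -/
lemma IsLocallyClosed.isClosed_closure_sdiff (hY : IsLocallyClosed Y) :
    IsClosed (closure Y \ Y) := by
  have h := hY.isOpen_coborder.isClosed_compl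
  rwa [coborder, compl_compl] at h

instance isIso_restrictionAdjunction_counit : IsIso (restrictionAdjunction A Y).counit :=
  isIso_counit A isInducing_subspaceIncl

/-- `C` is the direct image of its restriction to the closed set `T`, and the restriction of `M` to
`T` is zero. -/
lemma eq_zero_of_supportedOn {T : Set X} (hT : IsClosed T) (hYT : Disjoint Y T)
    {M C : SheafOfModules.{u} A} (hM : supportedOn A Y M) (hC : supportedOn A T C) (g : M ⟶ C) :
    g = 0 := by
  have := isIso_unit_app_of_supportedOn hT C hC
  rw [← cancel_mono ((restrictionAdjunction A T).unit.app C), zero_comp]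
  refine ((restrictionAdjunction A T).unit.naturality g).trans ?_
  have h : (pullbackModules (subspaceIncl T) A).map g = 0 :=
    (isZero_restriction M hM hYT).eq_of_src _ _
  refine (congrArg (fun t => (restrictionAdjunction A T).unit.app M ≫
    (pushforwardModules (subspaceIncl T) A).map t) h).trans ?_
  rw [Functor.map_zero, comp_zero]

instance restrictSupported_faithful : (restrictSupported A Y).Faithful where
  map_injective {M N} a b h := by
    have h' : (pullbackModules (subspaceIncl Y) A).map a.hom =
      (pullbackModules (subspaceIncl Y) A).map b.hom := h
    have := mono_of_supportedOn ((restrictionAdjunction A Y).unit.app N.obj) N.property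
      (isIso_stalkFunctor_map_unit_of_mem N.obj)
    apply (supportedOn A Y).ι.map_injective
    refine (cancel_mono ((restrictionAdjunction A Y).unit.app N.obj)).1 ?_
    refine ((restrictionAdjunction A Y).unit.naturality a.hom).trans
      (Eq.trans ?_ ((restrictionAdjunction A Y).unit.naturality b.hom).symm)
    exact congrArg (fun t => (restrictionAdjunction A Y).unit.app M.obj ≫
      (pushforwardModules (subspaceIncl Y) A).map t) h'

/-- The transpose of `g` maps `M` to the direct image of the restriction of `N`, and `N` embeds
there with cokernel supported on `closure Y \ Y`. No nonzero morphism goes from `M` to that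
cokernel, so the transpose lands in `N`. -/
lemma restrictSupported_full (hY : IsLocallyClosed Y) : (restrictSupported A Y).Full where
  map_surjective {M N} g := by
    let adj := restrictionAdjunction A Y
    have := mono_of_supportedOn (adj.unit.app N.obj) N.property
      (isIso_stalkFunctor_map_unit_of_mem N.obj)
    have hC : supportedOn A (closure Y \ Y) (cokernel (adj.unit.app N.obj)) :=
      supportedOn_cokernel (adj.unit.app N.obj) (isIso_stalkFunctor_map_unit_of_mem N.obj)
    let k : M.obj ⟶ (pushforwardModules (subspaceIncl Y) A).obj
      ((pullbackModules (subspaceIncl Y) A).obj N.obj) := (adj.homEquiv _ _) g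
    have hk : k ≫ cokernel.π (adj.unit.app N.obj) = 0 :=
      eq_zero_of_supportedOn hY.isClosed_closure_sdiff Set.disjoint_sdiff_right M.property hC _
    let l : M.obj ⟶ N.obj := Abelian.monoLift (adj.unit.app N.obj) k hk
    have hl : l ≫ adj.unit.app N.obj = k := Abelian.monoLift_comp _ _ _
    refine ⟨(supportedOn A Y).homMk l, ?_⟩
    apply (adj.homEquiv _ _).injective
    refine (adj.homEquiv_unit _ _ _).trans ?_
    exact (adj.unit.naturality l).symm.trans hl

/-- The preimage of `P` is the part of its direct image that restricts to zero on `closure Y \ Y`.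
It has the stalks of the direct image over `Y` and zero stalks elsewhere. -/
lemma restrictSupported_essSurj (hY : IsLocallyClosed Y) : (restrictSupported A Y).EssSurj where
  mem_essImage P := by
    have hT := hY.isClosed_closure_sdiff
    let J := (pushforwardModules (subspaceIncl Y) A).obj P
    let η := (restrictionAdjunction A (closure Y \ Y)).unit.app J
    have hJ : ∀ x ∉ closure Y, IsZero ((SheafOfModules.stalkFunctor A x).obj J) := fun x hx =>
      isZero_stalkFunctor_pushforwardModules (subspaceIncl Y) A P x (by rwa [range_subspaceIncl])
    have hN : supportedOn A Y (kernel η) := by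
      intro x hx
      by_cases hx' : x ∈ closure Y
      · have := isIso_stalkFunctor_map_unit_of_mem (Y := closure Y \ Y) J x ⟨hx', hx⟩
        exact (isZero_kernel_of_mono ((SheafOfModules.stalkFunctor A x).map η)).of_iso
          (PreservesKernel.iso (SheafOfModules.stalkFunctor A x) η)
      · have hm := (SheafOfModules.stalkFunctor A x).map_mono (kernel.ι η)
        exact @IsZero.of_mono _ _ _ _ _ _ hm (hJ x hx')
    have hι : ∀ x ∈ Y, IsIso ((SheafOfModules.stalkFunctor A x).map (kernel.ι η)) := by
      intro x hx
      have h₀ : (SheafOfModules.stalkFunctor A x).map η = 0 :=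
        (supportedOn_pushforward hT _ x fun h => h.2 hx).eq_of_tgt _ _
      have h₁ := (ShortComplex.exact_kernel η).map (SheafOfModules.stalkFunctor A x)
      have h₂ : Epi ((SheafOfModules.stalkFunctor A x).map (kernel.ι η)) := h₁.epi_f h₀
      exact isIso_of_mono_of_epi _
    have h : IsIso ((pullbackModules (subspaceIncl Y) A).map (kernel.ι η)) := by
      rw [SheafOfModules.isIso_iff_stalkFunctor_map_isIso]
      intro z
      have := hι (z : Y).1 (z : Y).2
      exact (NatIso.isIso_map_iff (stalkPullbackModulesIso (subspaceIncl Y) A z) _).1 this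
    exact ⟨⟨kernel η, hN⟩, ⟨@asIso _ _ _ _ _ h ≪≫
      asIso ((restrictionAdjunction A Y).counit.app P)⟩⟩

lemma restrictSupported_isEquivalence (hY : IsLocallyClosed Y) :
    (restrictSupported A Y).IsEquivalence where
  full := restrictSupported_full hY
  essSurj := restrictSupported_essSurj hY

end

/-! ### Exactness of the inclusion, and the theorem. -/

section

variable {X : TopCat.{u}} {A : Sheaf (Opens.grothendieckTopology X) RingCat.{u}}

lemma SheafOfModules.exact_of_stalkFunctor_map_exact (S : ShortComplex (SheafOfModules.{u} A))
    (hS : ∀ x, (S.map (stalkFunctor A x)).Exact) : S.Exact := by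
  rw [ShortComplex.exact_iff_isZero_homology, isZero_iff_stalkFunctor_obj_isZero]
  intro x
  exact ((ShortComplex.exact_iff_isZero_homology _).1 (hS x)).of_iso
    (S.mapHomologyIso (stalkFunctor A x)).symm

variable (A) (Y : Set X) [(restrictSupported A Y).IsEquivalence]

lemma supportedOn_inclusionOfRestriction (V : SheafOfModules.{u} (restrictRing A Y)) :
    supportedOn A Y ((inclusionOfRestriction A Y).obj V) :=
  ((restrictSupported A Y).inv.obj V).property

/-- The restriction to `Y` is a left inverse of the inclusion functor. -/
def inclusionOfRestrictionCompPullback :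
    inclusionOfRestriction A Y ⋙ pullbackModules (subspaceIncl Y) A ≅ 𝟭 _ :=
  (restrictSupported A Y).asEquivalence.counitIso

/-- The stalk at `y ∈ Y` of the inclusion of a module on `Y`. -/
def inclusionOfRestrictionStalkIso (y : subspace Y) :
    inclusionOfRestriction A Y ⋙ SheafOfModules.stalkFunctor A (subspaceIncl Y y) ≅
      SheafOfModules.stalkFunctor (restrictRing A Y) y :=
  Functor.isoWhiskerLeft _ (stalkPullbackModulesIso (subspaceIncl Y) A y) ≪≫
    (Functor.associator _ _ _).symm ≪≫
    Functor.isoWhiskerRight (inclusionOfRestrictionCompPullback A Y) _ ≪≫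
    Functor.leftUnitor _

/-- Stalks at points of `Y` are those of `S`, and stalks elsewhere are zero. -/
lemma inclusionOfRestriction_map_exact (S : ShortComplex (SheafOfModules.{u} (restrictRing A Y)))
    (hS : S.Exact) : (S.map (inclusionOfRestriction A Y)).Exact := by
  refine SheafOfModules.exact_of_stalkFunctor_map_exact _ fun x => ?_
  by_cases hx : x ∈ Y
  · let y : subspace Y := (⟨x, hx⟩ : Y)
    have h := hS.map (SheafOfModules.stalkFunctor (restrictRing A Y) y)
    exact ShortComplex.exact_of_iso
      (S.mapNatIso (inclusionOfRestrictionStalkIso A Y y)).symm h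
  · exact ShortComplex.exact_of_isZero_X₂ _ (supportedOn_inclusionOfRestriction A Y S.X₂ x hx)

lemma inclusionOfRestriction_exact : PreservesFiniteLimits (inclusionOfRestriction A Y) ∧
    PreservesFiniteColimits (inclusionOfRestriction A Y) :=
  ((inclusionOfRestriction A Y).exact_tfae.out 1 3).1 (inclusionOfRestriction_map_exact A Y)

end

end

theorem theorem1 {X : TopCat.{u}} (A : Sheaf (Opens.grothendieckTopology X) RingCat.{u}) (Y : Set X)
    (hY : IsLocallyClosed Y)
    [HasDerivedCategory.{w₁} (SheafOfModules.{u} A)]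
    [HasDerivedCategory.{w₂} (SheafOfModules.{u} (restrictRing A Y))]
    [HasDerivedCategory.{w} AddCommGrpCat.{u}] :
    ∃ _ : (restrictSupported A Y).IsEquivalence, SatisfiesR (inclusionOfRestriction A Y) := by
  have hE := restrictSupported_isEquivalence (A := A) hY
  obtain ⟨hL, hC⟩ := inclusionOfRestriction_exact A Y
  have h₁ : HasRHom (SheafOfModules.{u} A) := hasRHom _
  have h₂ : HasRHom (SheafOfModules.{u} (restrictRing A Y)) := hasRHom _
  refine ⟨hE, hL, hC, h₁, h₂, isIso_RHomComparison_app (inclusionOfRestriction A Y) ?_⟩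
  have hT := hY.isClosed_closure_sdiff
  have := pushforwardModules_preservesFiniteColimits A (isClosedEmbedding_subspaceIncl hT)
  let e := inclusionOfRestrictionCompPullback A Y
  -- This stalkwise isomorphism over `Y` yields both that the map from the inclusion to the direct
  -- image is a monomorphism and that its cokernel is supported on `closure Y \ Y`.
  have hε : ∀ V : SheafOfModules.{u} (restrictRing A Y), ∀ x ∈ Y,
      IsIso ((SheafOfModules.stalkFunctor A x).map
        ((restrictionAdjunction A Y).unit.app ((inclusionOfRestriction A Y).obj V) ≫
          (pushforwardModules (subspaceIncl Y) A).map (e.hom.app V))) := by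
    intro V x hx
    have := isIso_stalkFunctor_map_unit_of_mem ((inclusionOfRestriction A Y).obj V) x hx
    rw [Functor.map_comp]
    infer_instance
  intro K I _
  exact CochainComplex.bijective_mapDerivedCategory_map (restrictionAdjunction A Y)
    (inclusionOfRestriction A Y) e (restrictionAdjunction A (closure Y \ Y))
    (fun V => isZero_restriction _ (supportedOn_inclusionOfRestriction A Y V)
      Set.disjoint_sdiff_right)
    (fun V => mono_of_supportedOn _ (supportedOn_inclusionOfRestriction A Y V) (hε V))
    (fun V => isIso_unit_app_of_supportedOn hT _ (supportedOn_cokernel _ (hε V))) K I
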